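/- Let $g\ge 0$ and let $E=[\mathbf b_0,\mathbf a_0]\setminus\bigcup_{j=1}^g(\mathbf a_j,\mathbf b_j)$ be a finite gap set, $\mathbf b_0<\mathbf a_1<\mathbf b_1<\mathbf a_2<\dots<\mathbf b_g<\mathbf a_0$. Let $\Psi$ be the Ahlfors function of $\overline{\mathbb C}\setminus E$, i.e. the maximizer of $|\lim_{z\to\infty}zf(z)|$ among all holomorphic $f$ on $\overline{\mathbb C}\setminus E$ with $|f|\le 1$ and $f(\infty)=0$, normalized by $\lim_{z\to\infty}z\Psi(z)>0$. Let $\mathbf C=(\mathbf c_1,\dots,\mathbf c_g)$ be a fixed ordering of the (distinct, real) zeros of $\Psi$ in $\mathbb C\setminus E$, and let $\lambda_0,\mathbf c_0,\lambda_1,\dots,\lambda_g$ be the coefficients of $$\Delta_E(z)=\Psi(z)+\frac1{\Psi(z)}=\lambda_0z+\mathbf c_0+\sum_{j=1}^g\frac{\lambda_j}{\mathbf c_j-z},\qquad \lambda_0,\dots,\lambda_g>0 .$$ For a collection $\mathbf C$ of $g$ distinct real points, a bounded operator $A$ on $\ell^2(\mathbb Z)$ is of class $\mathbb A$ (for $\mathbf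 C$) if it is a $(g+1)$-block Jacobi matrix whose $j$-th block row is $A^*(\vec p_j),\,B(\vec p_j,\vec q_j),\,A(\vec p_{j+1})$, where $\vec p_j,\vec q_j\in\mathbb R^{g+1}$ (with entries indexed $0,\dots,g$), the last entry of $\vec p_j$ is positive, $A(\vec p)=\delta_g\vec p^{\,*}$, and $B(\vec p,\vec q)=(\vec q\,\vec p^{\,*})^-+(\vec p\,\vec q^{\,*})^++\mathrm{diag}(\mathbf c_1,\dots,\mathbf c_g,0)$; here $T^-$ is the strictly upper triangular part of $T$ and $T^+=T-T^-$. Let $Se_n=e_{n+1}$. We write $A\in\mathrm{GMP}(\mathbf C)$ if $A$ is of class $\mathbb A$ for $\mathbf C$ and, for every $1\le k\le g$, $\mathbf c_k-A$ is invertible and $S^{-k}(\mathbf c_k-A)^{-1}S^k$ is of class $\mathbb A$ for the collection $y(\mathbf c_{k+1}),\dots,y(\mathbf c_g),0,y(\mathbf c_1),\dots,y(\mathbf c_{k-1})$, $y(x)=1/(\mathbf c_k-x)$. $A$ is periodic with generating coefficients $\vec{\mathbf p}=(\vec p,\vec q)$ if $\vec p_j=\vec p$, $\vec q_j=\vec q$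 for all $j$, and $A(E,\mathbf C)$ is the set of periodic $A\in\mathrm{GMP}(\mathbf C)$ with spectrum $\sigma(A)=E$. With $\mathbf p_m=\begin{bmatrix}p_m\\ q_m\end{bmatrix}$, $\mathfrak j=\begin{bmatrix}0&-1\\1&0\end{bmatrix}$, $\mathfrak a(z,\mathbf c;\mathbf p_m)=I-\frac1{\mathbf c-z}\mathbf p_m\mathbf p_m^*\mathfrak j$ and $\mathfrak a(z;\mathbf p_g)=\begin{bmatrix}0&-p_g\\ 1/p_g&(z-p_gq_g)/p_g\end{bmatrix}$ put $$\Lambda_k(\vec{\mathbf p})=-\operatorname{tr}\Big\{\prod_{m=0}^{k-2}\mathfrak a(\mathbf c_k,\mathbf c_{m+1};\mathbf p_m)\;\mathbf p_{k-1}\mathbf p_{k-1}^*\mathfrak j\;\prod_{m=k}^{g-1}\mathfrak a(\mathbf c_k,\mathbf c_{m+1};\mathbf p_m)\;\mathfrak a(\mathbf c_k;\mathbf p_g)\Big\}$$ (products in increasing order of $m$). **Theorem.** Let $A\in\mathrm{GMP}(\mathbf C)$ be periodic with generating coefficients $\vec{\mathbf p}=(\vec p,\vec q)$. Then $A\in A(E,\mathbf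 C)$ if and only if $$p_g=\frac1{\lambda_0},\qquad q_g=-\mathbf c_0-\lambda_0\sum_{j=0}^{g-1}p_jq_j,\qquad \Lambda_k(\vec{\mathbf p})=\lambda_k\quad(k=1,\dots,g).$$ -/

import Mathlib

/-! ### Finite gap sets and the Ahlfors function -/

/-- `E = [b₀, a₀] \ ⋃ⱼ (aⱼ, bⱼ)` with `g` nondegenerate gaps, listed from left to right, separated
by nondegenerate intervals. -/
def IsFiniteGapSet (g : ℕ) (E : Set ℝ) : Prop :=
  ∃ (b₀ a₀ : ℝ) (a b : Fin g → ℝ),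
    b₀ < a₀ ∧ (∀ j, b₀ < a j) ∧ (∀ j, a j < b j) ∧ (∀ j, b j < a₀) ∧
    (∀ i j, i < j → b i < a j) ∧
    E = Set.Icc b₀ a₀ \ ⋃ j, Set.Ioo (a j) (b j)

/-- `f` is a holomorphic function on the domain `ℂ̄ \ K`, bounded by one in modulus, vanishing at
infinity, and `d = lim_{z → ∞} z f(z)`. Only the values of `f` off `K` matter. -/
structure IsAhlforsCompetitor (K : Set ℂ) (f : ℂ → ℂ) (d : ℂ) : Prop where
  holomorphic : DifferentiableOn ℂ f Kᶜ
  norm_le_one : ∀ z ∈ Kᶜ, ‖f z‖ ≤ 1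
  vanishes : Filter.Tendsto f (Bornology.cobounded ℂ) (nhds 0)
  deriv_infty : Filter.Tendsto (fun z => z * f z) (Bornology.cobounded ℂ) (nhds d)

/-- `Ψ` is the Ahlfors function of `ℂ̄ \ K`: among all competitors it maximizes
`|lim_{z → ∞} z f(z)|`, with the normalization `lim_{z → ∞} z Ψ(z) > 0`. -/
def IsAhlforsFunction (K : Set ℂ) (Ψ : ℂ → ℂ) : Prop :=
  ∃ γ : ℝ, 0 < γ ∧ IsAhlforsCompetitor K Ψ (γ : ℂ) ∧
    ∀ (f : ℂ → ℂ) (d : ℂ), IsAhlforsCompetitor K f d → ‖d‖ ≤ γ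

/-- A real set as a subset of the complex plane. -/
def toComplexSet (E : Set ℝ) : Set ℂ := (fun x : ℝ => (x : ℂ)) '' E

/-! ### The class `𝔸` and GMP matrices -/

/-- The Hilbert space `ℓ²(ℤ)`. -/
abbrev EllTwo : Type := lp (fun _ : ℤ => ℂ) 2

/-- The matrix entry `⟨T eₙ, eₘ⟩` of a bounded operator with respect to the standard basis. -/
noncomputable def entry (T : EllTwo →L[ℂ] EllTwo) (m n : ℤ) : ℂ :=
  T (lp.single 2 n (1 : ℂ)) m

/-- The upper triangular part `T⁻`, excluding the main diagonal. -/
def upperPart {n : ℕ} (T : Matrix (Fin n) (Fin n) ℝ) : Matrix (Fin n) (Fin n) ℝ :=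
  Matrix.of fun i j => if i < j then T i j else 0

/-- The lower triangular part `T⁺ = T - T⁻`, including the main diagonal. -/
def lowerPart {n : ℕ} (T : Matrix (Fin n) (Fin n) ℝ) : Matrix (Fin n) (Fin n) ℝ :=
  T - upperPart T

/-- The diagonal matrix `C̃ = diag(c₁, …, c_g, 0)`. -/
def diagC {g : ℕ} (c : Fin g → ℝ) : Matrix (Fin (g + 1)) (Fin (g + 1)) ℝ :=
  Matrix.diagonal (Fin.snoc (α := fun _ => ℝ) c 0)

/-- The off-diagonal block `A(p) = δ_g p*`. -/
def blockA {g : ℕ} (p : Fin (g + 1) → ℝ) : Matrix (Fin (g + 1)) (Fin (g + 1)) ℝ :=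
  Matrix.vecMulVec (Pi.single (Fin.last g) 1) p

/-- The diagonal block `B(p, q) = (q p*)⁻ + (p q*)⁺ + C̃`. -/
def blockB {g : ℕ} (c : Fin g → ℝ) (p q : Fin (g + 1) → ℝ) :
    Matrix (Fin (g + 1)) (Fin (g + 1)) ℝ :=
  upperPart (Matrix.vecMulVec q p) + lowerPart (Matrix.vecMulVec p q) + diagC c

/-- The block in block row `j` and block column `l` of the block Jacobi matrix whose `j`-th block
row is `A*(p_j), B(p_j, q_j), A(p_{j+1})`. -/
def jacobiBlock {g : ℕ} (c : Fin g → ℝ) (P Q : ℤ → Fin (g + 1) → ℝ) (j l : ℤ) :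
    Matrix (Fin (g + 1)) (Fin (g + 1)) ℝ :=
  if l = j then blockB c (P j) (Q j)
  else if l = j + 1 then blockA (P l)
  else if j = l + 1 then (blockA (P j)).transpose
  else 0

/-- The two-sided matrix `M` is of the class `𝔸` for the ordered collection `c`, with generating
coefficient sequences `(P j, Q j)`, `j ∈ ℤ`. -/
def HasGeneratingCoeffs {g : ℕ} (c : Fin g → ℝ) (P Q : ℤ → Fin (g + 1) → ℝ)
    (M : ℤ → ℤ → ℂ) : Prop :=
  (∀ j, 0 < P j (Fin.last g)) ∧
  ∀ (j l : ℤ) (m n : Fin (g + 1)),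
    M (((g : ℤ) + 1) * j + (m : ℕ)) (((g : ℤ) + 1) * l + (n : ℕ)) =
      ((jacobiBlock c P Q j l m n : ℝ) : ℂ)

/-- The two-sided matrix `M` is of the class `𝔸` for the ordered collection `c`. -/
def IsClassA {g : ℕ} (c : Fin g → ℝ) (M : ℤ → ℤ → ℂ) : Prop :=
  ∃ P Q : ℤ → Fin (g + 1) → ℝ, HasGeneratingCoeffs c P Q M

/-- The matrix `S^{-k} M S^k`, where `S eₙ = eₙ₊₁`. -/
def shiftConj (k : ℕ) (M : ℤ → ℤ → ℂ) : ℤ → ℤ → ℂ :=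
  fun m n => M (m + k) (n + k)

/-- The ordered collection `y(c_{k+1}), …, y(c_g), y(∞) = 0, y(c₁), …, y(c_{k-1})` obtained from
`c₁, …, c_g` by the change of variable `y(x) = 1 / (c_k - x)`. (Here `c_k` is `c k` for the
zero-based index `k : Fin g`.) -/
noncomputable def transformedPoints {g : ℕ} (c : Fin g → ℝ) (k : Fin g) : Fin g → ℝ := fun i =>
  if h : (k : ℕ) + 1 + i < g then 1 / (c k - c ⟨(k : ℕ) + 1 + i, h⟩)
  else if (k : ℕ) + 1 + i = g then 0
  else 1 / (c k - c ⟨(k : ℕ) + 1 + i - (g + 1), by omega⟩)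

/-- `A ∈ GMP(C)`: `A` is of the class `𝔸`, each `c_k - A` is invertible, and
`S^{-k} (c_k - A)⁻¹ S^k`, `k = 1, …, g`, is again of the class `𝔸` (for the points transformed
by `y = 1 / (c_k - x)`). The zero-based index `k : Fin g` stands for `k + 1`. -/
def IsGMP {g : ℕ} (c : Fin g → ℝ) (A : EllTwo →L[ℂ] EllTwo) : Prop :=
  IsClassA c (entry A) ∧
  ∀ k : Fin g, ∃ u : (EllTwo →L[ℂ] EllTwo)ˣ,
    (u : EllTwo →L[ℂ] EllTwo) = (c k : ℂ) • (1 : EllTwo →L[ℂ] EllTwo) - A ∧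
    IsClassA (transformedPoints c k)
      (shiftConj ((k : ℕ) + 1) (entry ((u⁻¹ : (EllTwo →L[ℂ] EllTwo)ˣ) : EllTwo →L[ℂ] EllTwo)))

/-- `A` is one-block periodic with generating coefficients `(p, q)`. -/
def IsPeriodicWith {g : ℕ} (c : Fin g → ℝ) (p q : Fin (g + 1) → ℝ)
    (A : EllTwo →L[ℂ] EllTwo) : Prop :=
  HasGeneratingCoeffs c (fun _ => p) (fun _ => q) (entry A)

/-- The isospectral torus `A(E, C)`: periodic GMP matrices with spectrum `E`. -/
def isospectralTorus {g : ℕ} (E : Set ℝ) (c : Fin g → ℝ) : Set (EllTwo →L[ℂ] EllTwo) :=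
  {A | IsGMP c A ∧ spectrum ℂ A = toComplexSet E ∧ ∃ p q, IsPeriodicWith c p q A}

/-! ### The functions `Λ_k` -/

/-- `𝔧`. -/
def matJ : Matrix (Fin 2) (Fin 2) ℝ := !![0, -1; 1, 0]

/-- `𝔞(z; p, q) = 𝔞(z, ∞; p, q)`. -/
noncomputable def transferInfty (z p q : ℝ) : Matrix (Fin 2) (Fin 2) ℝ :=
  !![0, -p; 1 / p, (z - p * q) / p]

/-- `𝔞(z, c; p, q) = I - (c - z)⁻¹ [p; q] [p q] 𝔧`. -/
noncomputable def transferAt (z c p q : ℝ) : Matrix (Fin 2) (Fin 2) ℝ :=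
  1 - (1 / (c - z)) • (Matrix.vecMulVec ![p, q] ![p, q] * matJ)

/-- `Λ_k(p, q)`; the zero-based index `k : Fin g` stands for `k + 1`, and both products are taken
in increasing order of the index. -/
noncomputable def Lam {g : ℕ} (c : Fin g → ℝ) (p q : Fin (g + 1) → ℝ) (k : Fin g) : ℝ :=
  -Matrix.trace
    ((((List.finRange g).filter (fun m => m < k)).map
        (fun m => transferAt (c k) (c m) (p m.castSucc) (q m.castSucc))).prod *
      (Matrix.vecMulVec ![p k.castSucc, q k.castSucc] ![p k.castSucc, q k.castSucc] * matJ) *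
      (((List.finRange g).filter (fun m => k < m)).map
        (fun m => transferAt (c k) (c m) (p m.castSucc) (q m.castSucc))).prod *
      transferInfty (c k) (p (Fin.last g)) (q (Fin.last g)))

/-! The proof determines both sides of the equivalence through their discriminants.

Write `E` as a union of bands `[l i, r i]`, and let `W = ∏ (z - l i) / (z - r i)`. By
`IsBandSystem.ahlfors_identity` the Ahlfors function satisfies `((1 + Ψ) / (1 - Ψ))² = W` off `E`.
Indeed the Cayley transform of `√W` is a competitor. If a competitor `s` is real on the real
axis, the maximum principle shows that the quotient of `(1 + s) / (1 - s)` by `√W` maps the upper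
half-plane to its closure (`IsBandSystem.im_cayley_div_sqrtRatio_nonneg`); its expansion at infinity
bounds the derivative of `s` there, and equality forces the quotient to be one. A symmetrization
argument, with the maximum principle once more, removes the restriction to real competitors. As a
consequence `Δ = Ψ + 1 / Ψ` satisfies `Δ - 2 = λ₀ ∏ (z - r i) / ∏ (z - c k)` and
`Δ + 2 = λ₀ ∏ (z - l i) / ∏ (z - c k)` (`exists_ahlfors_simplePoleFun`).

For a periodic GMP matrix `A` with coefficients `p, q`, let `U` be the shift by one block. In the
commutative bicommutant of `A` and `U`, the equations for the columns of `A` say that the basis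
vectors of `ℓ²(ℤ)` in one block form a Floquet vector with spectral parameter `A` and multiplier `U`.
Cayley–Hamilton for the monodromy matrix, whose trace has the partial fraction expansion
`trace_monodromy_eq` with residues `Λ_k`, gives the magic formula
`U + U⁻¹ = A / p_g + d + ∑ Λ_k (c k - A)⁻¹` (`IsPeriodicWith.magic_formula`). Comparing matrix entries
gives `Λ_k > 0`, since the inverses `(c k - A)⁻¹` are of the class `𝔸` up to a shift; and with Bloch
vectors it follows that the spectrum of `A` is the preimage of `[-2, 2]` under
`Δ_A = z / p_g + d + ∑ Λ_k / (c k - z)` (`IsPeriodicWith.mem_spectrum_iff`).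

If `Δ_A = Δ`, then the spectrum is the preimage of `[-2, 2]` under `Δ`, which is `E`. If the spectrum
is `E`, then `Δ_A` increases on each band, and takes the values `-2` and `2` at its ends, as `Δ` does.
The difference `Δ_A - Δ` has at most `g + 1` zeros unless it vanishes, while there are `2 g + 2` band
ends; so the coefficients agree (`IsPeriodicWith.spectrum_eq_iff`). -/

section

open Filter Topology Complex

/-! ### The maximum principle and partial fractions -/

/-- A form of the maximum principle without boundary values: a holomorphic function on an open set
whose upper limits at all finite boundary points and at infinity are at most `M` is bounded
by `M`. -/
theorem norm_le_of_eventually_lt_at_boundary {U : Set ℂ} (hU : IsOpen U) {f : ℂ → ℂ} {M : ℝ}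
    (hf : DifferentiableOn ℂ f U)
    (hbd : ∀ x ∉ U, ∀ m > M, ∀ᶠ z in 𝓝[U] x, ‖f z‖ < m)
    (hinf : ∀ m > M, ∀ᶠ z in Bornology.cobounded ℂ, z ∈ U → ‖f z‖ < m) :
    ∀ z ∈ U, ‖f z‖ ≤ M := by
  have key : ∀ m > M, IsCompact {z | z ∈ U ∧ m ≤ ‖f z‖} := by
    intro m hm
    refine Metric.isCompact_of_isClosed_isBounded ?_ ?_
    · rw [← isOpen_compl_iff, isOpen_iff_mem_nhds]
      intro x hx
      by_cases hxU : x ∈ U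
      · have hlt : ‖f x‖ < m := by
          by_contra h
          exact hx ⟨hxU, not_lt.mp h⟩
        have hc : ContinuousAt (fun z => ‖f z‖) x :=
          (hf.differentiableAt (hU.mem_nhds hxU)).continuousAt.norm
        filter_upwards [hc.eventually_lt_const hlt] with z hz h
        exact absurd h.2 (not_le.mpr hz)
      · have := eventually_nhdsWithin_iff.mp (hbd x hxU m hm)
        filter_upwards [this] with z hz h
        exact absurd h.2 (not_le.mpr (hz h.1))
    · rw [Bornology.isBounded_def]
      filter_upwards [hinf m hm] with z hz h
      exact absurd h.2 (not_le.mpr (hz h.1))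
  by_contra! ⟨z₁, hz₁, hlt⟩
  obtain ⟨z₀, hz₀, hmax⟩ := (key _ hlt).exists_isMaxOn ⟨z₁, hz₁, le_rfl⟩
    (f := fun z => ‖f z‖) (fun z hz =>
      (hf.differentiableAt (hU.mem_nhds hz.1)).continuousAt.norm.continuousWithinAt)
  have hmaxU : ∀ z ∈ U, ‖f z‖ ≤ ‖f z₀‖ := by
    intro z hz
    rcases le_total ‖f z₁‖ ‖f z‖ with h | h
    · exact hmax ⟨hz, h⟩
    · exact h.trans hz₀.2
  have hcomp := key ‖f z₀‖ (hlt.trans_le hz₀.2)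
  have hopen : IsOpen {z | z ∈ U ∧ ‖f z₀‖ ≤ ‖f z‖} := by
    rw [isOpen_iff_mem_nhds]
    rintro x ⟨hxU, hx⟩
    have h1 : ∀ᶠ z in 𝓝 x, DifferentiableAt ℂ f z := by
      filter_upwards [hU.mem_nhds hxU] with z hz
      exact hf.differentiableAt (hU.mem_nhds hz)
    have h2 : IsLocalMax (norm ∘ f) x := by
      filter_upwards [hU.mem_nhds hxU] with z hz
      exact (hmaxU z hz).trans hx
    filter_upwards [Complex.eventually_eq_of_isLocalMax_norm h1 h2, hU.mem_nhds hxU] with z hz hzU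
    exact ⟨hzU, by rw [hz]; exact hx⟩
  have huniv := IsClopen.eq_univ ⟨hcomp.isClosed, hopen⟩ ⟨z₀, hz₀.1, le_rfl⟩
  rw [huniv] at hcomp
  exact noncompact_univ ℂ hcomp

/-- A polynomial of degree less than `n`, divided by a product of `n` distinct linear factors. -/
theorem Polynomial.eval_div_prod_sub_eq_sum {n : ℕ} {r : Fin n → ℂ} (hr : Function.Injective r)
    {N : Polynomial ℂ} (hN : N.degree < n) {z : ℂ} (hz : ∀ i, z ≠ r i) :
    N.eval z / ∏ i, (z - r i) =
      ∑ i, N.eval (r i) / (∏ j ∈ Finset.univ.erase i, (r i - r j)) / (z - r i) := by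
  have h1 := Lagrange.eq_interpolate (s := Finset.univ) (v := r) (f := N) hr.injOn (by simpa using hN)
  have h2 := Lagrange.eval_interpolate_not_at_node (s := Finset.univ) (v := r)
    (fun i => N.eval (r i)) (x := z) (fun i _ => hz i)
  rw [← h1, Lagrange.eval_nodal] at h2
  rw [h2, mul_div_cancel_left₀ _ (Finset.prod_ne_zero_iff.mpr fun i _ => sub_ne_zero.mpr (hz i))]
  refine Finset.sum_congr rfl fun i _ => ?_
  rw [Lagrange.nodalWeight, Finset.prod_inv_distrib]
  ring

/-- `∏ (X - l i)` and `∏ (X - r i)` are both monic of degree `n`. -/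
theorem Polynomial.degree_prod_sub_prod_lt {n : ℕ} (l r : Fin n → ℂ) :
    ((∏ i, (Polynomial.X - Polynomial.C (l i))) -
      ∏ i, (Polynomial.X - Polynomial.C (r i))).degree < (n : WithBot ℕ) := by
  have hm := fun l : Fin n → ℂ => Polynomial.monic_prod_X_sub_C l Finset.univ
  have hd : ∀ l : Fin n → ℂ, (∏ i, (Polynomial.X - Polynomial.C (l i))).degree = (n : WithBot ℕ) := by
    intro l
    rw [Polynomial.degree_prod]
    simp
  refine (Polynomial.degree_sub_lt_left ?_ (hm l).ne_zero ?_).trans_eq (hd l)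
  · rw [hd, hd]
  · rw [(hm l).leadingCoeff, (hm r).leadingCoeff]

/-! ### Systems of bands -/

/-- `[l i, r i]` are disjoint nondegenerate intervals, listed from left to right. -/
structure IsBandSystem {n : ℕ} (l r : Fin n → ℝ) : Prop where
  lt : ∀ i, l i < r i
  sep : ∀ i j, i < j → r i < l j

/-- The union of the bands `[l i, r i]`. -/
def bandUnion {n : ℕ} (l r : Fin n → ℝ) : Set ℝ := ⋃ i, Set.Icc (l i) (r i)

/-- The rational function `∏ (z - l i) / (z - r i)`. -/
noncomputable def bandRatio {n : ℕ} (l r : Fin n → ℝ) (z : ℂ) : ℂ :=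
  (∏ i, (z - l i)) / ∏ i, (z - r i)

namespace IsBandSystem

variable {n : ℕ} {l r : Fin n → ℝ}

theorem injective_left (h : IsBandSystem l r) : Function.Injective l :=
  StrictMono.injective fun i j hij => (h.lt i).trans (h.sep i j hij)

theorem injective_right (h : IsBandSystem l r) : Function.Injective r :=
  StrictMono.injective fun i j hij => (h.sep i j hij).trans (h.lt j)

theorem prod_pos (h : IsBandSystem l r) {x : ℝ} (hx : x ∉ bandUnion l r) :
    0 < (∏ i, (x - l i)) * ∏ i, (x - r i) := by
  rw [← Finset.prod_mul_distrib]
  refine Finset.prod_pos fun i _ => ?_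
  have hi : ¬ (l i ≤ x ∧ x ≤ r i) := fun hh => hx (Set.mem_iUnion.mpr ⟨i, hh⟩)
  have := h.lt i
  rcases lt_or_ge x (l i) with h1 | h1
  · exact mul_pos_of_neg_of_neg (by linarith) (by linarith)
  · have h2 : r i < x := by
      by_contra h3
      exact hi ⟨h1, not_lt.mp h3⟩
    exact mul_pos (by linarith) (by linarith)

/-- The product of all factors but those of the band containing the point is positive. -/
theorem exists_factor (h : IsBandSystem l r) {x : ℝ} {i : Fin n} (hi : x ∈ Set.Icc (l i) (r i)) :
    ∃ t : ℝ, 0 < t ∧ (∏ i, (x - l i)) * ∏ i, (x - r i) = (x - l i) * (x - r i) * t := by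
  refine ⟨∏ j ∈ Finset.univ.erase i, ((x - l j) * (x - r j)), ?_, ?_⟩
  · refine Finset.prod_pos fun j hj => ?_
    have hne := Finset.ne_of_mem_erase hj
    have := h.lt j
    rcases lt_or_gt_of_ne hne with h1 | h1
    · have := h.sep _ _ h1
      exact mul_pos (by linarith [hi.1]) (by linarith [hi.1])
    · have := h.sep _ _ h1
      exact mul_pos_of_neg_of_neg (by linarith [hi.2]) (by linarith [hi.2])
  · rw [← Finset.prod_mul_distrib,
      ← Finset.mul_prod_erase Finset.univ (fun j => (x - l j) * (x - r j)) (Finset.mem_univ i)]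

theorem prod_nonpos (h : IsBandSystem l r) {x : ℝ} (hx : x ∈ bandUnion l r) :
    (∏ i, (x - l i)) * ∏ i, (x - r i) ≤ 0 := by
  obtain ⟨i, h1, h2⟩ := Set.mem_iUnion.mp hx
  obtain ⟨t, ht, heq⟩ := h.exists_factor ⟨h1, h2⟩
  rw [heq]
  exact mul_nonpos_of_nonpos_of_nonneg
    (mul_nonpos_of_nonneg_of_nonpos (by linarith) (by linarith)) ht.le

theorem prod_neg (h : IsBandSystem l r) {x : ℝ} {i : Fin n} (h1 : l i < x) (h2 : x < r i) :
    (∏ i, (x - l i)) * ∏ i, (x - r i) < 0 := by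
  obtain ⟨t, ht, heq⟩ := h.exists_factor ⟨h1.le, h2.le⟩
  rw [heq]
  exact mul_neg_of_neg_of_pos (mul_neg_of_pos_of_neg (by linarith) (by linarith)) ht

theorem left_mem (h : IsBandSystem l r) (i : Fin n) : l i ∈ bandUnion l r :=
  Set.mem_iUnion.mpr ⟨i, le_rfl, (h.lt i).le⟩

theorem right_mem (h : IsBandSystem l r) (i : Fin n) : r i ∈ bandUnion l r :=
  Set.mem_iUnion.mpr ⟨i, (h.lt i).le, le_rfl⟩

/-- The partial fraction decomposition of the band ratio; interlacing makes the residues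
positive. -/
theorem exists_bandRatio_eq (h : IsBandSystem l r) :
    ∃ κ : Fin n → ℝ, (∀ i, 0 < κ i) ∧ ∀ z : ℂ, (∀ i, z ≠ r i) →
      bandRatio l r z = 1 + ∑ i, (κ i : ℂ) / (z - r i) := by
  refine ⟨fun i => (∏ j, (r i - l j)) / ∏ j ∈ Finset.univ.erase i, (r i - r j), fun i => ?_,
    fun z hz => ?_⟩
  · dsimp only
    rw [← Finset.mul_prod_erase Finset.univ _ (Finset.mem_univ i), mul_div_assoc,
      ← Finset.prod_div_distrib]
    refine mul_pos (sub_pos.mpr (h.lt i)) (Finset.prod_pos fun j hj => ?_)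
    have hne := Finset.ne_of_mem_erase hj
    have h1 := h.lt i
    have h2 := h.lt j
    rcases lt_or_gt_of_ne hne with h3 | h3
    · have := h.sep _ _ h3
      exact div_pos (by linarith) (by linarith)
    · have := h.sep _ _ h3
      exact div_pos_of_neg_of_neg (by linarith) (by linarith)
  · have hinj : Function.Injective (fun i => (r i : ℂ)) :=
      Complex.ofReal_injective.comp h.injective_right
    have hR : (∏ i, (z - (r i : ℂ))) ≠ 0 :=
      Finset.prod_ne_zero_iff.mpr fun i _ => sub_ne_zero.mpr (hz i)
    have key := Polynomial.eval_div_prod_sub_eq_sum hinj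
      (Polynomial.degree_prod_sub_prod_lt (fun i => (l i : ℂ)) (fun i => (r i : ℂ))) hz
    simp only [Polynomial.eval_sub, Polynomial.eval_prod, Polynomial.eval_X,
      Polynomial.eval_C] at key
    rw [sub_div, div_self hR] at key
    rw [bandRatio, eq_add_of_sub_eq' key]
    congr 1
    refine Finset.sum_congr rfl fun i _ => ?_
    have : (∏ j, ((r i : ℂ) - r j)) = 0 := Finset.prod_eq_zero (Finset.mem_univ i) (sub_self _)
    rw [this]
    push_cast
    ring

theorem prod_ne_zero_left {z : ℂ} (h : IsBandSystem l r) (hz : z ∉ toComplexSet (bandUnion l r)) :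
    (∏ i, (z - (l i : ℂ))) ≠ 0 :=
  Finset.prod_ne_zero_iff.mpr fun i _ => sub_ne_zero.mpr fun he => hz ⟨l i, h.left_mem i, he.symm⟩

theorem prod_ne_zero_right {z : ℂ} (h : IsBandSystem l r)
    (hz : z ∉ toComplexSet (bandUnion l r)) : (∏ i, (z - (r i : ℂ))) ≠ 0 :=
  Finset.prod_ne_zero_iff.mpr fun i _ => sub_ne_zero.mpr fun he => hz ⟨r i, h.right_mem i, he.symm⟩

theorem bandRatio_im_neg [NeZero n] (h : IsBandSystem l r) {z : ℂ} (hz : 0 < z.im) :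
    (bandRatio l r z).im < 0 := by
  obtain ⟨κ, hκ, hW⟩ := h.exists_bandRatio_eq
  rw [hW z (fun i he => by simp [he] at hz), Complex.add_im, Complex.im_sum, Complex.one_im, zero_add]
  refine Finset.sum_neg (fun i _ => ?_) ⟨0, Finset.mem_univ _⟩
  have hne : 0 < Complex.normSq (z - r i) := by
    rw [Complex.normSq_pos]
    intro he
    have := congrArg Complex.im he
    simp at this
    exact hz.ne' this
  rw [Complex.div_im]
  simp only [ofReal_im, zero_mul, zero_div, sub_im, ofReal_re, sub_zero, zero_sub]
  have := hκ i
  rw [neg_lt_zero]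
  positivity

theorem bandRatio_conj (l r : Fin n → ℝ) (z : ℂ) :
    bandRatio l r (starRingEnd ℂ z) = starRingEnd ℂ (bandRatio l r z) := by
  simp [bandRatio]

theorem bandRatio_ofReal (l r : Fin n → ℝ) (x : ℝ) :
    bandRatio l r x = (((∏ i, (x - l i)) / ∏ i, (x - r i) : ℝ) : ℂ) := by
  simp [bandRatio]

theorem bandRatio_im_eq_zero [NeZero n] (h : IsBandSystem l r) {z : ℂ}
    (hz : (bandRatio l r z).im = 0) : z.im = 0 := by
  by_contra hne
  rcases lt_or_gt_of_ne hne with h1 | h1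
  · have h2 : 0 < ((starRingEnd ℂ) z).im := by simpa using h1
    have := h.bandRatio_im_neg h2
    rw [bandRatio_conj, Complex.conj_im, hz] at this
    simp at this
  · exact (h.bandRatio_im_neg h1).ne hz

theorem bandRatio_mem_slitPlane [NeZero n] (h : IsBandSystem l r) {z : ℂ}
    (hz : z ∉ toComplexSet (bandUnion l r)) : bandRatio l r z ∈ Complex.slitPlane := by
  by_cases hi : (bandRatio l r z).im = 0
  · have hzi := h.bandRatio_im_eq_zero hi
    obtain ⟨x, rfl⟩ : ∃ x : ℝ, (x : ℂ) = z := ⟨z.re, Complex.ext (by simp) (by simp [hzi])⟩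
    have hx : x ∉ bandUnion l r := fun hx => hz ⟨x, hx, rfl⟩
    rw [bandRatio_ofReal, Complex.ofReal_mem_slitPlane]
    have := h.prod_pos hx
    rcases mul_pos_iff.mp this with ⟨h1, h2⟩ | ⟨h1, h2⟩
    · exact div_pos h1 h2
    · exact div_pos_of_neg_of_neg h1 h2
  · exact Or.inr hi

theorem isCompact_toComplexSet (l r : Fin n → ℝ) : IsCompact (toComplexSet (bandUnion l r)) :=
  (isCompact_iUnion fun _ => isCompact_Icc).image Complex.continuous_ofReal

theorem isOpen_compl (l r : Fin n → ℝ) : IsOpen (toComplexSet (bandUnion l r))ᶜ :=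
  (isCompact_toComplexSet l r).isClosed.isOpen_compl

theorem differentiableOn_bandRatio (h : IsBandSystem l r) :
    DifferentiableOn ℂ (bandRatio l r) (toComplexSet (bandUnion l r))ᶜ := by
  unfold bandRatio
  refine DifferentiableOn.div ?_ ?_ fun z hz => h.prod_ne_zero_right hz
  · fun_prop
  · fun_prop

/-- Widening the bands a little gives a system of bands again. -/
theorem eventually_widen (h : IsBandSystem l r) :
    ∀ᶠ ε in 𝓝[>] (0 : ℝ), IsBandSystem (fun i => l i - ε) (fun i => r i + ε) := by
  have h1 : ∀ᶠ ε in 𝓝[>] (0 : ℝ), ∀ i j, i < j → r i + ε < l j - ε := by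
    rw [eventually_all]
    intro i
    rw [eventually_all]
    intro j
    by_cases hij : i < j
    · have : Tendsto (fun ε : ℝ => l j - ε - (r i + ε)) (𝓝[>] 0) (𝓝 (l j - 0 - (r i + 0))) :=
        tendsto_nhdsWithin_of_tendsto_nhds (by apply Continuous.tendsto; fun_prop)
      have h2 := this.eventually_const_lt (u := 0) (by have := h.sep i j hij; linarith)
      filter_upwards [h2] with ε hε _
      linarith
    · exact Eventually.of_forall fun ε hh => absurd hh hij
  filter_upwards [h1, self_mem_nhdsWithin] with ε hε hpos
  exact ⟨fun i => by have := h.lt i; have : 0 < ε := hpos; linarith, hε⟩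

end IsBandSystem

/-! ### The Cayley transform of a bounded function -/

theorem cayley_re (u : ℂ) :
    ((1 + u) / (1 - u)).re = (1 - ‖u‖ ^ 2) / ‖1 - u‖ ^ 2 := by
  rw [Complex.div_re, ← Complex.normSq_eq_norm_sq, ← Complex.normSq_eq_norm_sq, ← add_div]
  congr 1
  simp [Complex.normSq_apply]
  ring

theorem cayley_re_pos {u : ℂ} (hu : ‖u‖ < 1) : 0 < ((1 + u) / (1 - u)).re := by
  rw [cayley_re]
  have h1 : (1 : ℂ) - u ≠ 0 := by
    intro h
    have : u = 1 := by linear_combination -h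
    simp [this] at hu
  have h2 : ‖u‖ ^ 2 < 1 := by nlinarith [norm_nonneg u]
  have := norm_pos_iff.mpr h1
  exact div_pos (by linarith) (by positivity)

theorem one_sub_ne_zero_of_norm_lt {u : ℂ} (hu : ‖u‖ < 1) : (1 : ℂ) - u ≠ 0 := by
  intro h
  have : u = 1 := by linear_combination -h
  simp [this] at hu

namespace IsBandSystem

variable {n : ℕ} {l r : Fin n → ℝ}

theorem tendsto_mul_bandRatio_sub_one [NeZero n] (h : IsBandSystem l r) :
    ∃ σ : ℝ, 0 < σ ∧
      Tendsto (fun z => z * (bandRatio l r z - 1)) (Bornology.cobounded ℂ) (𝓝 (σ : ℂ)) := by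
  obtain ⟨κ, hκ, hW⟩ := h.exists_bandRatio_eq
  refine ⟨∑ i, κ i, Finset.sum_pos (fun i _ => hκ i) ⟨0, Finset.mem_univ _⟩, ?_⟩
  have h1 : ∀ a : ℂ, Tendsto (fun z => z / (z - a)) (Bornology.cobounded ℂ) (𝓝 1) := by
    intro a
    have h2 : Tendsto (fun z : ℂ => 1 + a * (z - a)⁻¹) (Bornology.cobounded ℂ) (𝓝 (1 + a * 0)) :=
      tendsto_const_nhds.add (tendsto_const_nhds.mul
        (tendsto_inv₀_cobounded.comp (tendsto_sub_const_cobounded a)))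
    rw [mul_zero, add_zero] at h2
    refine h2.congr' ?_
    filter_upwards [Bornology.eventually_ne_cobounded a] with z hz
    have := sub_ne_zero.mpr hz
    field_simp
    ring
  have h3 : Tendsto (fun z : ℂ => ∑ i, (κ i : ℂ) * (z / (z - r i))) (Bornology.cobounded ℂ)
      (𝓝 (∑ i, (κ i : ℂ) * 1)) :=
    tendsto_finsetSum _ fun i _ => tendsto_const_nhds.mul (h1 _)
  simp only [mul_one] at h3
  rw [Complex.ofReal_sum]
  refine h3.congr' ?_
  have h4 : ∀ᶠ z in Bornology.cobounded ℂ, ∀ i, z ≠ (r i : ℂ) :=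
    eventually_all.mpr fun i => Bornology.eventually_ne_cobounded _
  filter_upwards [h4] with z hz
  rw [hW z hz, add_sub_cancel_left, Finset.mul_sum]
  exact Finset.sum_congr rfl fun i _ => by ring

theorem tendsto_one_of_tendsto_mul_sub_one {f : ℂ → ℂ} {a : ℂ}
    (hf : Tendsto (fun z => z * (f z - 1)) (Bornology.cobounded ℂ) (𝓝 a)) :
    Tendsto f (Bornology.cobounded ℂ) (𝓝 1) := by
  have h1 : Tendsto (fun z => z⁻¹ * (z * (f z - 1)) + 1) (Bornology.cobounded ℂ) (𝓝 (0 * a + 1)) :=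
    (tendsto_inv₀_cobounded.mul hf).add_const 1
  rw [zero_mul, zero_add] at h1
  refine h1.congr' ?_
  filter_upwards [Bornology.eventually_ne_cobounded 0] with z hz
  field_simp
  ring

/-- The square root of the band ratio, holomorphic with positive real part off the bands. -/
noncomputable def sqrtRatio (l r : Fin n → ℝ) (z : ℂ) : ℂ :=
  Complex.exp (Complex.log (bandRatio l r z) / 2)

theorem sqrtRatio_sq (h : IsBandSystem l r) {z : ℂ} (hz : z ∉ toComplexSet (bandUnion l r)) :
    sqrtRatio l r z ^ 2 = bandRatio l r z := by
  rw [sqrtRatio, ← Complex.exp_nat_mul, Nat.cast_ofNat, mul_div_cancel₀ _ two_ne_zero,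
    Complex.exp_log]
  exact div_ne_zero (h.prod_ne_zero_left hz) (h.prod_ne_zero_right hz)

theorem sqrtRatio_re_pos [NeZero n] (h : IsBandSystem l r) {z : ℂ}
    (hz : z ∉ toComplexSet (bandUnion l r)) : 0 < (sqrtRatio l r z).re := by
  rw [sqrtRatio, Complex.exp_re]
  refine mul_pos (Real.exp_pos _) (Real.cos_pos_of_mem_Ioo ?_)
  have h1 := Complex.mem_slitPlane_iff_arg.mp (h.bandRatio_mem_slitPlane hz)
  have h2 := Complex.neg_pi_lt_arg (bandRatio l r z)
  have h3 := lt_of_le_of_ne (Complex.arg_le_pi (bandRatio l r z)) h1.1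
  have h4 : (Complex.log (bandRatio l r z) / 2).im = (bandRatio l r z).arg / 2 := by
    rw [show (2 : ℂ) = ((2 : ℝ) : ℂ) by norm_num, Complex.div_ofReal_im, Complex.log_im]
  rw [h4]
  constructor <;> linarith

theorem differentiableOn_sqrtRatio [NeZero n] (h : IsBandSystem l r) :
    DifferentiableOn ℂ (sqrtRatio l r) (toComplexSet (bandUnion l r))ᶜ := by
  unfold sqrtRatio
  exact ((h.differentiableOn_bandRatio.clog fun z hz => h.bandRatio_mem_slitPlane hz).div_const
    2).cexp

theorem tendsto_mul_sqrtRatio_sub_one [NeZero n] (h : IsBandSystem l r) {σ : ℝ}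
    (hσ : Tendsto (fun z => z * (bandRatio l r z - 1)) (Bornology.cobounded ℂ) (𝓝 (σ : ℂ))) :
    Tendsto (fun z => z * (sqrtRatio l r z - 1)) (Bornology.cobounded ℂ) (𝓝 ((σ / 2 : ℝ) : ℂ)) := by
  have hW := tendsto_one_of_tendsto_mul_sub_one hσ
  have hF : Tendsto (sqrtRatio l r) (Bornology.cobounded ℂ) (𝓝 1) := by
    have h1 : Tendsto (fun z => Complex.exp (Complex.log (bandRatio l r z) / 2))
        (Bornology.cobounded ℂ) (𝓝 (Complex.exp (Complex.log 1 / 2))) :=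
      ((hW.clog one_mem_slitPlane).div_const 2).cexp
    rw [Complex.log_one, zero_div, Complex.exp_zero] at h1
    exact h1
  have h2 := hσ.div (hF.add_const 1) (by norm_num)
  rw [show (σ : ℂ) / (1 + 1) = ((σ / 2 : ℝ) : ℂ) by push_cast; ring] at h2
  refine h2.congr' ?_
  filter_upwards [Bornology.isBounded_def.mp (isCompact_toComplexSet l r).isBounded] with z hz
  have hne : sqrtRatio l r z + 1 ≠ 0 := by
    intro he
    have := h.sqrtRatio_re_pos hz
    rw [eq_neg_of_add_eq_zero_left he] at this
    norm_num at this
  rw [Pi.div_apply, ← h.sqrtRatio_sq hz]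
  field_simp
  ring

/-- The explicit competitor `(√W - 1) / (√W + 1)`. -/
theorem isAhlforsCompetitor_cayley_sqrtRatio [NeZero n] (h : IsBandSystem l r) {σ : ℝ}
    (hσ : Tendsto (fun z => z * (bandRatio l r z - 1)) (Bornology.cobounded ℂ) (𝓝 (σ : ℂ))) :
    IsAhlforsCompetitor (toComplexSet (bandUnion l r))
      (fun z => (sqrtRatio l r z - 1) / (sqrtRatio l r z + 1)) ((σ / 4 : ℝ) : ℂ) := by
  have hne : ∀ z ∈ (toComplexSet (bandUnion l r))ᶜ, sqrtRatio l r z + 1 ≠ 0 := by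
    intro z hz he
    have := h.sqrtRatio_re_pos hz
    rw [eq_neg_of_add_eq_zero_left he] at this
    norm_num at this
  have h1 := h.tendsto_mul_sqrtRatio_sub_one hσ
  have hF := tendsto_one_of_tendsto_mul_sub_one h1
  refine ⟨?_, fun z hz => ?_, ?_, ?_⟩
  · exact (h.differentiableOn_sqrtRatio.sub_const 1).div (h.differentiableOn_sqrtRatio.add_const 1)
      hne
  · rw [norm_div, div_le_one (norm_pos_iff.mpr (hne z hz)), ← sq_le_sq₀ (norm_nonneg _)
      (norm_nonneg _), ← Complex.normSq_eq_norm_sq, ← Complex.normSq_eq_norm_sq]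
    have := h.sqrtRatio_re_pos hz
    simp only [Complex.normSq_apply, sub_re, add_re, sub_im, add_im, one_re, one_im]
    nlinarith
  · have := (hF.sub_const 1).div (hF.add_const 1) (by norm_num)
    rw [sub_self, zero_div] at this
    exact this
  · have h2 := h1.div (hF.add_const 1) (by norm_num)
    rw [show ((σ / 2 : ℝ) : ℂ) / (1 + 1) = ((σ / 4 : ℝ) : ℂ) by push_cast; ring] at h2
    exact h2.congr fun z => by simp only [Pi.div_apply]; ring

/-! ### The extremal property -/

/-- Off the bands, the argument of the Cayley transform of a function bounded by `ρ < 1` and real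
on the real axis is dominated by the argument of `√W` for slightly widened bands. -/
theorem arg_cayley_ge_of_widen [NeZero n] {s : ℂ → ℂ} {ρ ε : ℝ} (hρ : ρ < 1) (hε : 0 < ε)
    (h' : IsBandSystem (fun i => l i - ε) (fun i => r i + ε))
    (hs : DifferentiableOn ℂ s (toComplexSet (bandUnion l r))ᶜ)
    (hs1 : ∀ z ∈ (toComplexSet (bandUnion l r))ᶜ, ‖s z‖ ≤ ρ)
    (hs0 : Tendsto s (Bornology.cobounded ℂ) (𝓝 0))
    (hreal : ∀ x : ℝ, x ∉ bandUnion l r → (s x).im = 0) {z : ℂ} (hz : 0 < z.im) :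
    (bandRatio (fun i => l i - ε) (fun i => r i + ε) z).arg / 2 ≤
      ((1 + s z) / (1 - s z)).arg := by
  set W := bandRatio (fun i => l i - ε) (fun i => r i + ε) with hW
  set F : ℂ → ℂ := fun z => (1 + s z) / (1 - s z) with hF
  have hU : IsOpen {z : ℂ | 0 < z.im} := isOpen_lt continuous_const Complex.continuous_im
  have hmem : ∀ l r : Fin n → ℝ, ∀ z : ℂ, 0 < z.im → z ∈ (toComplexSet (bandUnion l r))ᶜ := by
    rintro l r z hz ⟨x, _, rfl⟩
    simp at hz
  have hlt : ∀ z ∈ (toComplexSet (bandUnion l r))ᶜ, ‖s z‖ < 1 := fun z hz => (hs1 z hz).trans_lt hρ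
  have hFre : ∀ z ∈ (toComplexSet (bandUnion l r))ᶜ, 0 < (F z).re := fun z hz =>
    cayley_re_pos (hlt z hz)
  have hFd : DifferentiableOn ℂ F (toComplexSet (bandUnion l r))ᶜ :=
    (hs.const_add 1).div (hs.const_sub 1) fun z hz => one_sub_ne_zero_of_norm_lt (hlt z hz)
  have hFlog : DifferentiableOn ℂ (fun z => Complex.log (F z)) (toComplexSet (bandUnion l r))ᶜ :=
    hFd.clog fun z hz => Or.inl (hFre z hz)
  -- `log ‖Φ‖ = (arg W) / 2 - arg F` is nonpositive on the real axis: on the bands `arg W` tends to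
  -- `-π`, because the wider bands cover them in their interior, while `arg F ≥ -π / 2`; off the
  -- bands `F` is positive and `arg W ≤ 0`
  set Φ : ℂ → ℂ := fun z => Complex.exp (I * (Complex.log (F z) - Complex.log (W z) / 2)) with hΦ
  have hnorm : ∀ z, ‖Φ z‖ = Real.exp ((W z).arg / 2 - (F z).arg) := by
    intro z
    rw [hΦ, Complex.norm_exp]
    congr 1
    have : (Complex.log (W z) / 2).im = (W z).arg / 2 := by
      rw [show (2 : ℂ) = ((2 : ℝ) : ℂ) by norm_num, Complex.div_ofReal_im, Complex.log_im]
    rw [Complex.I_mul_re, Complex.sub_im, this, Complex.log_im]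
    ring
  have hWarg : ∀ z : ℂ, 0 < z.im → (W z).arg < 0 := fun z hz =>
    Complex.arg_neg_iff.mpr (h'.bandRatio_im_neg hz)
  have hdiff : DifferentiableOn ℂ Φ {z : ℂ | 0 < z.im} := by
    have h1 := hFlog.mono (fun z hz => hmem l r z hz)
    have h2 : DifferentiableOn ℂ (fun z => Complex.log (W z)) {z : ℂ | 0 < z.im} :=
      (h'.differentiableOn_bandRatio.clog fun z hz => h'.bandRatio_mem_slitPlane hz).mono
        (fun z hz => hmem _ _ z hz)
    exact ((h1.sub (h2.div_const 2)).const_mul I).cexp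
  have key : ∀ z ∈ {z : ℂ | 0 < z.im}, ‖Φ z‖ ≤ 1 := by
    refine norm_le_of_eventually_lt_at_boundary hU hdiff ?_ ?_
    · intro x hx m hm
      rcases lt_or_eq_of_le (show x.im ≤ 0 from not_lt.mp hx) with hx | hx
      · have h1 : ∀ᶠ z : ℂ in 𝓝 x, z.im < 0 :=
          Complex.continuous_im.continuousAt.eventually_lt_const hx
        rw [eventually_nhdsWithin_iff]
        filter_upwards [h1] with z h1 h2
        exact absurd h2 (not_lt.mpr h1.le)
      · obtain ⟨x, rfl⟩ : ∃ y : ℝ, (y : ℂ) = x := ⟨x.re, Complex.ext (by simp) (by simp [hx])⟩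
        by_cases hxE : x ∈ bandUnion l r
        · obtain ⟨i, hi⟩ := Set.mem_iUnion.mp hxE
          have hprod := h'.prod_neg (x := x) (i := i) (by linarith [hi.1]) (by linarith [hi.2])
          have hWx : W x = (((∏ i, (x - (l i - ε))) / ∏ i, (x - (r i + ε)) : ℝ) : ℂ) :=
            bandRatio_ofReal _ _ _
          have hWneg : (W x).re < 0 := by
            rw [hWx, Complex.ofReal_re]
            rcases mul_neg_iff.mp hprod with ⟨h1, h2⟩ | ⟨h1, h2⟩
            · exact div_neg_of_pos_of_neg h1 h2
            · exact div_neg_of_neg_of_pos h1 h2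
          have hWc : ContinuousAt W x := by
            rw [hW]
            unfold bandRatio
            refine ContinuousAt.div (by fun_prop) (by fun_prop) ?_
            have := right_ne_zero_of_mul hprod.ne
            exact_mod_cast this
          have htend : Tendsto W (𝓝[{z : ℂ | 0 < z.im}] x) (𝓝[{z : ℂ | z.im < 0}] (W x)) :=
            tendsto_nhdsWithin_of_tendsto_nhds_of_eventually_within _
              (hWc.tendsto.mono_left nhdsWithin_le_nhds)
              (eventually_nhdsWithin_of_forall fun z hz => h'.bandRatio_im_neg hz)
          have harg := (Complex.tendsto_arg_nhdsWithin_im_neg_of_re_neg_of_im_zero hWneg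
            (by rw [hWx, Complex.ofReal_im])).comp htend
          have h1 : Tendsto (fun z => Real.exp ((W z).arg / 2 + Real.pi / 2))
              (𝓝[{z : ℂ | 0 < z.im}] x) (𝓝 (Real.exp (-Real.pi / 2 + Real.pi / 2))) :=
            ((harg.div_const 2).add_const _).rexp
          rw [neg_div, neg_add_cancel, Real.exp_zero] at h1
          filter_upwards [h1.eventually_lt_const hm, self_mem_nhdsWithin] with z hz hzU
          rw [hnorm]
          refine lt_of_le_of_lt (Real.exp_le_exp.mpr ?_) hz
          have := (abs_lt.mp (Complex.abs_arg_lt_pi_div_two_iff.mpr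
            (Or.inl (hFre z (hmem l r z hzU))))).1
          linarith
        · have hx' : (x : ℂ) ∈ (toComplexSet (bandUnion l r))ᶜ := by
            rintro ⟨y, hy, hyx⟩
            rw [Complex.ofReal_inj] at hyx
            exact hxE (hyx ▸ hy)
          have hFx : (F x).arg = 0 := by
            rw [Complex.arg_eq_zero_iff]
            refine ⟨(hFre _ hx').le, ?_⟩
            rw [hF]
            simp [Complex.div_im, hreal x hxE]
          have hc : ContinuousAt (fun z => (F z).arg) x :=
            ContinuousAt.comp (Complex.continuousAt_arg (Or.inl (hFre _ hx')))
              (hFd.differentiableAt ((isOpen_compl l r).mem_nhds hx')).continuousAt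
          have h1 : Tendsto (fun z => Real.exp (-(F z).arg)) (𝓝[{z : ℂ | 0 < z.im}] x)
              (𝓝 (Real.exp (-(F x).arg))) :=
            (hc.neg.rexp).tendsto.mono_left nhdsWithin_le_nhds
          rw [hFx, neg_zero, Real.exp_zero] at h1
          filter_upwards [h1.eventually_lt_const hm, self_mem_nhdsWithin] with z hz hzU
          rw [hnorm]
          refine lt_of_le_of_lt (Real.exp_le_exp.mpr ?_) hz
          have := hWarg z hzU
          linarith
    · intro m hm
      have h0 : Tendsto F (Bornology.cobounded ℂ) (𝓝 1) := by
        have := (hs0.const_add 1).div (hs0.const_sub 1) (by norm_num)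
        rw [add_zero, sub_zero, div_one] at this
        exact this
      have h1 : Tendsto (fun z => Real.exp (-(F z).arg)) (Bornology.cobounded ℂ)
          (𝓝 (Real.exp (-(1 : ℂ).arg))) :=
        (((Complex.continuousAt_arg one_mem_slitPlane).tendsto.comp h0).neg).rexp
      rw [Complex.arg_one, neg_zero, Real.exp_zero] at h1
      filter_upwards [h1.eventually_lt_const hm] with z hz hzU
      rw [hnorm]
      refine lt_of_le_of_lt (Real.exp_le_exp.mpr ?_) hz
      have := hWarg z hzU
      linarith
  have := key z hz
  rw [hnorm, Real.exp_le_one_iff] at this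
  linarith

/-- For a function bounded by one and real on the real axis, the quotient of its Cayley transform
by `√W` maps the upper half-plane to its closure. -/
theorem im_cayley_div_sqrtRatio_nonneg [NeZero n] (h : IsBandSystem l r) {s : ℂ → ℂ}
    (hs : DifferentiableOn ℂ s (toComplexSet (bandUnion l r))ᶜ)
    (hs1 : ∀ z ∈ (toComplexSet (bandUnion l r))ᶜ, ‖s z‖ ≤ 1)
    (hs0 : Tendsto s (Bornology.cobounded ℂ) (𝓝 0))
    (hreal : ∀ x : ℝ, x ∉ bandUnion l r → (s x).im = 0) {z : ℂ} (hz : 0 < z.im) :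
    0 ≤ ((1 + s z) / (1 - s z) / sqrtRatio l r z).im := by
  have hzE : z ∈ (toComplexSet (bandUnion l r))ᶜ := by
    rintro ⟨x, _, rfl⟩
    simp at hz
  by_cases hs1z : s z = 1
  · simp [hs1z]
  have hWs := h.bandRatio_mem_slitPlane hzE
  have hzr : ∀ t : ℝ, (z : ℂ) - t ≠ 0 := by
    intro t he
    have := congrArg Complex.im he
    simp at this
    exact hz.ne' this
  -- the widening `ε` tends to zero for a fixed scaling `ρ` of the function
  have hwiden : ∀ ρ ∈ Set.Ioo (0 : ℝ) 1,
      (bandRatio l r z).arg / 2 ≤ ((1 + ρ * s z) / (1 - ρ * s z)).arg := by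
    intro ρ hρ
    have h1 : ∀ᶠ ε in 𝓝[>] (0 : ℝ),
        (bandRatio (fun i => l i - ε) (fun i => r i + ε) z).arg / 2 ≤
          ((1 + ρ * s z) / (1 - ρ * s z)).arg := by
      filter_upwards [h.eventually_widen, self_mem_nhdsWithin] with ε hε hpos
      refine arg_cayley_ge_of_widen (s := fun z => ρ * s z) hρ.2 hpos hε (hs.const_mul _) ?_ ?_ ?_ hz
      · intro z hz
        rw [norm_mul, Complex.norm_real, Real.norm_of_nonneg hρ.1.le]
        exact mul_le_of_le_one_right hρ.1.le (hs1 z hz)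
      · simpa using hs0.const_mul (ρ : ℂ)
      · intro x hx
        simp [hreal x hx]
    refine le_of_tendsto ?_ h1
    have h2 : ContinuousAt (fun ε : ℝ => bandRatio (fun i => l i - ε) (fun i => r i + ε) z) 0 := by
      unfold bandRatio
      refine ContinuousAt.div (by fun_prop) (by fun_prop) ?_
      exact Finset.prod_ne_zero_iff.mpr fun i _ => hzr _
    have h3 : ContinuousAt
        (fun ε : ℝ => (bandRatio (fun i => l i - ε) (fun i => r i + ε) z).arg / 2) 0 :=
      (ContinuousAt.comp (Complex.continuousAt_arg (by simpa using hWs)) h2).div_const 2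
    have h4 := h3.tendsto.mono_left (nhdsWithin_le_nhds (s := Set.Ioi 0))
    simpa using h4
  have hscaled : ∀ ρ ∈ Set.Ioo (0 : ℝ) 1,
      0 ≤ ((1 + ρ * s z) / (1 - ρ * s z) / sqrtRatio l r z).im := by
    intro ρ hρ
    have hre : 0 < ((1 + ρ * s z) / (1 - ρ * s z)).re := by
      apply cayley_re_pos
      rw [norm_mul, Complex.norm_real, Real.norm_of_nonneg hρ.1.le]
      exact (mul_le_of_le_one_right hρ.1.le (hs1 z hzE)).trans_lt hρ.2
    have h1 := hwiden ρ hρ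
    set F := (1 + ρ * s z) / (1 - ρ * s z) with hF
    have hF0 : F ≠ 0 := by
      intro h0
      rw [h0] at hre
      simp at hre
    have h2 := (abs_lt.mp (Complex.abs_arg_lt_pi_div_two_iff.mpr (Or.inl hre))).2
    have h3 := Complex.neg_pi_lt_arg (bandRatio l r z)
    have him : (Complex.log (bandRatio l r z) / 2).im = (bandRatio l r z).arg / 2 := by
      rw [show (2 : ℂ) = ((2 : ℝ) : ℂ) by norm_num, Complex.div_ofReal_im, Complex.log_im]
    rw [← Complex.exp_log hF0, sqrtRatio, ← Complex.exp_sub, Complex.exp_im, Complex.sub_im, him,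
      Complex.log_im]
    exact mul_nonneg (Real.exp_pos _).le
      (Real.sin_nonneg_of_nonneg_of_le_pi (by linarith) (by linarith))
  -- the scaling `ρ` tends to one
  have hc : ContinuousAt
      (fun ρ : ℝ => ((1 + ρ * s z) / (1 - ρ * s z) / sqrtRatio l r z).im) 1 := by
    refine Complex.continuous_im.continuousAt.comp ?_
    refine ContinuousAt.div_const (ContinuousAt.div (by fun_prop) (by fun_prop) ?_) _
    rw [Complex.ofReal_one, one_mul]
    exact sub_ne_zero.mpr (Ne.symm hs1z)
  have h5 := hc.tendsto.mono_left (nhdsWithin_le_nhds (s := Set.Iio 1))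
  rw [Complex.ofReal_one, one_mul] at h5
  refine ge_of_tendsto h5 ?_
  filter_upwards [Ioo_mem_nhdsLT (show (0 : ℝ) < 1 by norm_num)] with ρ hρ
  exact hscaled ρ hρ

end IsBandSystem

/-! ### The Ahlfors function of the complement of a system of bands -/

/-- A holomorphic germ with a zero of order at least two whose imaginary part is nonnegative on a
half-disc vanishes: the angles `n θ`, `0 < θ < π`, fill more than a full turn for `n ≥ 2`. -/
theorem AnalyticAt.eventually_eq_zero_of_im_nonneg {K : ℂ → ℂ} (hK : AnalyticAt ℂ K 0)
    (h0 : K 0 = 0) (h1 : Tendsto (fun ζ => K ζ / ζ) (𝓝[≠] 0) (𝓝 0))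
    (him : ∀ᶠ ζ in 𝓝 (0 : ℂ), ζ.im < 0 → 0 ≤ (K ζ).im) : ∀ᶠ ζ in 𝓝 (0 : ℂ), K ζ = 0 := by
  by_contra hne
  obtain ⟨n, G, hG, hG0, hKG⟩ := hK.exists_eventuallyEq_pow_smul_nonzero_iff.mpr hne
  simp only [sub_zero, smul_eq_mul] at hKG
  have hn : 2 ≤ n := by
    by_contra hn
    have hn : n = 0 ∨ n = 1 := by omega
    rcases hn with rfl | rfl
    · have := hKG.self_of_nhds
      rw [h0, pow_zero, one_mul] at this
      exact hG0 this.symm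
    · have h2 : Tendsto (fun ζ => K ζ / ζ) (𝓝[≠] 0) (𝓝 (G 0)) := by
        refine (hG.continuousAt.tendsto.mono_left nhdsWithin_le_nhds).congr' ?_
        filter_upwards [hKG.filter_mono nhdsWithin_le_nhds, self_mem_nhdsWithin] with ζ hζ hζ0
        have : ζ ≠ 0 := hζ0
        rw [hζ, pow_one, mul_div_cancel_left₀ _ this]
      exact hG0 (tendsto_nhds_unique h2 h1)
  have hnpos : (0 : ℝ) < n := by positivity
  have key : ∀ φ : ℝ, 0 < φ → φ < 2 * Real.pi → 0 ≤ (Complex.exp (-(φ * I)) * G 0).im := by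
    intro φ hφ hφ2
    set u : ℂ := Complex.exp ((-(φ / n) : ℝ) * I) with hu
    have hun : u ^ n = Complex.exp (-(φ * I)) := by
      rw [hu, ← Complex.exp_nat_mul]
      congr 1
      push_cast
      have : (n : ℂ) ≠ 0 := by exact_mod_cast hnpos.ne'
      field_simp
    have huim : u.im < 0 := by
      rw [hu, Complex.exp_ofReal_mul_I_im, Real.sin_neg, neg_lt_zero]
      refine Real.sin_pos_of_pos_of_lt_pi (by positivity) ?_
      rw [div_lt_iff₀ hnpos]
      have : (2 : ℝ) ≤ n := by exact_mod_cast hn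
      nlinarith [Real.pi_pos]
    have hlim : Tendsto (fun t : ℝ => (t : ℂ) * u) (𝓝[>] 0) (𝓝 0) := by
      have : Tendsto (fun t : ℝ => (t : ℂ) * u) (𝓝 0) (𝓝 (((0 : ℝ) : ℂ) * u)) :=
        Continuous.tendsto (by fun_prop) 0
      rw [Complex.ofReal_zero, zero_mul] at this
      exact this.mono_left nhdsWithin_le_nhds
    have hlim2 : Tendsto (fun t : ℝ => (u ^ n * G (t * u)).im) (𝓝[>] 0) (𝓝 (u ^ n * G 0).im) :=
      (Complex.continuous_im.tendsto _).comp
        (tendsto_const_nhds.mul (hG.continuousAt.tendsto.comp hlim))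
    rw [← hun]
    refine ge_of_tendsto hlim2 ?_
    filter_upwards [hlim.eventually hKG, hlim.eventually him, self_mem_nhdsWithin] with t h2 h3 ht
    have ht : 0 < t := ht
    have h4 := h3 (by rw [Complex.im_ofReal_mul]; exact mul_neg_of_pos_of_neg ht huim)
    rw [h2, mul_pow, mul_assoc, ← Complex.ofReal_pow, Complex.im_ofReal_mul] at h4
    exact nonneg_of_mul_nonneg_right h4 (by positivity)
  have key_re : ∀ φ : ℝ, 0 < φ → φ < 2 * Real.pi →
      0 ≤ Real.cos φ * (G 0).im - Real.sin φ * (G 0).re := by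
    intro φ h1 h2
    have h3 := key φ h1 h2
    rw [← neg_mul, ← Complex.ofReal_neg, Complex.mul_im, Complex.exp_ofReal_mul_I_im,
      Complex.exp_ofReal_mul_I_re, Real.sin_neg, Real.cos_neg] at h3
    linarith
  have hpi := Real.pi_pos
  have e1 := key_re (Real.pi / 2) (by linarith) (by linarith)
  have e2 := key_re Real.pi (by linarith) (by linarith)
  have e3 := key_re (Real.pi / 2 + Real.pi) (by linarith) (by linarith)
  have e4 := key_re (Real.pi / 4) (by linarith) (by linarith)
  rw [Real.cos_pi_div_two, Real.sin_pi_div_two] at e1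
  rw [Real.cos_pi, Real.sin_pi] at e2
  rw [Real.cos_add_pi, Real.sin_add_pi, Real.cos_pi_div_two, Real.sin_pi_div_two] at e3
  rw [Real.cos_pi_div_four, Real.sin_pi_div_four] at e4
  have hre : (G 0).re = 0 := by linarith
  rw [hre, mul_zero, sub_zero] at e4
  have him0 : 0 ≤ (G 0).im := nonneg_of_mul_nonneg_right e4 (by positivity)
  exact hG0 (Complex.ext hre (by simp only [Complex.zero_im]; linarith))

/-- A holomorphic function off a compact real set that vanishes near infinity vanishes. -/
theorem eq_zero_of_eventually_cobounded {E : Set ℝ} (hE : IsOpen (toComplexSet E)ᶜ) {N : ℂ → ℂ}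
    (hN : DifferentiableOn ℂ N (toComplexSet E)ᶜ)
    (hinf : ∀ᶠ z in Bornology.cobounded ℂ, N z = 0) : ∀ z ∈ (toComplexSet E)ᶜ, N z = 0 := by
  obtain ⟨ρ, -, hρ⟩ := (Metric.hasBasis_cobounded_compl_closedBall (0 : ℂ)).eventually_iff.mp hinf
  have main : ∀ U : Set ℂ, IsOpen U → IsPreconnected U → U ⊆ (toComplexSet E)ᶜ →
      (∃ z₀ ∈ U, ρ < ‖z₀‖) → ∀ z ∈ U, N z = 0 := by
    rintro U hU hUc hUE ⟨z₀, hz₀, hlt⟩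
    have h1 : AnalyticOnNhd ℂ N U := (hN.mono hUE).analyticOnNhd hU
    have h2 : N =ᶠ[𝓝 z₀] (fun _ => (0 : ℂ)) := by
      have : (Metric.closedBall (0 : ℂ) ρ)ᶜ ∈ 𝓝 z₀ :=
        Metric.isClosed_closedBall.isOpen_compl.mem_nhds (by simpa using hlt)
      filter_upwards [this] with z hz
      exact hρ hz
    exact h1.eqOn_of_preconnected_of_eventuallyEq (fun _ _ => analyticAt_const) hUc hz₀ h2
  have hE' : ∀ z : ℂ, z.im ≠ 0 → z ∈ (toComplexSet E)ᶜ := by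
    rintro z hz ⟨x, _, rfl⟩
    simp at hz
  have hup : ∀ z : ℂ, 0 < z.im → N z = 0 :=
    main {z | 0 < z.im} (isOpen_lt continuous_const Complex.continuous_im)
      (convex_halfSpace_im_gt 0).isPreconnected (fun z hz => hE' z (ne_of_gt hz))
      ⟨((|ρ| + 1 : ℝ) : ℂ) * I, by
        simp only [Set.mem_ofPred_eq, Complex.im_ofReal_mul, Complex.I_im]; positivity, by
        rw [norm_mul, Complex.norm_I, Complex.norm_real, Real.norm_of_nonneg (by positivity)]
        linarith [le_abs_self ρ]⟩
  have hdown : ∀ z : ℂ, z.im < 0 → N z = 0 :=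
    main {z | z.im < 0} (isOpen_lt Complex.continuous_im continuous_const)
      (convex_halfSpace_im_lt 0).isPreconnected (fun z hz => hE' z (ne_of_lt hz))
      ⟨((-(|ρ| + 1) : ℝ) : ℂ) * I, by
        simp only [Set.mem_ofPred_eq, Complex.im_ofReal_mul, Complex.I_im]
        have := abs_nonneg ρ
        linarith, by
        rw [norm_mul, Complex.norm_I, Complex.norm_real, norm_neg,
          Real.norm_of_nonneg (by positivity)]
        linarith [le_abs_self ρ]⟩
  intro z hz
  rcases lt_trichotomy z.im 0 with h | h | h
  · exact hdown z h
  · have hc := (hN.differentiableAt (hE.mem_nhds hz)).continuousAt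
    have hlim : Tendsto (fun t : ℝ => z + t * I) (𝓝[>] 0) (𝓝 z) := by
      have : Tendsto (fun t : ℝ => z + t * I) (𝓝 0) (𝓝 (z + ((0 : ℝ) : ℂ) * I)) :=
        Continuous.tendsto (by fun_prop) 0
      rw [Complex.ofReal_zero, zero_mul, add_zero] at this
      exact this.mono_left nhdsWithin_le_nhds
    refine tendsto_nhds_unique (hc.tendsto.comp hlim) (tendsto_const_nhds.congr' ?_)
    filter_upwards [self_mem_nhdsWithin] with t ht
    refine (hup _ ?_).symm
    simpa [h] using ht
  · exact hup z h

/-- How far `u` is from the unit circle, in terms of the square of its Cayley transform. -/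
theorem sq_one_sub_norm_sq_le {u a b : ℂ} (hb : b ≠ 0) (hu : ‖u‖ ≤ 1)
    (h : (1 + u) ^ 2 * b = (1 - u) ^ 2 * a) :
    (1 - ‖u‖ ^ 2) ^ 2 ≤ 8 * (‖a / b‖ + (a / b).re) := by
  have hu1 : (1 : ℂ) - u ≠ 0 := by
    intro h0
    have h1 : u = 1 := by linear_combination -h0
    rw [h1] at h
    norm_num at h
    exact hb h
  set F := (1 + u) / (1 - u) with hF
  have hFab : F ^ 2 = a / b := by
    rw [hF, div_pow, div_eq_div_iff (pow_ne_zero 2 hu1) hb]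
    linear_combination h
  have hre := cayley_re u
  rw [← hF] at hre
  have hpos : 0 < ‖1 - u‖ ^ 2 := by
    have := norm_pos_iff.mpr hu1
    positivity
  have h2 : ‖1 - u‖ ≤ 2 := (norm_sub_le _ _).trans (by rw [norm_one]; linarith)
  have h3 : 0 ≤ 1 - ‖u‖ ^ 2 := by nlinarith [norm_nonneg u]
  have h4 : 0 ≤ F.re := by rw [hre]; positivity
  have h5 : 1 - ‖u‖ ^ 2 ≤ 4 * F.re := by
    have h6 : 1 - ‖u‖ ^ 2 = F.re * ‖1 - u‖ ^ 2 := by rw [hre, div_mul_cancel₀ _ hpos.ne']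
    have h8 : ‖1 - u‖ ^ 2 ≤ 4 := by nlinarith [norm_nonneg (1 - u)]
    rw [h6, mul_comm]
    exact mul_le_mul_of_nonneg_right h8 h4
  have h7 : 2 * F.re ^ 2 = ‖a / b‖ + (a / b).re := by
    rw [← hFab, norm_pow, ← Complex.normSq_eq_norm_sq, Complex.normSq_apply, pow_two F,
      Complex.mul_re]
    ring
  nlinarith

namespace IsBandSystem

variable {n : ℕ} {l r : Fin n → ℝ}

theorem tendsto_mul_cayley_div_sqrtRatio_sub_one [NeZero n] (h : IsBandSystem l r) {s : ℂ → ℂ}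
    {d σ : ℝ}
    (hσ : Tendsto (fun z => z * (bandRatio l r z - 1)) (Bornology.cobounded ℂ) (𝓝 (σ : ℂ)))
    (hs0 : Tendsto s (Bornology.cobounded ℂ) (𝓝 0))
    (hsd : Tendsto (fun z => z * s z) (Bornology.cobounded ℂ) (𝓝 (d : ℂ))) :
    Tendsto (fun z => z * ((1 + s z) / (1 - s z) / sqrtRatio l r z - 1)) (Bornology.cobounded ℂ)
      (𝓝 ((2 * d - σ / 2 : ℝ) : ℂ)) := by
  have h1 := h.tendsto_mul_sqrtRatio_sub_one hσ
  have h2 := tendsto_one_of_tendsto_mul_sub_one h1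
  have h3 := (((hsd.const_mul 2).div (hs0.const_sub 1) (by norm_num)).sub h1).div h2 one_ne_zero
  have e : ((2 : ℂ) * d / (1 - 0) - ((σ / 2 : ℝ) : ℂ)) / 1 = ((2 * d - σ / 2 : ℝ) : ℂ) := by
    push_cast; ring
  rw [e] at h3
  refine h3.congr' ?_
  filter_upwards [hs0.eventually_ne (zero_ne_one), h2.eventually_ne one_ne_zero] with z hz hF
  have : (1 : ℂ) - s z ≠ 0 := sub_ne_zero.mpr hz.symm
  simp only [Pi.div_apply]
  field_simp
  ring

/-- The sharp bound for competitors that are real on the real axis, with the case of equality. -/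
theorem derivInfty_le_and_eq [NeZero n] (h : IsBandSystem l r) {s : ℂ → ℂ} {d σ : ℝ}
    (hσ : Tendsto (fun z => z * (bandRatio l r z - 1)) (Bornology.cobounded ℂ) (𝓝 (σ : ℂ)))
    (hs : IsAhlforsCompetitor (toComplexSet (bandUnion l r)) s d)
    (hreal : ∀ x : ℝ, x ∉ bandUnion l r → (s x).im = 0) :
    d ≤ σ / 4 ∧ (d = σ / 4 → ∀ z ∈ (toComplexSet (bandUnion l r))ᶜ,
      (1 + s z) ^ 2 * (∏ i, (z - (r i : ℂ))) = (1 - s z) ^ 2 * ∏ i, (z - (l i : ℂ))) := by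
  have hT := h.tendsto_mul_cayley_div_sqrtRatio_sub_one hσ hs.vanishes hs.deriv_infty
  set T : ℂ → ℂ := fun z => (1 + s z) / (1 - s z) / sqrtRatio l r z with hTdef
  have him : ∀ z : ℂ, 0 < z.im → 0 ≤ (T z).im := fun z hz =>
    h.im_cayley_div_sqrtRatio_nonneg hs.holomorphic hs.norm_le_one hs.vanishes hreal hz
  constructor
  · have h1 : Tendsto (fun y : ℝ => (y : ℂ) * I) atTop (Bornology.cobounded ℂ) := by
      rw [← tendsto_norm_atTop_iff_cobounded]
      simpa using tendsto_abs_atTop_atTop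
    have h2 : Tendsto (fun y : ℝ => (-I * ((y : ℂ) * I * (T (y * I) - 1))).im) atTop
        (𝓝 (-I * ((2 * d - σ / 2 : ℝ) : ℂ)).im) :=
      (Complex.continuous_im.tendsto _).comp ((hT.comp h1).const_mul _)
    have h3 : (-I * ((2 * d - σ / 2 : ℝ) : ℂ)).im = -(2 * d - σ / 2) := by
      rw [Complex.im_mul_ofReal]; simp
    rw [h3] at h2
    have h4 : 0 ≤ -(2 * d - σ / 2) := by
      refine ge_of_tendsto h2 ?_
      filter_upwards [eventually_gt_atTop 0] with y hy
      have e : -I * ((y : ℂ) * I * (T (y * I) - 1)) = (y : ℂ) * (T (y * I) - 1) := by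
        linear_combination (-(y : ℂ) * (T (y * I) - 1)) * Complex.I_sq
      rw [e, Complex.im_ofReal_mul, Complex.sub_im, Complex.one_im, sub_zero]
      exact mul_nonneg hy.le (him _ (by simpa using hy))
    linarith
  · intro hd
    rw [show 2 * d - σ / 2 = 0 by rw [hd]; ring, Complex.ofReal_zero] at hT
    have hT1 := tendsto_one_of_tendsto_mul_sub_one hT
    -- in the coordinate `ζ = 1 / z` at infinity, `T - 1` has a zero of order at least two
    set K : ℂ → ℂ := Function.update (fun ζ => T ζ⁻¹ - 1) 0 0 with hK
    have hK0 : K 0 = 0 := Function.update_self ..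
    have hKne : ∀ ζ, ζ ≠ 0 → K ζ = T ζ⁻¹ - 1 := fun ζ hζ => Function.update_of_ne hζ _ _
    have hinv : Tendsto (fun ζ : ℂ => ζ⁻¹) (𝓝[≠] 0) (Bornology.cobounded ℂ) :=
      tendsto_inv₀_nhdsNE_zero
    have hKq : Tendsto (fun ζ => K ζ / ζ) (𝓝[≠] 0) (𝓝 0) := by
      refine (hT.comp hinv).congr' ?_
      filter_upwards [self_mem_nhdsWithin] with ζ hζ
      rw [hKne ζ hζ, Function.comp_apply]
      ring
    have hKc : ContinuousAt K 0 := by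
      rw [continuousAt_iff_punctured_nhds, hK0]
      have := (hT1.comp hinv).sub_const 1
      rw [sub_self] at this
      refine this.congr' ?_
      filter_upwards [self_mem_nhdsWithin] with ζ hζ
      rw [hKne ζ hζ, Function.comp_apply]
    have hTd : ∀ᶠ z in Bornology.cobounded ℂ, DifferentiableAt ℂ T z := by
      filter_upwards [Bornology.isBounded_def.mp (isCompact_toComplexSet l r).isBounded,
        hs.vanishes.eventually_ne (zero_ne_one)] with z hz hz1
      have hn := (isOpen_compl l r).mem_nhds hz
      have hsz := hs.holomorphic.differentiableAt hn
      have hFz := h.differentiableOn_sqrtRatio.differentiableAt hn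
      exact ((hsz.const_add 1).div (hsz.const_sub 1) (sub_ne_zero.mpr hz1.symm)).div hFz
        (Complex.exp_ne_zero _)
    have hKan : AnalyticAt ℂ K 0 := by
      refine Complex.analyticAt_of_differentiable_on_punctured_nhds_of_continuousAt ?_ hKc
      filter_upwards [hinv.eventually hTd, self_mem_nhdsWithin] with ζ hζ hζ0
      have hζ0 : ζ ≠ 0 := hζ0
      have : DifferentiableAt ℂ (fun ζ => T ζ⁻¹ - 1) ζ :=
        (DifferentiableAt.comp ζ hζ (differentiableAt_inv hζ0)).sub_const 1
      refine this.congr_of_eventuallyEq ?_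
      filter_upwards [isOpen_ne.mem_nhds hζ0] with w hw
      exact hKne w hw
    have hKim : ∀ᶠ ζ in 𝓝 (0 : ℂ), ζ.im < 0 → 0 ≤ (K ζ).im := by
      refine Eventually.of_forall fun ζ hζ => ?_
      have hζ0 : ζ ≠ 0 := by rintro rfl; simp at hζ
      rw [hKne ζ hζ0, Complex.sub_im, Complex.one_im, sub_zero]
      refine him _ ?_
      rw [Complex.inv_im]
      exact div_pos (by linarith) (Complex.normSq_pos.mpr hζ0)
    have hzero := hKan.eventually_eq_zero_of_im_nonneg hK0 hKq hKim
    have hTone : ∀ᶠ z in Bornology.cobounded ℂ, T z = 1 := by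
      filter_upwards [tendsto_inv₀_cobounded.eventually hzero,
        Bornology.eventually_ne_cobounded (0 : ℂ)] with z hz hz0
      rw [hKne _ (inv_ne_zero hz0), inv_inv] at hz
      linear_combination hz
    intro z hz
    refine sub_eq_zero.mp (eq_zero_of_eventually_cobounded
      (N := fun z => (1 + s z) ^ 2 * (∏ i, (z - (r i : ℂ))) - (1 - s z) ^ 2 * ∏ i, (z - (l i : ℂ)))
      (isOpen_compl l r) ?_ ?_ z hz)
    · have := hs.holomorphic
      fun_prop
    · filter_upwards [hTone, Bornology.isBounded_def.mp (isCompact_toComplexSet l r).isBounded,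
        hs.vanishes.eventually_ne (zero_ne_one)] with z hz hzE hz1
      have h1 : (1 : ℂ) - s z ≠ 0 := sub_ne_zero.mpr hz1.symm
      have h2 := h.sqrtRatio_sq hzE
      have h3 : 1 + s z = sqrtRatio l r z * (1 - s z) := by
        rw [hTdef] at hz
        dsimp only at hz
        rw [div_eq_one_iff_eq (show sqrtRatio l r z ≠ 0 from Complex.exp_ne_zero _), div_eq_iff h1] at hz
        exact hz
      rw [bandRatio, eq_div_iff (h.prod_ne_zero_right hzE)] at h2
      rw [h3, ← h2]
      ring

/-- The Ahlfors function of the complement of the bands is an algebraic function: the square of its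
Cayley transform is the band ratio. -/
theorem ahlfors_identity [NeZero n] (h : IsBandSystem l r) {Ψ : ℂ → ℂ}
    (hΨ : IsAhlforsFunction (toComplexSet (bandUnion l r)) Ψ) :
    ∀ z ∈ (toComplexSet (bandUnion l r))ᶜ,
      (1 + Ψ z) ^ 2 * (∏ i, (z - (r i : ℂ))) = (1 - Ψ z) ^ 2 * ∏ i, (z - (l i : ℂ)) := by
  obtain ⟨γ, hγ, hcomp, hmax⟩ := hΨ
  obtain ⟨σ, hσpos, hσ⟩ := h.tendsto_mul_bandRatio_sub_one
  have hge : σ / 4 ≤ γ := by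
    have := hmax _ _ (h.isAhlforsCompetitor_cayley_sqrtRatio hσ)
    rwa [Complex.norm_real, Real.norm_of_nonneg (by positivity)] at this
  set E := toComplexSet (bandUnion l r) with hE
  have hconjE : ∀ z ∈ Eᶜ, (starRingEnd ℂ) z ∈ Eᶜ := by
    rintro z hz ⟨x, hx, hxz⟩
    refine hz ⟨x, hx, ?_⟩
    have := congrArg (starRingEnd ℂ) hxz
    simpa using this
  have hopen : IsOpen Eᶜ := isOpen_compl l r
  have hconjinf : Tendsto (starRingEnd ℂ) (Bornology.cobounded ℂ) (Bornology.cobounded ℂ) := by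
    rw [← tendsto_norm_atTop_iff_cobounded]
    simpa using tendsto_norm_cobounded_atTop
  -- the symmetrization `s` of `Ψ` is extremal as well and real on the real axis
  set Ψ' : ℂ → ℂ := fun z => (starRingEnd ℂ) (Ψ ((starRingEnd ℂ) z)) with hΨ'
  have hΨ'd : DifferentiableOn ℂ Ψ' Eᶜ := by
    intro z hz
    have h1 := hcomp.holomorphic.differentiableAt (hopen.mem_nhds (hconjE z hz))
    have h2 := h1.conj_conj
    rw [Complex.conj_conj] at h2
    exact h2.differentiableWithinAt
  have hΨ'n : ∀ z ∈ Eᶜ, ‖Ψ' z‖ ≤ 1 := fun z hz => by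
    rw [hΨ', Complex.norm_conj]
    exact hcomp.norm_le_one _ (hconjE z hz)
  have hΨ'0 : Tendsto Ψ' (Bornology.cobounded ℂ) (𝓝 0) := by
    have := (Complex.continuous_conj.tendsto _).comp (hcomp.vanishes.comp hconjinf)
    rw [map_zero] at this
    exact this
  have hΨ'1 : Tendsto (fun z => z * Ψ' z) (Bornology.cobounded ℂ) (𝓝 (γ : ℂ)) := by
    have := (Complex.continuous_conj.tendsto _).comp (hcomp.deriv_infty.comp hconjinf)
    rw [Complex.conj_ofReal] at this
    refine this.congr fun z => ?_
    simp [hΨ']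
  set s : ℂ → ℂ := fun z => (Ψ z + Ψ' z) / 2 with hs
  set k : ℂ → ℂ := fun z => (Ψ z - Ψ' z) / 2 with hk
  have hpar : ∀ z ∈ Eᶜ, ‖k z‖ ^ 2 ≤ 1 - ‖s z‖ ^ 2 := by
    intro z hz
    have h1 := hcomp.norm_le_one z hz
    have h2 := hΨ'n z hz
    have h3 := parallelogram_law_with_norm ℝ (Ψ z) (Ψ' z)
    rw [hs, hk]
    simp only [norm_div, Complex.norm_ofNat, div_pow]
    nlinarith [norm_nonneg (Ψ z), norm_nonneg (Ψ' z)]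
  have hsn : ∀ z ∈ Eᶜ, ‖s z‖ ≤ 1 := by
    intro z hz
    have := hpar z hz
    nlinarith [norm_nonneg (s z), sq_nonneg ‖k z‖]
  have hscomp : IsAhlforsCompetitor E s γ := by
    refine ⟨(hcomp.holomorphic.add hΨ'd).div_const 2, hsn, ?_, ?_⟩
    · have := (hcomp.vanishes.add hΨ'0).div_const 2
      simpa using this
    · have := (hcomp.deriv_infty.add hΨ'1).div_const 2
      rw [add_self_div_two] at this
      exact this.congr fun z => by rw [hs]; ring
  have hsreal : ∀ x : ℝ, x ∉ bandUnion l r → (s x).im = 0 := by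
    intro x _
    have : s x = ((Ψ x).re : ℂ) := by
      rw [hs, hΨ']
      simp only [Complex.conj_ofReal]
      rw [Complex.add_conj]
      push_cast
      ring
    rw [this, Complex.ofReal_im]
  obtain ⟨hle, heq⟩ := h.derivInfty_le_and_eq hσ hscomp hsreal
  have hid := heq (le_antisymm hle hge)
  -- `|s|` tends to one at the bands, so that `k` tends to zero there
  have hk0 : ∀ z ∈ Eᶜ, ‖k z‖ ≤ 0 := by
    refine norm_le_of_eventually_lt_at_boundary hopen
      ((hcomp.holomorphic.sub hΨ'd).div_const 2) ?_ ?_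
    · intro x hx m hm
      obtain ⟨x, hxE, rfl⟩ := not_not.mp hx
      have hnp := h.prod_nonpos hxE
      have main : ∀ a b : ℂ → ℂ, Continuous a → Continuous b →
          (∀ z ∈ Eᶜ, (1 - ‖s z‖ ^ 2) ^ 2 ≤ 8 * (‖a z / b z‖ + (a z / b z).re)) →
          b x ≠ 0 → (∃ t : ℝ, t ≤ 0 ∧ a x / b x = t) →
          ∀ᶠ z in 𝓝[Eᶜ] (x : ℂ), ‖k z‖ < m := by
        rintro a b ha hb hab hbx ⟨t, ht, htab⟩
        have hc : ContinuousAt (fun z => a z / b z) x := ha.continuousAt.div hb.continuousAt hbx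
        have hc2 : ContinuousAt (fun z => 8 * (‖a z / b z‖ + (a z / b z).re)) x :=
          (hc.norm.add (Complex.continuous_re.continuousAt.comp hc)).const_mul 8
        have hval : 8 * (‖a x / b x‖ + (a x / b x).re) = 0 := by
          rw [htab, Complex.norm_real, Complex.ofReal_re, Real.norm_of_nonpos ht]
          ring
        have hm4 : 8 * (‖a x / b x‖ + (a x / b x).re) < m ^ 4 := by
          rw [hval]; positivity
        filter_upwards [(hc2.eventually_lt_const hm4).filter_mono nhdsWithin_le_nhds,
          self_mem_nhdsWithin] with z hz hzE
        have h1 := hab z hzE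
        have h2 := hpar z hzE
        have h3 : (‖k z‖ ^ 2) ^ 2 ≤ (1 - ‖s z‖ ^ 2) ^ 2 := pow_le_pow_left₀ (by positivity) h2 2
        have h4 : ‖k z‖ ^ 4 < m ^ 4 := by
          calc ‖k z‖ ^ 4 = (‖k z‖ ^ 2) ^ 2 := by ring
            _ ≤ _ := h3.trans h1
            _ < m ^ 4 := hz
        exact lt_of_pow_lt_pow_left₀ 4 hm.le h4
      -- at the right end of a band the reciprocal of the band ratio has to be used
      by_cases hR : (∏ i, (x - r i)) = 0
      · have hL : (∏ i, (x - l i)) ≠ 0 := by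
          obtain ⟨i, -, hi⟩ := Finset.prod_eq_zero_iff.mp hR
          refine Finset.prod_ne_zero_iff.mpr fun j _ hj => ?_
          rcases lt_trichotomy i j with h1 | rfl | h1
          · linarith [h.sep i j h1]
          · linarith [h.lt i]
          · linarith [h.sep j i h1, h.lt i, h.lt j]
        refine main (fun z => ∏ i, (z - (r i : ℂ))) (fun z => ∏ i, (z - (l i : ℂ)))
          (by fun_prop) (by fun_prop) (fun z hz => ?_) (by exact_mod_cast hL)
          ⟨0, le_rfl, ?_⟩
        · rw [← norm_neg (s z)]
          refine sq_one_sub_norm_sq_le (h.prod_ne_zero_left hz)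
            (by rw [norm_neg]; exact hsn z hz) ?_
          have := hid z hz
          linear_combination -this
        · have : (∏ i, ((x : ℂ) - r i)) = 0 := by exact_mod_cast congrArg ((↑) : ℝ → ℂ) hR
          simp only [this, zero_div, Complex.ofReal_zero]
      · refine main (fun z => ∏ i, (z - (l i : ℂ))) (fun z => ∏ i, (z - (r i : ℂ)))
          (by fun_prop) (by fun_prop) (fun z hz => ?_) (by exact_mod_cast hR)
          ⟨(∏ i, (x - l i)) / ∏ i, (x - r i), ?_, by push_cast; rfl⟩
        · exact sq_one_sub_norm_sq_le (h.prod_ne_zero_right hz) (hsn z hz) (hid z hz)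
        · rw [← mul_div_mul_right _ _ hR]
          exact div_nonpos_of_nonpos_of_nonneg hnp (mul_self_nonneg _)
    · intro m hm
      have h1 : Tendsto (fun z => ‖k z‖) (Bornology.cobounded ℂ) (𝓝 0) := by
        have := ((hcomp.vanishes.sub hΨ'0).div_const 2).norm
        rw [sub_zero, zero_div, norm_zero] at this
        exact this
      filter_upwards [h1.eventually_lt_const hm] with z hz _
      exact hz
  intro z hz
  have h1 : k z = 0 := norm_le_zero_iff.mp (hk0 z hz)
  have h2 : Ψ z = s z := by
    have : Ψ z - Ψ' z = 0 := by
      have := h1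
      rw [hk] at this
      simpa using this
    rw [hs]
    linear_combination this / 2
  rw [h2]
  exact hid z hz

end IsBandSystem

/-! ### Partial fractions of `Ψ + 1 / Ψ` -/

/-- A finite gap set with `g` gaps is a union of `g + 1` bands. -/
theorem IsFiniteGapSet.exists_isBandSystem {g : ℕ} {E : Set ℝ} (hE : IsFiniteGapSet g E) :
    ∃ l r : Fin (g + 1) → ℝ, IsBandSystem l r ∧ E = bandUnion l r := by
  obtain ⟨b₀, a₀, a, b, h0, hb0, hab, hba, hsep, rfl⟩ := hE
  set l : Fin (g + 1) → ℝ := Fin.cons b₀ b with hl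
  set r : Fin (g + 1) → ℝ := Fin.snoc (α := fun _ => ℝ) a a₀ with hr
  have hl0 : l 0 = b₀ := Fin.cons_zero ..
  have hls : ∀ j : Fin g, l j.succ = b j := fun j => Fin.cons_succ ..
  have hrl : r (Fin.last g) = a₀ := Fin.snoc_last ..
  have hrc : ∀ j : Fin g, r j.castSucc = a j := fun j => Fin.snoc_castSucc ..
  have hB : IsBandSystem l r := by
    constructor
    · intro i
      induction i using Fin.cases with
      | zero =>
        rw [hl0]
        obtain hi | ⟨j, hj⟩ := Fin.eq_castSucc_or_eq_last (0 : Fin (g + 1)) |>.symm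
        · rw [hi, hrl]; exact h0
        · rw [hj, hrc]; exact hb0 j
      | succ i =>
        rw [hls]
        obtain hi | ⟨j, hj⟩ := Fin.eq_castSucc_or_eq_last i.succ |>.symm
        · rw [hi, hrl]; exact hba i
        · rw [hj, hrc]
          refine hsep i j ?_
          have := congrArg Fin.val hj
          simp at this
          exact Fin.lt_def.mpr (by omega)
    · intro i j hij
      obtain ⟨i, rfl⟩ := Fin.exists_castSucc_eq.mpr (ne_of_lt (lt_of_lt_of_le hij (Fin.le_last j)))
      obtain ⟨j, rfl⟩ := Fin.exists_succ_eq.mpr (ne_of_gt (lt_of_le_of_lt (Fin.zero_le _) hij))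
      rw [hrc, hls]
      have hij' : i ≤ j := by
        have : (i : ℕ) < j + 1 := by simpa [Fin.lt_def] using hij
        exact Fin.le_def.mpr (by omega)
      rcases eq_or_lt_of_le hij' with rfl | h
      · exact hab i
      · exact (hab i).trans ((hsep i j h).trans (hab j))
  refine ⟨l, r, hB, ?_⟩
  have hlm : Monotone l := StrictMono.monotone fun i j hij => (hB.lt i).trans (hB.sep i j hij)
  have hrm : Monotone r := StrictMono.monotone fun i j hij => (hB.sep i j hij).trans (hB.lt j)
  ext x
  simp only [bandUnion, Set.mem_sdiff, Set.mem_iUnion, Set.mem_Icc, Set.mem_Ioo, not_exists]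
  constructor
  · rintro ⟨⟨h1, h2⟩, h3⟩
    have hne : (Finset.univ.filter fun i => l i ≤ x).Nonempty := ⟨0, by simp [hl0, h1]⟩
    set i := (Finset.univ.filter fun i => l i ≤ x).max' hne with hi
    have him : l i ≤ x := (Finset.mem_filter.mp (Finset.max'_mem _ hne)).2
    refine ⟨i, him, ?_⟩
    obtain hil | ⟨j, hj⟩ := Fin.eq_castSucc_or_eq_last i |>.symm
    · rw [hil, hrl]; exact h2
    · rw [hj, hrc]
      by_contra hlt
      have h4 : ¬ l j.succ ≤ x := by
        intro h5
        have := Finset.le_max' (Finset.univ.filter fun i => l i ≤ x) j.succ (by simp [h5])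
        rw [← hi, hj] at this
        exact absurd this (not_le.mpr (Fin.castSucc_lt_succ))
      rw [hls] at h4
      exact h3 j ⟨not_le.mp hlt, not_le.mp h4⟩
  · rintro ⟨i, h1, h2⟩
    refine ⟨⟨?_, ?_⟩, ?_⟩
    · rw [← hl0]; exact (hlm (Fin.zero_le i)).trans h1
    · rw [← hrl]; exact h2.trans (hrm (Fin.le_last i))
    · rintro j ⟨h3, h4⟩
      rw [← hrc] at h3
      rw [← hls] at h4
      rcases le_or_gt i j.castSucc with h5 | h5
      · exact absurd (h2.trans (hrm h5)) (not_le.mpr h3)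
      · exact absurd ((hlm (Fin.castSucc_lt_iff_succ_le.mp h5)).trans h1) (not_le.mpr h4)

/-- The rational function `a z + b + ∑ e k / (c k - z)`. -/
noncomputable def simplePoleFun {g : ℕ} (c : Fin g → ℝ) (a b : ℝ) (e : Fin g → ℝ) (z : ℂ) : ℂ :=
  a * z + b + ∑ k, (e k : ℂ) / ((c k : ℂ) - z)

/-- If two monic products of `g + 1` linear factors agree at `g` points, their difference is a
multiple of the product over these points. -/
theorem exists_prod_sub_prod_eq {g : ℕ} (l r : Fin (g + 1) → ℝ) {c : Fin g → ℝ}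
    (hc : Function.Injective c)
    (hcz : ∀ k, (∏ i, ((c k : ℂ) - l i)) = ∏ i, ((c k : ℂ) - r i)) (z : ℂ) :
    (∏ i, (z - (l i : ℂ))) - ∏ i, (z - (r i : ℂ)) =
      ((∑ i, (r i - l i) : ℝ) : ℂ) * ∏ k, (z - (c k : ℂ)) := by
  open Polynomial in
  set N : ℂ[X] := (∏ i, (X - C (l i : ℂ))) - ∏ i, (X - C (r i : ℂ)) with hN
  set D : ℂ[X] := ∏ k, (X - C (c k : ℂ)) with hD
  set τ : ℂ := ((∑ i, (r i - l i) : ℝ) : ℂ) with hτ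
  have hcoeff : ∀ l : Fin (g + 1) → ℝ,
      (∏ i, (X - C (l i : ℂ))).coeff g = -∑ i, (l i : ℂ) := by
    intro l
    have := Polynomial.prod_X_sub_C_coeff_card_pred (Finset.univ : Finset (Fin (g + 1)))
      (fun i => (l i : ℂ)) (by simp)
    simpa using this
  have hDm : D.Monic := Polynomial.monic_prod_X_sub_C _ _
  have hDn : D.natDegree = g := by simp [hD]
  have hDc : D.coeff g = 1 := by rw [← hDn]; exact hDm.coeff_natDegree
  have hdeg : (N - C τ * D).degree < g := by
    rw [Polynomial.degree_lt_iff_coeff_zero]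
    intro m hm
    rw [Polynomial.coeff_sub, Polynomial.coeff_C_mul]
    rcases eq_or_lt_of_le hm with rfl | hm
    · rw [hDc, hN, Polynomial.coeff_sub, hcoeff, hcoeff, hτ]
      push_cast
      rw [Finset.sum_sub_distrib]
      ring
    · have h1 : N.coeff m = 0 := by
        refine Polynomial.coeff_eq_zero_of_degree_lt
          (lt_of_lt_of_le (Polynomial.degree_prod_sub_prod_lt _ _) ?_)
        exact_mod_cast hm
      rw [h1, Polynomial.coeff_eq_zero_of_natDegree_lt (by rw [hDn]; exact hm)]
      ring
  have hzero : N - C τ * D = 0 := by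
    refine Polynomial.eq_zero_of_degree_lt_of_eval_index_eq_zero (s := Finset.univ)
      (v := fun k => (c k : ℂ)) ((Complex.ofReal_injective.comp hc).injOn) (by simpa using hdeg) ?_
    intro k _
    have : (∏ j, ((c k : ℂ) - c j)) = 0 := Finset.prod_eq_zero (Finset.mem_univ k) (sub_self _)
    simp [hN, hD, Polynomial.eval_prod, hcz k, this]
  have := congrArg (Polynomial.eval z) hzero
  simp only [hN, hD, Polynomial.eval_sub, Polynomial.eval_mul, Polynomial.eval_prod,
    Polynomial.eval_X, Polynomial.eval_C, Polynomial.eval_zero] at this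
  linear_combination this

/-- Division of a monic product of `g + 1` linear factors by one of `g` factors. -/
theorem prod_div_prod_eq {g : ℕ} (r : Fin (g + 1) → ℝ) {c : Fin g → ℝ}
    (hc : Function.Injective c) {z : ℂ} (hz : ∀ k, z ≠ c k) :
    (∏ i, (z - (r i : ℂ))) / ∏ k, (z - (c k : ℂ)) =
      simplePoleFun c 1 (∑ k, c k - ∑ i, r i)
        (fun k => -((∏ i, (c k - r i)) / ∏ j ∈ Finset.univ.erase k, (c k - c j))) z := by
  open Polynomial in
  set D : ℂ[X] := ∏ k, (X - C (c k : ℂ)) with hD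
  set e : ℂ := ((∑ k, c k - ∑ i, r i : ℝ) : ℂ) with he
  set r₀ : Fin (g + 1) → ℂ := Fin.cons 0 (fun k => (c k : ℂ)) with hr₀
  have hXD : X * D = ∏ i, (X - C (r₀ i)) := by
    rw [Fin.prod_univ_succ]
    simp [hr₀, hD]
  set N : ℂ[X] := (∏ i, (X - C (r i : ℂ))) - X * D - C e * D with hN
  have hcoeff : ∀ l : Fin (g + 1) → ℂ, (∏ i, (X - C (l i))).coeff g = -∑ i, l i := by
    intro l
    have := Polynomial.prod_X_sub_C_coeff_card_pred (Finset.univ : Finset (Fin (g + 1)))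
      l (by simp)
    simpa using this
  have hDm : D.Monic := Polynomial.monic_prod_X_sub_C _ _
  have hDn : D.natDegree = g := by simp [hD]
  have hDc : D.coeff g = 1 := by rw [← hDn]; exact hDm.coeff_natDegree
  have hdeg : N.degree < g := by
    rw [Polynomial.degree_lt_iff_coeff_zero]
    intro m hm
    rw [hN, hXD, Polynomial.coeff_sub, Polynomial.coeff_C_mul]
    rcases eq_or_lt_of_le hm with rfl | hm
    · rw [hDc, Polynomial.coeff_sub, hcoeff, hcoeff, he, Fin.sum_univ_succ (f := r₀)]
      simp only [hr₀, Fin.cons_zero, Fin.cons_succ]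
      push_cast
      ring
    · have h1 : ((∏ i, (X - C (r i : ℂ))) - ∏ i, (X - C (r₀ i))).coeff m = 0 := by
        refine Polynomial.coeff_eq_zero_of_degree_lt
          (lt_of_lt_of_le (Polynomial.degree_prod_sub_prod_lt _ _) ?_)
        exact_mod_cast hm
      rw [h1, Polynomial.coeff_eq_zero_of_natDegree_lt (by rw [hDn]; exact hm)]
      ring
  have hDz : (∏ k, (z - (c k : ℂ))) ≠ 0 :=
    Finset.prod_ne_zero_iff.mpr fun k _ => sub_ne_zero.mpr (hz k)
  have key := Polynomial.eval_div_prod_sub_eq_sum (Complex.ofReal_injective.comp hc) hdeg hz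
  have heval : ∀ w, N.eval w = (∏ i, (w - (r i : ℂ))) - (w + e) * ∏ k, (w - (c k : ℂ)) := by
    intro w
    simp only [hN, hD, Polynomial.eval_sub, Polynomial.eval_mul, Polynomial.eval_prod,
      Polynomial.eval_X, Polynomial.eval_C]
    ring
  simp only [heval, Function.comp_apply] at key
  rw [sub_div, mul_div_cancel_right₀ _ hDz] at key
  rw [simplePoleFun, eq_add_of_sub_eq' key, Complex.ofReal_one, one_mul]
  congr 1
  refine Finset.sum_congr rfl fun k _ => ?_
  have h0 : (∏ j, ((c k : ℂ) - c j)) = 0 := Finset.prod_eq_zero (Finset.mem_univ k) (sub_self _)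
  rw [h0, mul_zero, sub_zero, ← neg_sub (c k : ℂ) z]
  push_cast
  rw [div_neg, neg_div]

/-- The sign of the residues of `∏ (z - r i) / ∏ (z - c k)`. By `exists_prod_sub_prod_eq` the sign is
that of the derivative of the band ratio at `c k`, and the partial fractions of the band ratio have
positive coefficients. -/
theorem IsBandSystem.prod_div_prod_erase_neg {g : ℕ} {l r : Fin (g + 1) → ℝ}
    (h : IsBandSystem l r) {c : Fin g → ℝ} (hc : Function.Injective c)
    (hcE : ∀ k, c k ∉ bandUnion l r)
    (hcz : ∀ k, (∏ i, ((c k : ℂ) - l i)) = ∏ i, ((c k : ℂ) - r i)) (k : Fin g) :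
    (∏ i, (c k - r i)) / (∏ j ∈ Finset.univ.erase k, (c k - c j)) < 0 := by
  obtain ⟨κ, hκ, hW⟩ := h.exists_bandRatio_eq
  have hcE' : ∀ k, (c k : ℂ) ∉ toComplexSet (bandUnion l r) := by
    rintro k ⟨x, hx, hxc⟩
    rw [Complex.ofReal_inj] at hxc
    exact hcE k (hxc ▸ hx)
  set τ : ℝ := ∑ i, (r i - l i) with hτ
  have hτpos : 0 < τ := Finset.sum_pos (fun i _ => sub_pos.mpr (h.lt i)) ⟨0, Finset.mem_univ _⟩
  have hdiff := exists_prod_sub_prod_eq l r hc hcz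
  have hRk := h.prod_ne_zero_right (hcE' k)
  have hri : ∀ i, (c k : ℂ) ≠ r i := fun i he => hcE' k ⟨r i, h.right_mem i, he.symm⟩
  have hWk : ∑ i, (κ i : ℂ) / ((c k : ℂ) - r i) = 0 := by
    have := hW (c k) hri
    rw [bandRatio, hcz k, div_self hRk] at this
    linear_combination -this
  have hval : (τ : ℂ) * (∏ j ∈ Finset.univ.erase k, ((c k : ℂ) - c j)) / (∏ i, ((c k : ℂ) - r i)) =
      -∑ i, (κ i : ℂ) / (((c k : ℂ) - r i) * ((c k : ℂ) - r i)) := by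
    have hc1 : ContinuousAt (fun z : ℂ => (τ : ℂ) * (∏ j ∈ Finset.univ.erase k, (z - (c j : ℂ))) /
        (∏ i, (z - (r i : ℂ)))) (c k) := by
      refine ContinuousAt.div (by fun_prop) (by fun_prop) hRk
    have hc2 : ContinuousAt
        (fun z : ℂ => -∑ i, (κ i : ℂ) / ((z - r i) * ((c k : ℂ) - r i))) (c k) := by
      refine (tendsto_finsetSum _ fun i _ => ?_).neg
      have : ((c k : ℂ) - r i) * ((c k : ℂ) - r i) ≠ 0 :=
        mul_ne_zero (sub_ne_zero.mpr (hri i)) (sub_ne_zero.mpr (hri i))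
      exact ContinuousAt.div (f := fun _ : ℂ => (κ i : ℂ))
        (g := fun z : ℂ => (z - r i) * ((c k : ℂ) - r i)) (by fun_prop) (by fun_prop) this
    refine tendsto_nhds_unique (hc1.tendsto.mono_left (nhdsWithin_le_nhds (s := {(c k : ℂ)}ᶜ)))
      ((hc2.tendsto.mono_left nhdsWithin_le_nhds).congr' ?_)
    have hopen := (IsBandSystem.isOpen_compl l r).mem_nhds (hcE' k)
    filter_upwards [nhdsWithin_le_nhds hopen, self_mem_nhdsWithin] with z hzE hzk
    have hzk : z ≠ c k := hzk
    have hzri : ∀ i, z ≠ r i := fun i he => hzE ⟨r i, h.right_mem i, he.symm⟩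
    have hRz := h.prod_ne_zero_right hzE
    have e1 := hW z hzri
    have e2 := hdiff z
    rw [← Finset.mul_prod_erase Finset.univ (fun j => z - (c j : ℂ)) (Finset.mem_univ k)] at e2
    rw [bandRatio, div_eq_iff hRz] at e1
    have e3 : (τ : ℂ) * (∏ j ∈ Finset.univ.erase k, (z - (c j : ℂ))) / (∏ i, (z - (r i : ℂ))) =
        (∑ i, (κ i : ℂ) / (z - r i)) / (z - c k) := by
      rw [div_eq_div_iff hRz (sub_ne_zero.mpr hzk)]
      linear_combination e1 - e2
    rw [e3, ← sub_zero (∑ i, (κ i : ℂ) / (z - r i)), ← hWk, ← Finset.sum_sub_distrib,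
      Finset.sum_div, ← Finset.sum_neg_distrib]
    refine Finset.sum_congr rfl fun i _ => ?_
    have h1 := sub_ne_zero.mpr (hzri i)
    have h2 := sub_ne_zero.mpr (hri i)
    have h3 := sub_ne_zero.mpr hzk
    field_simp
    ring
  have hreal : τ * (∏ j ∈ Finset.univ.erase k, (c k - c j)) / (∏ i, (c k - r i)) =
      -∑ i, κ i / ((c k - r i) * (c k - r i)) := by exact_mod_cast hval
  have hneg : -∑ i, κ i / ((c k - r i) * (c k - r i)) < 0 := by
    rw [neg_lt_zero]
    refine Finset.sum_pos (fun i _ => div_pos (hκ i) (mul_self_pos.mpr ?_)) ⟨0, Finset.mem_univ _⟩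
    exact sub_ne_zero.mpr (by exact_mod_cast hri i)
  rw [← hreal, mul_div_assoc] at hneg
  have := neg_of_mul_neg_right hneg hτpos.le
  rw [← inv_div]
  exact inv_neg''.mpr this

/-- The function `Ψ + 1 / Ψ` for the Ahlfors function `Ψ`. -/
theorem exists_ahlfors_simplePoleFun {g : ℕ} {l r : Fin (g + 1) → ℝ} (h : IsBandSystem l r)
    {Ψ : ℂ → ℂ} (hΨ : IsAhlforsFunction (toComplexSet (bandUnion l r)) Ψ)
    {c : Fin g → ℝ} (hc : Function.Injective c)
    (hcE : ∀ k, c k ∉ bandUnion l r) (hcΨ : ∀ k, Ψ (c k) = 0) :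
    ∃ (lam0 c0 : ℝ) (lam : Fin g → ℝ), 0 < lam0 ∧ (∀ k, 0 < lam k) ∧
      (∀ z : ℂ, (∀ k, z ≠ c k) →
        simplePoleFun c lam0 c0 lam z - 2 = lam0 * ((∏ i, (z - (r i : ℂ))) / ∏ k, (z - (c k : ℂ))) ∧
        simplePoleFun c lam0 c0 lam z + 2 =
          lam0 * ((∏ i, (z - (l i : ℂ))) / ∏ k, (z - (c k : ℂ)))) ∧
      ∀ z ∉ toComplexSet (bandUnion l r), Ψ z ≠ 0 →
        Ψ z + 1 / Ψ z = simplePoleFun c lam0 c0 lam z := by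
  have hid := h.ahlfors_identity hΨ
  have hcE' : ∀ k, (c k : ℂ) ∉ toComplexSet (bandUnion l r) := by
    rintro k ⟨x, hx, hxc⟩
    rw [Complex.ofReal_inj] at hxc
    exact hcE k (hxc ▸ hx)
  have hcz : ∀ k, (∏ i, ((c k : ℂ) - l i)) = ∏ i, ((c k : ℂ) - r i) := by
    intro k
    have := hid (c k) (hcE' k)
    rw [hcΨ k] at this
    linear_combination -this
  have hdiff := exists_prod_sub_prod_eq l r hc hcz
  set τ : ℝ := ∑ i, (r i - l i) with hτ
  have hτpos : 0 < τ := Finset.sum_pos (fun i _ => sub_pos.mpr (h.lt i)) ⟨0, Finset.mem_univ _⟩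
  have hτ0 : (τ : ℂ) ≠ 0 := by exact_mod_cast hτpos.ne'
  have hneg := h.prod_div_prod_erase_neg hc hcE hcz
  set μ : Fin g → ℝ := fun k => -((∏ i, (c k - r i)) / ∏ j ∈ Finset.univ.erase k, (c k - c j))
    with hμ
  have hscale : ∀ z : ℂ, (∀ k, z ≠ c k) →
      simplePoleFun c (4 / τ) (4 / τ * (∑ k, c k - ∑ i, r i) + 2) (fun k => 4 / τ * μ k) z - 2 =
        ((4 / τ : ℝ) : ℂ) * ((∏ i, (z - (r i : ℂ))) / ∏ k, (z - (c k : ℂ))) := by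
    intro z hz
    rw [prod_div_prod_eq r hc hz, simplePoleFun, simplePoleFun]
    have : ∑ k, ((4 / τ * μ k : ℝ) : ℂ) / ((c k : ℂ) - z) =
        ((4 / τ : ℝ) : ℂ) * ∑ k, (μ k : ℂ) / ((c k : ℂ) - z) := by
      rw [Finset.mul_sum]
      refine Finset.sum_congr rfl fun k _ => ?_
      rw [Complex.ofReal_mul, mul_div_assoc]
    rw [this]
    simp only [Complex.ofReal_add, Complex.ofReal_mul, Complex.ofReal_one, Complex.ofReal_ofNat, hμ]
    ring
  have hscale2 : ∀ z : ℂ, (∀ k, z ≠ c k) →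
      simplePoleFun c (4 / τ) (4 / τ * (∑ k, c k - ∑ i, r i) + 2) (fun k => 4 / τ * μ k) z + 2 =
        ((4 / τ : ℝ) : ℂ) * ((∏ i, (z - (l i : ℂ))) / ∏ k, (z - (c k : ℂ))) := by
    intro z hz
    have hDz : (∏ k, (z - (c k : ℂ))) ≠ 0 :=
      Finset.prod_ne_zero_iff.mpr fun k _ => sub_ne_zero.mpr (hz k)
    rw [eq_add_of_sub_eq (hscale z hz), eq_add_of_sub_eq (hdiff z), Complex.ofReal_div,
      Complex.ofReal_ofNat]
    field_simp
    ring
  refine ⟨4 / τ, 4 / τ * (∑ k, c k - ∑ i, r i) + 2, fun k => 4 / τ * μ k, by positivity,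
    fun k => mul_pos (by positivity) (neg_pos.mpr (hneg k)),
    fun z hz => ⟨hscale z hz, hscale2 z hz⟩, fun z hzE hz0 => ?_⟩
  have hz : ∀ k, z ≠ c k := fun k he => hz0 (he ▸ hcΨ k)
  have hDz : (∏ k, (z - (c k : ℂ))) ≠ 0 :=
    Finset.prod_ne_zero_iff.mpr fun k _ => sub_ne_zero.mpr (hz k)
  have h1 := hid z hzE
  have h2 := hdiff z
  rw [eq_add_of_sub_eq (hscale z hz), Complex.ofReal_div, Complex.ofReal_ofNat]
  field_simp
  rw [eq_add_of_sub_eq h2] at h1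
  linear_combination -h1

end

section

open Filter Topology

/-! ### Transfer matrices over commutative real algebras -/

/-- The nilpotent matrix `[p; q] [p q] 𝔧`. -/
def nilJ {R : Type*} [CommRing R] (p q : R) : Matrix (Fin 2) (Fin 2) R :=
  !![p * q, -(p * p); q * q, -(p * q)]

/-- `𝔞(z, ∞; p, q)` over a commutative ring, with `t` in the place of `1 / p`. -/
def transferInftyRing {R : Type*} [CommRing R] (z p t q : R) : Matrix (Fin 2) (Fin 2) R :=
  !![0, -p; t, t * z - q]

/-- The monodromy matrix over a commutative ring, with `y k` in the place of `1 / (c k - z)` and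
`t` in the place of `1 / p_g`. -/
def monodromy {R : Type*} [CommRing R] {g : ℕ} (z t : R) (y : Fin g → R) (p q : Fin (g + 1) → R) :
    Matrix (Fin 2) (Fin 2) R :=
  ((List.finRange g).map fun k => 1 - y k • nilJ (p k.castSucc) (q k.castSucc)).prod *
    transferInftyRing z (p (Fin.last g)) t (q (Fin.last g))

theorem vecMulVec_mul_matJ (p q : ℝ) : Matrix.vecMulVec ![p, q] ![p, q] * matJ = nilJ p q := by
  ext i j
  fin_cases i <;> fin_cases j <;> simp [matJ, nilJ, Matrix.vecMulVec, Matrix.mul_apply, mul_comm]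

theorem transferAt_eq (z c p q : ℝ) : transferAt z c p q = 1 - (1 / (c - z)) • nilJ p q := by
  rw [transferAt, vecMulVec_mul_matJ]

theorem transferInfty_eq {z p q : ℝ} (hp : p ≠ 0) :
    transferInfty z p q = transferInftyRing z p (1 / p) q := by
  rw [transferInfty, transferInftyRing]
  congr 3
  field_simp

theorem det_monodromy {R : Type*} [CommRing R] {g : ℕ} (z : R) {t : R} (y : Fin g → R)
    {p : Fin (g + 1) → R} (q : Fin (g + 1) → R) (ht : p (Fin.last g) * t = 1) :
    (monodromy z t y p q).det = 1 := by
  have h1 : ∀ k : Fin g, (1 - y k • nilJ (p k.castSucc) (q k.castSucc)).det = 1 := by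
    intro k
    rw [Matrix.det_fin_two]
    simp [nilJ]
    ring
  have h2 : ∀ l : List (Fin g),
      ((l.map fun k => 1 - y k • nilJ (p k.castSucc) (q k.castSucc)).prod).det = 1 := by
    intro l
    induction l with
    | nil => simp
    | cons k l ih => rw [List.map_cons, List.prod_cons, Matrix.det_mul, h1, ih, one_mul]
  rw [monodromy, Matrix.det_mul, h2, one_mul, transferInftyRing, Matrix.det_fin_two_of]
  linear_combination ht

open scoped Matrix.Module in
/-- A chain of vectors linked by matrices; the entries of the vectors lie in a module, on which
`2 × 2` matrices act through `Matrix.Module`. -/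
theorem chain_eq_prod_smul {R M : Type*} [CommRing R] [AddCommGroup M] [Module R M] {g : ℕ}
    (X : Fin (g + 1) → Fin 2 → M) (a : Fin g → Matrix (Fin 2) (Fin 2) R)
    (h : ∀ i : Fin g, X i.castSucc = a i • X i.succ) :
    X 0 = ((List.finRange g).map a).prod • X (Fin.last g) := by
  induction g with
  | zero => simp
  | succ g ih =>
    have h1 := ih (fun i => X i.succ) (fun i => a i.succ) (fun i => h i.succ)
    rw [List.finRange_succ, List.map_cons, List.prod_cons, List.map_map, mul_smul]
    exact (h 0).trans (congrArg (fun Y => a 0 • Y) h1)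

section Eigen

variable {R M : Type*} [CommRing R] [AddCommGroup M] [Module R M] {g : ℕ}

/-- The formal Floquet eigenvalue problem: `z` is an eigenvalue with eigenvector `v` of the symbol
`w⁻¹ A(p)* + B(p, q) + w A(p)`, over a commutative ring `R` and for entries of `v` in a module. -/
structure IsFloquetVector (c : Fin g → R) (p q : Fin (g + 1) → R) (z w w' : R)
    (v : Fin (g + 1) → M) : Prop where
  row : ∀ i : Fin g, (z - c i) • v i.castSucc =
    p i.castSucc • (∑ j, if j ≤ i.castSucc then q j • v j else 0) +
      q i.castSucc • (∑ j, if i.castSucc < j then p j • v j else 0) +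
      (p i.castSucc * w') • v (Fin.last g)
  lastRow : z • v (Fin.last g) = p (Fin.last g) • (∑ j, q j • v j) + w • (∑ j, p j • v j) +
    (p (Fin.last g) * w') • v (Fin.last g)

/-- The sum `∑ p j • v j` over `j ≥ i`. -/
def tailSum (p : Fin (g + 1) → R) (v : Fin (g + 1) → M) (i : Fin (g + 1)) : M :=
  ∑ j, if i ≤ j then p j • v j else 0

/-- The sum `∑ q j • v j` over `j < i`. -/
def headSum (q : Fin (g + 1) → R) (v : Fin (g + 1) → M) (i : Fin (g + 1)) : M :=
  ∑ j, if j < i then q j • v j else 0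

theorem tailSum_castSucc (p : Fin (g + 1) → R) (v : Fin (g + 1) → M) (i : Fin g) :
    tailSum p v i.castSucc = tailSum p v i.succ + p i.castSucc • v i.castSucc := by
  have : ∀ j : Fin (g + 1), (if i.castSucc ≤ j then p j • v j else 0) =
      (if i.succ ≤ j then p j • v j else 0) + if j = i.castSucc then p j • v j else 0 := by
    intro j
    simp only [← Fin.castSucc_lt_iff_succ_le]
    rcases lt_trichotomy i.castSucc j with h | h | h
    · simp [h, h.le, h.ne']
    · simp [← h]
    · simp [not_le.mpr h, not_lt.mpr h.le, h.ne]
  rw [tailSum, Finset.sum_congr rfl fun j _ => this j, Finset.sum_add_distrib,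
    Finset.sum_ite_eq' Finset.univ, if_pos (Finset.mem_univ _), tailSum]

theorem headSum_succ (q : Fin (g + 1) → R) (v : Fin (g + 1) → M) (i : Fin g) :
    headSum q v i.succ = headSum q v i.castSucc + q i.castSucc • v i.castSucc := by
  have : ∀ j : Fin (g + 1), (if j < i.succ then q j • v j else 0) =
      (if j < i.castSucc then q j • v j else 0) + if j = i.castSucc then q j • v j else 0 := by
    intro j
    simp only [← Fin.le_castSucc_iff]
    rcases lt_trichotomy i.castSucc j with h | h | h
    · simp [not_le.mpr h, not_lt.mpr h.le, h.ne']
    · simp [← h]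
    · simp [h, h.le, h.ne]
  rw [headSum, Finset.sum_congr rfl fun j _ => this j, Finset.sum_add_distrib,
    Finset.sum_ite_eq' Finset.univ, if_pos (Finset.mem_univ _), headSum]

theorem tailSum_zero (p : Fin (g + 1) → R) (v : Fin (g + 1) → M) :
    tailSum p v 0 = ∑ j, p j • v j := by simp [tailSum]

theorem headSum_zero (q : Fin (g + 1) → R) (v : Fin (g + 1) → M) : headSum q v 0 = 0 := by
  simp [headSum]

theorem tailSum_last (p : Fin (g + 1) → R) (v : Fin (g + 1) → M) :
    tailSum p v (Fin.last g) = p (Fin.last g) • v (Fin.last g) := by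
  simp [tailSum, Fin.last_le_iff]

theorem headSum_last (q : Fin (g + 1) → R) (v : Fin (g + 1) → M) :
    ∑ j, q j • v j = headSum q v (Fin.last g) + q (Fin.last g) • v (Fin.last g) := by
  have : ∀ j : Fin (g + 1), q j • v j =
      (if j < Fin.last g then q j • v j else 0) + if j = Fin.last g then q j • v j else 0 := by
    intro j
    rcases eq_or_lt_of_le (Fin.le_last j) with h | h
    · simp [h]
    · simp [h, h.ne]
  rw [Finset.sum_congr rfl fun j _ => this j, Finset.sum_add_distrib,
    Finset.sum_ite_eq' Finset.univ, if_pos (Finset.mem_univ _), headSum]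

namespace IsFloquetVector

variable {c : Fin g → R} {p q : Fin (g + 1) → R} {z w w' : R} {v : Fin (g + 1) → M}

theorem row' (h : IsFloquetVector c p q z w w' v) (i : Fin g) : (z - c i) • v i.castSucc =
    p i.castSucc • (headSum q v i.succ + w' • v (Fin.last g)) +
      q i.castSucc • tailSum p v i.succ := by
  have e1 : (∑ j, if j ≤ i.castSucc then q j • v j else 0) = headSum q v i.succ := by
    simp only [headSum, Fin.le_castSucc_iff]
  have e2 : (∑ j, if i.castSucc < j then p j • v j else 0) = tailSum p v i.succ := by
    simp only [tailSum, Fin.castSucc_lt_iff_succ_le]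
  rw [h.row i, e1, e2]
  module

theorem eq_neg_smul (h : IsFloquetVector c p q z w w' v) {y : Fin g → R}
    (hy : ∀ k, (c k - z) * y k = 1) (i : Fin g) : v i.castSucc =
    -(y i • (p i.castSucc • (headSum q v i.succ + w' • v (Fin.last g)) +
      q i.castSucc • tailSum p v i.succ)) := by
  rw [← h.row' i, smul_smul, ← neg_smul]
  have : -(y i * (z - c i)) = 1 := by linear_combination hy i
  rw [this, one_smul]

open scoped Matrix.Module in
/-- Cayley–Hamilton for the monodromy matrix: all entries of a Floquet vector are annihilated by
`w + w⁻¹ - tr`. In this way the spectral variable `z` may be an operator. -/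
theorem smul_eq_zero (h : IsFloquetVector c p q z w w' v) (hw : w * w' = 1) {t : R}
    (ht : p (Fin.last g) * t = 1) {y : Fin g → R} (hy : ∀ k, (c k - z) * y k = 1)
    (i : Fin (g + 1)) : (w + w' - (monodromy z t y p q).trace) • v i = 0 := by
  -- the transfer matrices link these vectors, and the last one closes the chain up to `w`
  set X : Fin (g + 1) → Fin 2 → M := fun i =>
    ![tailSum p v i, -(headSum q v i + w' • v (Fin.last g))] with hX
  have hstep : ∀ i : Fin g,
      X i.castSucc = (1 - y i • nilJ (p i.castSucc) (q i.castSucc)) • X i.succ := by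
    intro i
    have h1 := h.eq_neg_smul hy i
    have h2 := tailSum_castSucc p v i
    have h3 := headSum_succ q v i
    ext j
    fin_cases j
    · simp only [hX, Matrix.Module.smul_apply, Fin.sum_univ_two, nilJ]
      simp
      rw [h2]
      nth_rewrite 1 [h1]
      module
    · simp only [hX, Matrix.Module.smul_apply, Fin.sum_univ_two, nilJ]
      simp
      rw [eq_sub_of_add_eq h3.symm]
      nth_rewrite 1 [h1]
      module
  have hlast : X (Fin.last g) =
      w • (transferInftyRing z (p (Fin.last g)) t (q (Fin.last g)) • X 0) := by
    have h1 := h.lastRow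
    rw [headSum_last q v, ← tailSum_zero] at h1
    ext j
    fin_cases j
    · simp only [hX, Pi.smul_apply, Matrix.Module.smul_apply, Fin.sum_univ_two, transferInftyRing]
      simp
      rw [tailSum_last, headSum_zero]
      linear_combination (norm := module) -(p (Fin.last g) • congrArg (· • v (Fin.last g)) hw)
    · simp only [hX, Pi.smul_apply, Matrix.Module.smul_apply, Fin.sum_univ_two, transferInftyRing]
      simp
      rw [headSum_zero]
      linear_combination (norm := module) t • h1 +
        congrArg (· • (headSum q v (Fin.last g) + q (Fin.last g) • v (Fin.last g)
          + w' • v (Fin.last g))) ht + (t * z - q (Fin.last g)) • congrArg (· • v (Fin.last g)) hw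
  have hchain := chain_eq_prod_smul X _ hstep
  rw [hlast, smul_comm, ← mul_smul] at hchain
  change X 0 = w • (monodromy z t y p q • X 0) at hchain
  set T := monodromy z t y p q with hT
  have hdet := det_monodromy z y q ht
  rw [← hT, Matrix.det_fin_two] at hdet
  have hr0 := congrFun hchain 0
  have hr1 := congrFun hchain 1
  simp only [Pi.smul_apply, Matrix.Module.smul_apply, Fin.sum_univ_two] at hr0 hr1
  -- Cayley–Hamilton for `T`, whose determinant is one, written out with `w T X₀ = X₀`
  set τ := w + w' - T.trace with hτ
  rw [Matrix.trace_fin_two] at hτ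
  have hs : w - (T 0 0 + T 1 1) + w' * w * (T 0 0 + T 1 1) -
      w' * w ^ 2 * (T 0 0 * T 1 1 - T 0 1 * T 1 0) = 0 := by
    linear_combination (T 0 0 + T 1 1 - w) * hw - w * w * w' * hdet
  have hX0 : τ • X 0 = 0 := by
    ext j
    fin_cases j
    · change τ • X 0 0 = 0
      rw [hτ]
      linear_combination (norm := module) (w' * (1 - w * T 1 1)) • hr0 + (w' * w * T 0 1) • hr1 +
        congrArg (· • X 0 0) hs
    · change τ • X 0 1 = 0
      rw [hτ]
      linear_combination (norm := module) (w' * (1 - w * T 0 0)) • hr1 + (w' * w * T 1 0) • hr0 +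
        congrArg (· • X 0 1) hs
  have hXlast : τ • X (Fin.last g) = 0 := by
    rw [hlast, smul_comm τ w, smul_comm τ (transferInftyRing _ _ _ _), hX0, smul_zero, smul_zero]
  have hvlast : τ • v (Fin.last g) = 0 := by
    have := congrFun hXlast 0
    simp only [hX, Pi.smul_apply, Matrix.cons_val_zero, tailSum_last, Pi.zero_apply] at this
    linear_combination (norm := module) t • this - τ • congrArg (· • v (Fin.last g)) ht
  have hv : ∀ i : Fin g, τ • X i.succ = 0 → τ • v i.castSucc = 0 := by
    intro i hi
    have h0 := congrFun hi 0
    have h1 := congrFun hi 1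
    simp only [hX, Pi.smul_apply, Matrix.cons_val_zero, Matrix.cons_val_one, Pi.zero_apply] at h0 h1
    rw [h.eq_neg_smul hy i]
    linear_combination (norm := module) (y i * p i.castSucc) • h1 - (y i * q i.castSucc) • h0
  have hXall : ∀ i : Fin (g + 1), τ • X i = 0 := by
    intro i
    induction i using Fin.reverseInduction with
    | last => exact hXlast
    | cast i hi => rw [hstep i, smul_comm τ, hi, smul_zero]
  induction i using Fin.lastCases with
  | last => exact hvlast
  | cast i => exact hv i (hXall _)

end IsFloquetVector

end Eigen

/-! ### Partial fractions of the trace of the monodromy matrix -/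

/-- The residues of a product of factors `1 - (c k - z)⁻¹ N k` with distinct poles; they depend
neither on the algebra nor on the value of `z` in it. The algebra is universally quantified because
the same residues serve both for real numbers and for operators. -/
theorem exists_prod_eq_one_add_sum {g : ℕ} {c : Fin g → ℝ} (hc : Function.Injective c)
    (N : Fin g → Matrix (Fin 2) (Fin 2) ℝ) (l : List (Fin g)) (hl : l.Nodup) :
    ∃ Rs : Fin g → Matrix (Fin 2) (Fin 2) ℝ, ∑ k, Rs k = -(l.map N).sum ∧
      (∀ k ∉ l, Rs k = 0) ∧
      ∀ (R : Type) [CommRing R] [Algebra ℝ R] (z : R) (y : Fin g → R),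
        (∀ k, (algebraMap ℝ R (c k) - z) * y k = 1) →
        (l.map fun k => 1 - y k • (N k).map (algebraMap ℝ R)).prod =
          1 + ∑ k, y k • (Rs k).map (algebraMap ℝ R) := by
  induction l with
  | nil => exact ⟨0, by simp, by simp, by intros; simp⟩
  | cons k₀ l ih =>
    obtain ⟨hk₀, hl⟩ := List.nodup_cons.mp hl
    obtain ⟨Rs, hsum, hout, hprod⟩ := ih hl
    set S : Fin g → Matrix (Fin 2) (Fin 2) ℝ := fun k => (c k₀ - c k)⁻¹ • (N k₀ * Rs k) with hS
    refine ⟨fun k => Rs k - S k + (if k = k₀ then -N k₀ + ∑ k, S k else 0), ?_, ?_, ?_⟩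
    · rw [Finset.sum_add_distrib, Finset.sum_sub_distrib, Finset.sum_ite_eq' Finset.univ,
        if_pos (Finset.mem_univ _), hsum, List.map_cons, List.sum_cons]
      abel
    · intro k hk
      rw [List.mem_cons, not_or] at hk
      simp [hS, hout k hk.2, hk.1]
    · intro R _ _ z y hy
      rw [List.map_cons, List.prod_cons, hprod R z y hy]
      set φ : ℝ →+* R := algebraMap ℝ R
      have hmul : ∀ k, (y k₀ * y k) • ((N k₀).map φ * (Rs k).map φ) =
          (y k - y k₀) • (S k).map φ := by
        intro k
        have hSk : (S k).map φ = φ (c k₀ - c k)⁻¹ • ((N k₀).map φ * (Rs k).map φ) := by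
          ext i j
          simp [hS, Matrix.mul_apply]
        rw [hSk, smul_smul]
        by_cases hk : k = k₀
        · subst hk
          rw [hout k hk₀]
          simp
        · have hne : c k₀ - c k ≠ 0 := sub_ne_zero.mpr fun h => hk (hc h.symm)
          have h1 : φ (c k₀ - c k) * φ (c k₀ - c k)⁻¹ = 1 := by
            rw [← map_mul, mul_inv_cancel₀ hne, map_one]
          rw [map_sub] at h1
          congr 1
          have e1 := hy k
          have e2 := hy k₀
          have e3 : (φ (c k₀) - φ (c k)) * (y k₀ * y k) = y k - y k₀ := by
            linear_combination y k * e2 - y k₀ * e1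
          linear_combination φ (c k₀ - c k)⁻¹ * e3 - y k₀ * y k * h1
      have e1 : ∀ k, y k • (Rs k - S k + (if k = k₀ then -N k₀ + ∑ k, S k else 0)).map φ =
          y k • (Rs k).map φ - y k • (S k).map φ +
            (if k = k₀ then y k₀ • (-(N k₀).map φ + ∑ k, (S k).map φ) else 0) := by
        intro k
        have hadd : ∀ A B : Matrix (Fin 2) (Fin 2) ℝ, (A + B).map φ = A.map φ + B.map φ :=
          fun A B => Matrix.map_add φ (map_add φ) A B
        have hsub : ∀ A B : Matrix (Fin 2) (Fin 2) ℝ, (A - B).map φ = A.map φ - B.map φ :=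
          fun A B => Matrix.map_sub φ (map_sub φ) A B
        have hsm : (∑ k, S k).map φ = ∑ k, (S k).map φ :=
          map_sum φ.mapMatrix S Finset.univ
        have hneg : (-N k₀).map φ = -(N k₀).map φ := map_neg φ.mapMatrix (N k₀)
        by_cases hk : k = k₀
        · subst hk
          rw [if_pos rfl, if_pos rfl, hadd, hsub, hadd, hsm, hneg, smul_add, smul_sub]
        · rw [if_neg hk, if_neg hk, add_zero, add_zero, hsub, smul_sub]
      rw [Finset.sum_congr rfl fun k _ => e1 k, Finset.sum_add_distrib, Finset.sum_sub_distrib,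
        Finset.sum_ite_eq' Finset.univ, if_pos (Finset.mem_univ _)]
      have e2 : (y k₀ • (N k₀).map φ) * ∑ k, y k • (Rs k).map φ =
          ∑ k, y k • (S k).map φ - y k₀ • ∑ k, (S k).map φ := by
        rw [Finset.mul_sum, Finset.smul_sum, ← Finset.sum_sub_distrib]
        refine Finset.sum_congr rfl fun k _ => ?_
        rw [smul_mul_smul_comm, hmul k, sub_smul]
      rw [sub_mul, one_mul, mul_add, mul_one, e2, smul_add, smul_neg]
      abel

theorem List.eq_filter_append_cons_filter {α : Type*} [LinearOrder α] {l : List α}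
    (hl : l.Pairwise (· < ·)) {k : α} (hk : k ∈ l) :
    l = l.filter (fun m => m < k) ++ k :: l.filter (fun m => k < m) := by
  induction l with
  | nil => simp at hk
  | cons a l ih =>
    obtain ⟨h1, h2⟩ := List.pairwise_cons.mp hl
    rcases List.mem_cons.mp hk with rfl | hk
    · rw [List.filter_cons_of_neg (by simp), List.filter_cons_of_neg (by simp),
        List.filter_eq_nil_iff.mpr fun m hm => by simpa using (h1 m hm).le,
        List.filter_eq_self.mpr fun m hm => by simpa using h1 m hm, List.nil_append]
    · have h3 := h1 k hk
      rw [List.filter_cons_of_pos (by simpa using h3), List.filter_cons_of_neg (by simpa using h3.le),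
        List.cons_append, ← ih h2 hk]

/-- The constant term of the discriminant. -/
noncomputable def discrConst {g : ℕ} (p q : Fin (g + 1) → ℝ) : ℝ :=
  -q (Fin.last g) - 1 / p (Fin.last g) * ∑ k : Fin g, p k.castSucc * q k.castSucc

theorem nilJ_map {R : Type*} [CommRing R] [Algebra ℝ R] (p q : ℝ) :
    (nilJ p q).map (algebraMap ℝ R) = nilJ (algebraMap ℝ R p) (algebraMap ℝ R q) := by
  ext i j
  fin_cases i <;> fin_cases j <;> simp [nilJ]

/-- The partial fraction decomposition of the trace of the monodromy matrix, with residues that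
are still to be identified. -/
theorem exists_trace_monodromy_eq {g : ℕ} {c : Fin g → ℝ} (hc : Function.Injective c)
    (p q : Fin (g + 1) → ℝ) :
    ∃ ρ : Fin g → ℝ, ∀ (R : Type) [CommRing R] [Algebra ℝ R] (z : R) (y : Fin g → R),
      (∀ k, (algebraMap ℝ R (c k) - z) * y k = 1) →
      (monodromy z (algebraMap ℝ R (1 / p (Fin.last g))) y (fun i => algebraMap ℝ R (p i))
          (fun i => algebraMap ℝ R (q i))).trace =
        algebraMap ℝ R (1 / p (Fin.last g)) * z + algebraMap ℝ R (discrConst p q) +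
          ∑ k, algebraMap ℝ R (ρ k) * y k := by
  obtain ⟨Rs, hsum, -, hprod⟩ := exists_prod_eq_one_add_sum hc
    (fun k => nilJ (p k.castSucc) (q k.castSucc)) (List.finRange g) (List.nodup_finRange g)
  set t := 1 / p (Fin.last g) with ht
  refine ⟨fun k => (Rs k * transferInftyRing (c k) (p (Fin.last g)) t (q (Fin.last g))).trace, ?_⟩
  intro R _ _ z y hy
  set φ : ℝ →+* R := algebraMap ℝ R
  have h1 := hprod R z y hy
  simp only [nilJ_map] at h1
  rw [monodromy, h1, add_mul, one_mul, Matrix.trace_add, Finset.sum_mul, Matrix.trace_sum]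
  have h2 : ∀ k, (y k • (Rs k).map φ *
      transferInftyRing z (φ (p (Fin.last g))) (φ t) (φ (q (Fin.last g)))).trace =
      φ (Rs k * transferInftyRing (c k) (p (Fin.last g)) t (q (Fin.last g))).trace * y k -
        φ t * φ (Rs k 1 1) := by
    intro k
    simp only [Matrix.trace_fin_two, Matrix.mul_apply, Fin.sum_univ_two, transferInftyRing,
      Matrix.smul_apply, Matrix.map_apply, Matrix.of_apply, Matrix.cons_val_zero,
      Matrix.cons_val_one, Matrix.cons_val', smul_eq_mul, map_add, map_mul, map_sub, map_neg,
      map_zero]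
    linear_combination -φ t * φ (Rs k 1 1) * hy k
  rw [Finset.sum_congr rfl fun k _ => h2 k, Finset.sum_sub_distrib, ← Finset.mul_sum, ← map_sum]
  have h3 : ∑ k, Rs k 1 1 = ∑ k : Fin g, p k.castSucc * q k.castSucc := by
    have h4 := congrArg (fun A : Matrix (Fin 2) (Fin 2) ℝ => A 1 1) hsum
    have h5 : ((List.finRange g).map fun k => nilJ (p k.castSucc) (q k.castSucc)).sum =
        ∑ k : Fin g, nilJ (p k.castSucc) (q k.castSucc) := by
      rw [← List.sum_toFinset _ (List.nodup_finRange g), List.toFinset_finRange]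
    rw [h5] at h4
    simpa [Matrix.sum_apply, nilJ] using h4
  rw [h3, discrConst]
  simp only [transferInftyRing, Matrix.trace_fin_two, Matrix.of_apply, Matrix.cons_val_zero,
      Matrix.cons_val_one, Matrix.cons_val', map_sub, map_neg, map_mul]
  rw [← ht]
  ring

/-- The residues of the trace of the monodromy matrix are the functions `Λ_k`. -/
theorem trace_monodromy_eq {g : ℕ} {c : Fin g → ℝ} (hc : Function.Injective c)
    {p : Fin (g + 1) → ℝ} (q : Fin (g + 1) → ℝ) (hp : p (Fin.last g) ≠ 0)
    {R : Type} [CommRing R] [Algebra ℝ R] (z : R) {y : Fin g → R}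
    (hy : ∀ k, (algebraMap ℝ R (c k) - z) * y k = 1) :
    (monodromy z (algebraMap ℝ R (1 / p (Fin.last g))) y (fun i => algebraMap ℝ R (p i))
        (fun i => algebraMap ℝ R (q i))).trace =
      algebraMap ℝ R (1 / p (Fin.last g)) * z + algebraMap ℝ R (discrConst p q) +
        ∑ k, algebraMap ℝ R (Lam c p q k) * y k := by
  obtain ⟨ρ, hρ⟩ := exists_trace_monodromy_eq hc p q
  suffices h : ∀ k, ρ k = Lam c p q k by
    rw [hρ R z y hy]
    simp only [h]
  intro k
  set a : ℝ → Fin g → Matrix (Fin 2) (Fin 2) ℝ := fun z m =>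
    transferAt z (c m) (p m.castSucc) (q m.castSucc) with ha
  set N := nilJ (p k.castSucc) (q k.castSucc) with hN
  have hac : ∀ m, m ≠ k → ContinuousAt (fun z => a z m) (c k) := by
    intro m hm
    simp only [ha, transferAt_eq]
    have h1 : ContinuousAt (fun z => 1 / (c m - z)) (c k) :=
      continuousAt_const.div (by fun_prop) (sub_ne_zero.mpr fun h => hm (hc h))
    exact continuousAt_const.sub (h1.smul continuousAt_const)
  have hlc : ∀ l : List (Fin g), (∀ m ∈ l, m ≠ k) →
      ContinuousAt (fun z => (l.map (a z)).prod) (c k) := by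
    intro l
    induction l with
    | nil => intro _; simpa using continuousAt_const
    | cons m l ih =>
      intro hm
      simp only [List.map_cons, List.prod_cons]
      exact (hac m (hm m (by simp))).mul (ih fun m' hm' => hm m' (by simp [hm']))
  set l₁ := (List.finRange g).filter (fun m => m < k) with hl₁
  set l₂ := (List.finRange g).filter (fun m => k < m) with hl₂
  have hsplit : List.finRange g = l₁ ++ k :: l₂ :=
    List.eq_filter_append_cons_filter (List.pairwise_lt_finRange g) (List.mem_finRange k)
  have hTc : Continuous fun z => transferInfty z (p (Fin.last g)) (q (Fin.last g)) := by
    refine continuous_matrix fun i j => ?_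
    fin_cases i <;> fin_cases j <;> simp [transferInfty] <;> fun_prop
  -- both `f` and `F` are continuous continuations of `(c k - z) * tr` to the point `c k`
  set f : ℝ → ℝ := fun z => ((l₁.map (a z)).prod * ((c k - z) • 1 - N) * (l₂.map (a z)).prod *
    transferInfty z (p (Fin.last g)) (q (Fin.last g))).trace with hf
  have hfc : ContinuousAt f (c k) := by
    have h1 := hlc l₁ fun m hm => ne_of_lt (by simpa [hl₁] using hm)
    have h2 := hlc l₂ fun m hm => ne_of_gt (by simpa [hl₂] using hm)
    have h3 : Continuous fun z : ℝ => (c k - z) • (1 : Matrix (Fin 2) (Fin 2) ℝ) - N := by fun_prop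
    exact (Continuous.matrix_trace continuous_id).continuousAt.comp
      (((h1.mul h3.continuousAt).mul h2).mul hTc.continuousAt)
  have hfk : f (c k) = Lam c p q k := by
    rw [hf, Lam]
    simp only [sub_self, zero_smul, zero_sub, mul_neg, neg_mul, Matrix.trace_neg,
      vecMulVec_mul_matJ, ha]
    rfl
  set F : ℝ → ℝ := fun z => (c k - z) * (1 / p (Fin.last g) * z + discrConst p q +
    ∑ m ∈ Finset.univ.erase k, ρ m * (1 / (c m - z))) + ρ k with hF
  have hFc : ContinuousAt F (c k) := by
    refine ContinuousAt.add (ContinuousAt.mul (by fun_prop) (ContinuousAt.add (by fun_prop) ?_))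
      continuousAt_const
    refine tendsto_finsetSum _ fun m hm => ?_
    exact continuousAt_const.mul (continuousAt_const.div (by fun_prop)
      (sub_ne_zero.mpr fun h => Finset.ne_of_mem_erase hm (hc h)))
  have hFk : F (c k) = ρ k := by simp [hF]
  rw [← hFk, ← hfk]
  have hne : ∀ᶠ z in 𝓝[≠] (c k), ∀ m, c m - z ≠ 0 := by
    rw [eventually_all]
    intro m
    by_cases hm : m = k
    · subst hm
      filter_upwards [self_mem_nhdsWithin] with z hz
      exact sub_ne_zero.mpr (Ne.symm hz)
    · have : ∀ᶠ z in 𝓝 (c k), z ≠ c m := isOpen_ne.mem_nhds fun h => hm (hc h.symm)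
      filter_upwards [nhdsWithin_le_nhds this] with z hz
      exact sub_ne_zero.mpr (Ne.symm hz)
  refine tendsto_nhds_unique (hFc.tendsto.mono_left (nhdsWithin_le_nhds (s := {c k}ᶜ)))
    ((hfc.tendsto.mono_left nhdsWithin_le_nhds).congr' ?_)
  filter_upwards [hne] with z hz
  have h1 := hρ ℝ z (fun m => 1 / (c m - z)) fun m => by
    simpa using mul_inv_cancel₀ (hz m)
  simp only [Algebra.algebraMap_self, RingHom.id_apply] at h1
  rw [monodromy, ← transferInfty_eq hp] at h1
  simp only [← transferAt_eq] at h1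
  change (((List.finRange g).map (a z)).prod * _).trace = _ at h1
  have h2 : (c k - z) • (((List.finRange g).map (a z)).prod *
      transferInfty z (p (Fin.last g)) (q (Fin.last g))) =
      (l₁.map (a z)).prod * ((c k - z) • 1 - N) * (l₂.map (a z)).prod *
        transferInfty z (p (Fin.last g)) (q (Fin.last g)) := by
    have h3 : (c k - z) • a z k = (c k - z) • 1 - N := by
      simp only [ha, transferAt_eq, smul_sub, smul_smul, mul_one_div_cancel (hz k), one_smul, hN]
    rw [hsplit, List.map_append, List.map_cons, List.prod_append, List.prod_cons, ← h3]
    simp only [Matrix.mul_smul, Matrix.smul_mul, Matrix.mul_assoc]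
  simp only [hf, hF]
  rw [← h2, Matrix.trace_smul, h1, smul_eq_mul,
    ← Finset.add_sum_erase Finset.univ _ (Finset.mem_univ k)]
  have := hz k
  field_simp
  ring

/-! ### The shift on `ℓ²(ℤ)` -/

theorem EllTwo.summable_norm_sq (f : EllTwo) : Summable fun m => ‖f m‖ ^ 2 := by
  have := (lp.memℓp f).summable (by norm_num)
  simpa using this

theorem EllTwo.norm_sq_eq_tsum (f : EllTwo) : ‖f‖ ^ 2 = ∑' m, ‖f m‖ ^ 2 := by
  have := lp.norm_rpow_eq_tsum (p := 2) (by norm_num) f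
  simpa using this

/-- The translate of a square summable sequence. -/
noncomputable def EllTwo.translate (k : ℤ) (f : EllTwo) : EllTwo :=
  ⟨fun m => f (m - k), by
    refine memℓp_gen ?_
    have := f.summable_norm_sq.comp_injective (sub_left_injective (b := k))
    simpa [Function.comp_def] using this⟩

@[simp]
theorem EllTwo.translate_apply (k : ℤ) (f : EllTwo) (m : ℤ) : f.translate k m = f (m - k) := rfl

/-- The shift `e n ↦ e (n + k)` as a unitary map. -/
noncomputable def shiftIso (k : ℤ) : EllTwo ≃ₗᵢ[ℂ] EllTwo where
  toFun := EllTwo.translate k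
  invFun := EllTwo.translate (-k)
  map_add' f h := by ext m; simp
  map_smul' a f := by ext m; simp
  left_inv f := by ext m; simp
  right_inv f := by ext m; simp
  norm_map' f := by
    have h1 : ‖EllTwo.translate k f‖ ^ 2 = ‖f‖ ^ 2 := by
      rw [EllTwo.norm_sq_eq_tsum, EllTwo.norm_sq_eq_tsum]
      exact (Equiv.subRight k).tsum_eq fun m => ‖f m‖ ^ 2
    exact (sq_eq_sq₀ (norm_nonneg _) (norm_nonneg _)).mp h1

/-- The shift as an invertible element of the algebra of bounded operators. -/
noncomputable def shiftUnit (k : ℤ) : (EllTwo →L[ℂ] EllTwo)ˣ :=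
  Unitary.toUnits (Unitary.linearIsometryEquiv.symm (shiftIso k))

theorem shiftUnit_apply (k : ℤ) (f : EllTwo) (m : ℤ) :
    (shiftUnit k : EllTwo →L[ℂ] EllTwo) f m = f (m - k) := rfl

theorem shiftUnit_inv_apply (k : ℤ) (f : EllTwo) (m : ℤ) :
    ((shiftUnit k)⁻¹ : (EllTwo →L[ℂ] EllTwo)ˣ).val f m = f (m + k) := by
  have h1 : (shiftUnit k : EllTwo →L[ℂ] EllTwo) (((shiftUnit k)⁻¹ : (EllTwo →L[ℂ] EllTwo)ˣ).val f) =
      f := by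
    rw [← mul_apply_eq_comp, Units.mul_inv, one_apply_eq_self]
  have h2 := shiftUnit_apply k (((shiftUnit k)⁻¹ : (EllTwo →L[ℂ] EllTwo)ˣ).val f) (m + k)
  rw [h1, add_sub_cancel_right] at h2
  exact h2.symm

theorem shiftUnit_single (k n : ℤ) :
    (shiftUnit k : EllTwo →L[ℂ] EllTwo) (lp.single 2 n 1) = lp.single 2 (n + k) 1 := by
  ext m
  rw [shiftUnit_apply, lp.single_apply, lp.single_apply, Pi.single_apply, Pi.single_apply]
  simp [sub_eq_iff_eq_add]

theorem shiftUnit_inv_single (k n : ℤ) :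
    ((shiftUnit k)⁻¹ : (EllTwo →L[ℂ] EllTwo)ˣ).val (lp.single 2 n 1) = lp.single 2 (n - k) 1 := by
  ext m
  rw [shiftUnit_inv_apply, lp.single_apply, lp.single_apply, Pi.single_apply, Pi.single_apply]
  simp [eq_sub_iff_add_eq]

theorem EllTwo.clm_ext {S T : EllTwo →L[ℂ] EllTwo}
    (h : ∀ n, S (lp.single 2 n 1) = T (lp.single 2 n 1)) : S = T := by
  ext1 f
  have h1 := lp.hasSum_single (p := 2) (by norm_num) f
  have h2 := h1.mapL S
  have h3 := h1.mapL T
  have h4 : ∀ (R : EllTwo →L[ℂ] EllTwo) (n : ℤ),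
      R (lp.single 2 n (f n)) = f n • R (lp.single 2 n 1) := by
    intro R n
    rw [← map_smul, ← lp.single_smul, smul_eq_mul, mul_one]
  simp only [h4, h] at h2 h3
  exact h2.unique h3

theorem norm_eq_one_of_not_isUnit_shiftUnit_sub {k : ℤ} {w : ℂ}
    (h : ¬ IsUnit ((shiftUnit k : EllTwo →L[ℂ] EllTwo) - w • 1)) : ‖w‖ = 1 := by
  have h1 : (shiftUnit k : EllTwo →L[ℂ] EllTwo) ∈ unitary (EllTwo →L[ℂ] EllTwo) :=
    (Unitary.linearIsometryEquiv.symm (shiftIso k)).2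
  have h2 := spectrum.subset_circle_of_unitary (𝕜 := ℂ) h1
  have h3 : w ∈ spectrum ℂ (shiftUnit k : EllTwo →L[ℂ] EllTwo) := by
    rw [spectrum.mem_iff, Algebra.algebraMap_eq_smul_one]
    intro h4
    exact h (by simpa using h4.neg)
  simpa using h2 h3

/-- The spectrum of `U + U⁻¹` lies in `[-2, 2]`. -/
theorem exists_of_not_isUnit_shift_add_inv {k : ℤ} {t : ℂ}
    (h : ¬ IsUnit ((shiftUnit k : EllTwo →L[ℂ] EllTwo) +
      ((shiftUnit k)⁻¹ : (EllTwo →L[ℂ] EllTwo)ˣ).val - t • 1)) :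
    ∃ x : ℝ, -2 ≤ x ∧ x ≤ 2 ∧ t = x := by
  obtain ⟨w₁, w₂, hprod, hsum⟩ : ∃ w₁ w₂ : ℂ, w₁ * w₂ = 1 ∧ w₁ + w₂ = t := by
    obtain ⟨w, hw⟩ := IsAlgClosed.exists_pow_nat_eq (t ^ 2 / 4 - 1) (n := 2) (by norm_num)
    exact ⟨t / 2 + w, t / 2 - w, by linear_combination -hw, by ring⟩
  set U : (EllTwo →L[ℂ] EllTwo)ˣ := shiftUnit k with hU
  have hfac : (U : EllTwo →L[ℂ] EllTwo) + (U⁻¹ : (EllTwo →L[ℂ] EllTwo)ˣ).val - t • 1 =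
      (U⁻¹ : (EllTwo →L[ℂ] EllTwo)ˣ).val * (((U : EllTwo →L[ℂ] EllTwo) - w₁ • 1) *
        ((U : EllTwo →L[ℂ] EllTwo) - w₂ • 1)) := by
    have e1 : ((U : EllTwo →L[ℂ] EllTwo) - w₁ • 1) * ((U : EllTwo →L[ℂ] EllTwo) - w₂ • 1) =
        (U : EllTwo →L[ℂ] EllTwo) * U - t • (U : EllTwo →L[ℂ] EllTwo) + 1 := by
      rw [← hsum, add_smul, sub_mul, mul_sub, mul_sub, smul_mul_smul_comm, hprod, one_smul]
      simp only [smul_mul_assoc, mul_smul_comm, mul_one, one_mul]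
      abel
    rw [e1, mul_add, mul_sub, ← mul_assoc, Units.inv_mul, one_mul, mul_smul_comm, Units.inv_mul,
      mul_one]
    abel
  have hcircle : ∀ a b : ℂ, a * b = 1 → ‖a‖ = 1 → a + b = ((2 * a.re : ℝ) : ℂ) ∧ |a.re| ≤ 1 := by
    intro a b hab ha
    have hb : b = (starRingEnd ℂ) a := by
      have ha0 : a ≠ 0 := left_ne_zero_of_mul_eq_one hab
      apply mul_left_cancel₀ ha0
      rw [hab, Complex.mul_conj, Complex.normSq_eq_norm_sq, ha]
      simp
    refine ⟨?_, ha ▸ Complex.abs_re_le_norm a⟩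
    rw [hb, Complex.add_conj]
  have hor : ‖w₁‖ = 1 ∨ ‖w₂‖ = 1 := by
    by_contra! hcon
    refine h ?_
    rw [hfac]
    have h1 : IsUnit ((U : EllTwo →L[ℂ] EllTwo) - w₁ • 1) := by
      by_contra h'
      exact hcon.1 (norm_eq_one_of_not_isUnit_shiftUnit_sub h')
    have h2 : IsUnit ((U : EllTwo →L[ℂ] EllTwo) - w₂ • 1) := by
      by_contra h'
      exact hcon.2 (norm_eq_one_of_not_isUnit_shiftUnit_sub h')
    exact (U⁻¹).isUnit.mul (h1.mul h2)
  rcases hor with h1 | h1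
  · obtain ⟨h2, h3⟩ := hcircle _ _ hprod h1
    have := abs_le.mp h3
    exact ⟨2 * w₁.re, by linarith, by linarith, hsum ▸ h2⟩
  · obtain ⟨h2, h3⟩ := hcircle _ _ ((mul_comm _ _).trans hprod) h1
    have := abs_le.mp h3
    exact ⟨2 * w₂.re, by linarith, by linarith, by rw [← hsum, add_comm, h2]⟩

/-- For `|μ| = 1` the equation `(U - μ) ξ = φ` has no square summable solution `ξ` when `φ` is
supported in one period and does not vanish: `|ξ|` would be constant along both half-lines of
indices congruent modulo the period. -/
theorem eq_zero_of_shift_sub_smul_eq {k : ℤ} (hk : 0 < k) {μ : ℂ} (hμ : ‖μ‖ = 1) {ξ : EllTwo}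
    {i : ℤ} {a : ℂ}
    (h : ∀ j : ℤ, ξ (k * j + i - k) - μ * ξ (k * j + i) = if j = 0 then a else 0) : a = 0 := by
  set x : ℤ → ℝ := fun j => ‖ξ (k * j + i)‖ with hx
  have hinj : Function.Injective fun j : ℤ => k * j + i := fun a b hab =>
    mul_left_cancel₀ hk.ne' (add_right_cancel hab)
  have hs : Summable fun j => x j ^ 2 := ξ.summable_norm_sq.comp_injective hinj
  have hstep : ∀ j : ℤ, j ≠ 0 → x (j - 1) = x j := by
    intro j hj
    have h1 := h j
    rw [if_neg hj, sub_eq_zero] at h1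
    have h2 : k * (j - 1) + i = k * j + i - k := by ring
    simp only [hx, h2, h1, norm_mul, hμ, one_mul]
  have hzero : ∀ f : ℕ → ℤ, Function.Injective f → (∀ n, x (f n) = x (f 0)) → x (f 0) = 0 := by
    intro f hf hconst
    have h1 := (hs.comp_injective hf).tendsto_atTop_zero
    simp only [Function.comp_def, hconst] at h1
    have := tendsto_nhds_unique tendsto_const_nhds h1
    exact pow_eq_zero_iff two_ne_zero |>.mp this
  have h0 : x 0 = 0 := by
    refine hzero (fun n => (n : ℤ)) Nat.cast_injective fun n => ?_
    induction n with
    | zero => rfl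
    | succ n ih =>
      rw [← ih, ← hstep ((n + 1 : ℕ) : ℤ) (by omega)]
      congr 1
      push_cast
      ring
  have h1 : x (-1) = 0 := by
    refine hzero (fun n => -1 - (n : ℤ)) (fun a b hab => by simpa using hab) fun n => ?_
    induction n with
    | zero => rfl
    | succ n ih =>
      rw [← ih, ← hstep (-1 - n) (by omega)]
      congr 1
      push_cast
      ring
  have h2 := h 0
  rw [if_pos rfl] at h2
  simp only [hx, norm_eq_zero] at h0 h1
  rw [h0, show k * 0 + i - k = k * (-1) + i by ring, h1] at h2
  simpa using h2.symm

/-! ### Periodic matrices of the class `𝔸` -/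

/-- The basis vector of `ℓ²(ℤ)` with index `i` in the block `j`. -/
noncomputable def blockVec {g : ℕ} (j : ℤ) (i : Fin (g + 1)) : EllTwo :=
  lp.single 2 (((g : ℤ) + 1) * j + (i : ℕ)) 1

theorem block_index_inj {g : ℕ} {j j' : ℤ} {i i' : Fin (g + 1)}
    (h : ((g : ℤ) + 1) * j + (i : ℕ) = ((g : ℤ) + 1) * j' + (i' : ℕ)) : j = j' ∧ i = i' := by
  have hi := i.isLt
  have hi' := i'.isLt
  have h1 : j = j' := by
    have e : ∀ (j : ℤ) (i : Fin (g + 1)), (((g : ℤ) + 1) * j + (i : ℕ)) / ((g : ℤ) + 1) = j := by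
      intro j i
      have := i.isLt
      rw [Int.add_comm, Int.add_mul_ediv_left _ _ (by omega),
        Int.ediv_eq_zero_of_lt (by omega) (by omega), zero_add]
    rw [← e j i, h, e]
  subst h1
  exact ⟨rfl, Fin.ext (by omega)⟩

theorem exists_block_index (g : ℕ) (m : ℤ) :
    ∃ (j : ℤ) (i : Fin (g + 1)), m = ((g : ℤ) + 1) * j + (i : ℕ) := by
  have h1 := Int.emod_nonneg m (show (g : ℤ) + 1 ≠ 0 by omega)
  have h2 := Int.emod_lt_of_pos m (show 0 < (g : ℤ) + 1 by omega)
  refine ⟨m / ((g : ℤ) + 1), ⟨(m % ((g : ℤ) + 1)).toNat, by omega⟩, ?_⟩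
  simp only
  rw [Int.toNat_of_nonneg h1, Int.mul_ediv_add_emod]

theorem blockVec_apply {g : ℕ} (j j' : ℤ) (i i' : Fin (g + 1)) :
    blockVec j i (((g : ℤ) + 1) * j' + (i' : ℕ)) = if j' = j ∧ i' = i then 1 else 0 := by
  rw [blockVec, lp.single_apply, Pi.single_apply]
  refine if_congr ⟨fun h => block_index_inj h, fun h => ?_⟩ rfl rfl
  rw [h.1, h.2]

theorem EllTwo.ext_block (g : ℕ) {f h : EllTwo}
    (H : ∀ (j : ℤ) (i : Fin (g + 1)),
      f (((g : ℤ) + 1) * j + (i : ℕ)) = h (((g : ℤ) + 1) * j + (i : ℕ))) : f = h := by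
  ext m
  obtain ⟨j, i, rfl⟩ := exists_block_index g m
  exact H j i

theorem shiftUnit_blockVec {g : ℕ} (j : ℤ) (i : Fin (g + 1)) :
    (shiftUnit ((g : ℤ) + 1) : EllTwo →L[ℂ] EllTwo) (blockVec j i) = blockVec (j + 1) i := by
  rw [blockVec, shiftUnit_single, blockVec]
  congr 1
  ring

theorem shiftUnit_inv_blockVec {g : ℕ} (j : ℤ) (i : Fin (g + 1)) :
    ((shiftUnit ((g : ℤ) + 1))⁻¹ : (EllTwo →L[ℂ] EllTwo)ˣ).val (blockVec j i) =
      blockVec (j - 1) i := by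
  rw [blockVec, shiftUnit_inv_single, blockVec]
  congr 1
  ring

theorem blockB_apply {g : ℕ} (c : Fin g → ℝ) (p q : Fin (g + 1) → ℝ) (i l : Fin (g + 1)) :
    blockB c p q i l = (if l ≤ i then p i * q l else 0) + (if i < l then q i * p l else 0) +
      if l = i then Fin.snoc (α := fun _ => ℝ) c 0 i else 0 := by
  simp only [blockB, upperPart, lowerPart, diagC, Matrix.add_apply, Matrix.sub_apply,
    Matrix.of_apply, Matrix.vecMulVec_apply, Matrix.diagonal_apply]
  rcases lt_trichotomy i l with h | h | h
  · simp [h, not_le.mpr h, h.ne, h.ne']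
  · simp [h]
  · simp [h.le, not_lt.mpr h.le, h.ne, h.ne']

theorem blockB_symm {g : ℕ} (c : Fin g → ℝ) (p q : Fin (g + 1) → ℝ) (i l : Fin (g + 1)) :
    blockB c p q i l = blockB c p q l i := by
  rw [blockB_apply, blockB_apply]
  rcases lt_trichotomy i l with h | h | h
  · simp [h, not_le.mpr h, h.ne, h.ne', not_lt.mpr h.le, h.le, mul_comm]
  · simp [h]
  · simp [h, not_le.mpr h, h.ne, h.ne', not_lt.mpr h.le, h.le, mul_comm]

theorem sum_blockB_smul {M : Type*} [AddCommGroup M] [Module ℝ M] {g : ℕ} (c : Fin g → ℝ)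
    (p q : Fin (g + 1) → ℝ) (v : Fin (g + 1) → M) (i : Fin (g + 1)) :
    ∑ l, blockB c p q i l • v l =
      p i • (∑ l, if l ≤ i then q l • v l else 0) + q i • (∑ l, if i < l then p l • v l else 0) +
        Fin.snoc (α := fun _ => ℝ) c 0 i • v i := by
  have h : ∀ l, blockB c p q i l • v l = p i • (if l ≤ i then q l • v l else 0) +
      q i • (if i < l then p l • v l else 0) +
        if l = i then Fin.snoc (α := fun _ => ℝ) c 0 i • v l else 0 := by
    intro l
    rw [blockB_apply]
    simp only [add_smul, ite_smul, zero_smul, smul_ite, smul_zero, mul_smul]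
  rw [Finset.sum_congr rfl fun l _ => h l, Finset.sum_add_distrib, Finset.sum_add_distrib,
    Finset.sum_ite_eq' Finset.univ, if_pos (Finset.mem_univ _), ← Finset.smul_sum,
    ← Finset.smul_sum]

namespace IsPeriodicWith

variable {g : ℕ} {c : Fin g → ℝ} {p q : Fin (g + 1) → ℝ} {A : EllTwo →L[ℂ] EllTwo}

theorem apply_blockVec (h : IsPeriodicWith c p q A) (j l : ℤ) (m n : Fin (g + 1)) :
    A (blockVec l n) (((g : ℤ) + 1) * j + (m : ℕ)) =
      ((jacobiBlock c (fun _ => p) (fun _ => q) j l m n : ℝ) : ℂ) :=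
  h.2 j l m n

theorem commute_shift (h : IsPeriodicWith c p q A) :
    Commute A (shiftUnit ((g : ℤ) + 1) : EllTwo →L[ℂ] EllTwo) := by
  refine EllTwo.clm_ext fun n => ?_
  obtain ⟨l, i, rfl⟩ := exists_block_index g n
  change A ((shiftUnit ((g : ℤ) + 1) : EllTwo →L[ℂ] EllTwo) (blockVec l i)) =
    (shiftUnit ((g : ℤ) + 1) : EllTwo →L[ℂ] EllTwo) (A (blockVec l i))
  rw [shiftUnit_blockVec]
  refine EllTwo.ext_block g fun j m => ?_
  rw [h.apply_blockVec, shiftUnit_apply,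
    show ((g : ℤ) + 1) * j + (m : ℕ) - ((g : ℤ) + 1) = ((g : ℤ) + 1) * (j - 1) + (m : ℕ) by ring,
    h.apply_blockVec]
  congr 1
  simp only [jacobiBlock]
  by_cases h1 : l + 1 = j
  · rw [if_pos h1, if_pos (by omega)]
  · rw [if_neg h1, if_neg (show ¬ l = j - 1 by omega)]
    by_cases h2 : l + 1 = j + 1
    · rw [if_pos h2, if_pos (by omega)]
    · rw [if_neg h2, if_neg (show ¬ l = j - 1 + 1 by omega)]
      by_cases h3 : j = l + 1 + 1
      · rw [if_pos h3, if_pos (by omega)]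
      · rw [if_neg h3, if_neg (by omega)]

/-- The columns of a periodic matrix of the class `𝔸`, through the shift by one block. -/
theorem map_blockVec_zero (h : IsPeriodicWith c p q A) (l : Fin (g + 1)) :
    A (blockVec 0 l) = ∑ i, blockB c p q l i • blockVec 0 i +
      p l • ((shiftUnit ((g : ℤ) + 1))⁻¹ : (EllTwo →L[ℂ] EllTwo)ˣ).val
        (blockVec 0 (Fin.last g)) +
      if l = Fin.last g then
        (shiftUnit ((g : ℤ) + 1) : EllTwo →L[ℂ] EllTwo) (∑ i, p i • blockVec 0 i) else 0 := by
  have hU : (shiftUnit ((g : ℤ) + 1) : EllTwo →L[ℂ] EllTwo) (∑ i, p i • blockVec 0 i) =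
      ∑ i, p i • blockVec 1 i := by
    rw [map_sum]
    refine Finset.sum_congr rfl fun i _ => ?_
    rw [ContinuousLinearMap.map_smul_of_tower, shiftUnit_blockVec, zero_add]
  rw [hU, shiftUnit_inv_blockVec, zero_sub]
  refine EllTwo.ext_block g fun j m => ?_
  have hsum : ∀ (a : Fin (g + 1) → ℝ) (j' : ℤ),
      (∑ i, a i • blockVec j' i : EllTwo) (((g : ℤ) + 1) * j + (m : ℕ)) =
        if j = j' then (a m : ℂ) else 0 := by
    intro a j'
    rw [lp.coeFn_sum, Finset.sum_apply]
    simp only [lp.coeFn_smul, Pi.smul_apply, blockVec_apply]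
    by_cases hj : j = j' <;> simp [hj]
  rw [h.apply_blockVec, lp.coeFn_add, lp.coeFn_add, Pi.add_apply, Pi.add_apply, hsum,
    lp.coeFn_smul, Pi.smul_apply, blockVec_apply]
  have hlast : (if l = Fin.last g then (∑ i, p i • blockVec 1 i : EllTwo) else 0)
      (((g : ℤ) + 1) * j + (m : ℕ)) = if l = Fin.last g then (if j = 1 then (p m : ℂ) else 0) else 0 := by
    by_cases hl : l = Fin.last g
    · rw [if_pos hl, if_pos hl, hsum]
    · rw [if_neg hl, if_neg hl]; rfl
  rw [hlast]
  simp only [jacobiBlock]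
  rcases eq_or_ne j 0 with rfl | h0
  · rw [if_pos rfl, if_pos rfl, blockB_symm]
    simp
  rw [if_neg h0.symm, if_neg h0]
  rcases eq_or_ne j (-1) with rfl | h1
  · rw [if_pos (by norm_num)]
    by_cases hm : m = Fin.last g
    · simp [blockA, Matrix.vecMulVec_apply, hm]
    · simp [blockA, Matrix.vecMulVec_apply, hm]
  rw [if_neg (by omega)]
  rcases eq_or_ne j 1 with rfl | h2
  · rw [if_pos (by norm_num)]
    by_cases hl : l = Fin.last g
    · simp [blockA, Matrix.vecMulVec_apply, hl]
    · simp [blockA, Matrix.vecMulVec_apply, hl]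
  rw [if_neg (by omega)]
  simp [h1, h2]

end IsPeriodicWith

/-! ### The magic formula -/

theorem EllTwo.coe_smul_clm (x : ℝ) (T : EllTwo →L[ℂ] EllTwo) : (x : ℂ) • T = x • T := by
  ext f m
  change (x : ℂ) * T f m = (x • T f : EllTwo) m
  rw [lp.coeFn_smul, Pi.smul_apply, Complex.real_smul]

namespace IsPeriodicWith

variable {g : ℕ} {c : Fin g → ℝ} {p q : Fin (g + 1) → ℝ} {A : EllTwo →L[ℂ] EllTwo}

theorem last_pos (h : IsPeriodicWith c p q A) : 0 < p (Fin.last g) := h.1 0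

/-- In any commutative algebra of operators containing `A` and the block shift `U`, the basis
vectors of one block form a Floquet vector with spectral variable `A` and multiplier `U`. -/
theorem isFloquetVector (h : IsPeriodicWith c p q A) {R : Type*} [CommRing R] [Algebra ℝ R]
    [Module R EllTwo] (hsmul : ∀ (x : ℝ) (f : EllTwo), algebraMap ℝ R x • f = x • f)
    {a w w' : R} (ha : ∀ f : EllTwo, a • f = A f)
    (hw : ∀ f : EllTwo, w • f = (shiftUnit ((g : ℤ) + 1) : EllTwo →L[ℂ] EllTwo) f)
    (hw' : ∀ f : EllTwo, w' • f = ((shiftUnit ((g : ℤ) + 1))⁻¹ : (EllTwo →L[ℂ] EllTwo)ˣ).val f) :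
    IsFloquetVector (fun k => algebraMap ℝ R (c k)) (fun i => algebraMap ℝ R (p i))
      (fun i => algebraMap ℝ R (q i)) a w w' (fun i => blockVec 0 i) := by
  constructor
  · intro i
    simp only [sub_smul, mul_smul, hsmul, ha, hw']
    rw [h.map_blockVec_zero, sum_blockB_smul, if_neg (Fin.castSucc_ne_last i), Fin.snoc_castSucc]
    abel
  · simp only [mul_smul, hsmul, ha, hw', hw]
    rw [h.map_blockVec_zero, sum_blockB_smul, if_pos rfl, Fin.snoc_last, zero_smul]
    simp only [Fin.le_last, if_true, not_lt.mpr (Fin.le_last _), if_false, Finset.sum_const_zero,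
      smul_zero]
    abel

open scoped IsMulCommutative in
/-- The discriminant, as a function of a periodic matrix `A` of the class `𝔸`, is the sum of the
block shift and its inverse. The Floquet vector formed by basis vectors of `ℓ²(ℤ)` is annihilated by
the difference of the two sides, which commutes with the shift. -/
theorem magic_formula (h : IsPeriodicWith c p q A) (hc : Function.Injective c)
    {u : Fin g → (EllTwo →L[ℂ] EllTwo)ˣ}
    (hu : ∀ k, (u k : EllTwo →L[ℂ] EllTwo) = (c k : ℂ) • (1 : EllTwo →L[ℂ] EllTwo) - A) :
    (shiftUnit ((g : ℤ) + 1) : EllTwo →L[ℂ] EllTwo) +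
        ((shiftUnit ((g : ℤ) + 1))⁻¹ : (EllTwo →L[ℂ] EllTwo)ˣ).val =
      ((1 / p (Fin.last g) : ℝ) : ℂ) • A +
        ((discrConst p q : ℝ) : ℂ) • (1 : EllTwo →L[ℂ] EllTwo) +
        ∑ k, ((Lam c p q k : ℝ) : ℂ) • ((u k)⁻¹ : (EllTwo →L[ℂ] EllTwo)ˣ).val := by
  set U := shiftUnit ((g : ℤ) + 1) with hU
  have hAU : Commute A (U : EllTwo →L[ℂ] EllTwo) := h.commute_shift
  set S : Set (EllTwo →L[ℂ] EllTwo) := {A, (U : EllTwo →L[ℂ] EllTwo)} with hS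
  set 𝒜 := Subalgebra.centralizer ℝ (Set.centralizer S) with h𝒜
  have hSS : S ⊆ Set.centralizer S := by
    rintro x (rfl | rfl) y (rfl | rfl)
    · rfl
    · exact hAU.symm
    · exact hAU
    · rfl
  -- the bicommutant of a commuting family is commutative, and it is closed under inverses
  have : IsMulCommutative 𝒜 := ⟨⟨fun x y => Subtype.ext (by
    have hy : y.1 ∈ Set.centralizer S := fun s hs => y.2 s (hSS hs)
    exact (x.2 y.1 hy).symm)⟩⟩
  have hmemA : A ∈ 𝒜 := fun T hT => (hT A (by simp [hS])).symm
  have hmemU : (U : EllTwo →L[ℂ] EllTwo) ∈ 𝒜 := fun T hT => (hT _ (by simp [hS])).symm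
  have hmemU' : (U⁻¹ : (EllTwo →L[ℂ] EllTwo)ˣ).val ∈ 𝒜 := fun T hT => by
    have h1 : Commute T (U : EllTwo →L[ℂ] EllTwo) := (hT _ (by simp [hS])).symm
    exact h1.units_inv_right
  have hmemu : ∀ k, ((u k)⁻¹ : (EllTwo →L[ℂ] EllTwo)ˣ).val ∈ 𝒜 := fun k T hT => by
    have h1 : Commute T A := (hT _ (by simp [hS])).symm
    have h2 : Commute T (u k : EllTwo →L[ℂ] EllTwo) := by
      rw [hu k]
      exact ((Commute.one_right T).smul_right _).sub_right h1
    exact h2.units_inv_right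
  have hsmul : ∀ (x : ℝ) (f : EllTwo), algebraMap ℝ 𝒜 x • f = x • f := by
    intro x f
    change ((algebraMap ℝ 𝒜 x : 𝒜) : EllTwo →L[ℂ] EllTwo) f = x • f
    rw [Subalgebra.coe_algebraMap, Algebra.algebraMap_eq_smul_one]
    rfl
  have hF := h.isFloquetVector hsmul (a := (⟨A, hmemA⟩ : 𝒜)) (w := ⟨_, hmemU⟩)
    (w' := ⟨_, hmemU'⟩) (fun f => rfl) (fun f => rfl) (fun f => rfl)
  have hp := h.last_pos.ne'
  have hy : ∀ k, (algebraMap ℝ 𝒜 (c k) - ⟨A, hmemA⟩) * ⟨_, hmemu k⟩ = 1 := by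
    intro k
    refine Subtype.ext ?_
    change ((algebraMap ℝ 𝒜 (c k) : 𝒜) - A : EllTwo →L[ℂ] EllTwo) *
      ((u k)⁻¹ : (EllTwo →L[ℂ] EllTwo)ˣ).val = 1
    rw [Subalgebra.coe_algebraMap, Algebra.algebraMap_eq_smul_one, ← EllTwo.coe_smul_clm, ← hu k,
      Units.mul_inv]
  have hww : (⟨_, hmemU⟩ : 𝒜) * ⟨_, hmemU'⟩ = 1 := Subtype.ext U.mul_inv
  have ht : algebraMap ℝ 𝒜 (p (Fin.last g)) * algebraMap ℝ 𝒜 (1 / p (Fin.last g)) = 1 := by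
    rw [← map_mul, mul_one_div_cancel hp, map_one]
  have hzero := fun i => hF.smul_eq_zero hww ht hy i
  rw [trace_monodromy_eq hc q hp _ hy] at hzero
  set τ : 𝒜 := ⟨_, hmemU⟩ + ⟨_, hmemU'⟩ - (algebraMap ℝ 𝒜 (1 / p (Fin.last g)) * ⟨A, hmemA⟩ +
    algebraMap ℝ 𝒜 (discrConst p q) + ∑ k, algebraMap ℝ 𝒜 (Lam c p q k) * ⟨_, hmemu k⟩) with hτ
  have hτcoe : (τ : EllTwo →L[ℂ] EllTwo) = U + (U⁻¹ : (EllTwo →L[ℂ] EllTwo)ˣ).val -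
      (((1 / p (Fin.last g) : ℝ) : ℂ) • A +
        ((discrConst p q : ℝ) : ℂ) • (1 : EllTwo →L[ℂ] EllTwo) +
        ∑ k, ((Lam c p q k : ℝ) : ℂ) • ((u k)⁻¹ : (EllTwo →L[ℂ] EllTwo)ˣ).val) := by
    rw [hτ]
    generalize 1 / p (Fin.last g) = t
    push_cast
    simp only [Algebra.algebraMap_eq_smul_one, smul_mul_assoc, one_mul, EllTwo.coe_smul_clm]
  have hτcomm : Commute (τ : EllTwo →L[ℂ] EllTwo) (U : EllTwo →L[ℂ] EllTwo) := by
    have hUc : (U : EllTwo →L[ℂ] EllTwo) ∈ Set.centralizer S := hSS (by simp [hS])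
    exact (τ.2 _ hUc).symm
  have hτ0 : ∀ (j : ℤ) (i : Fin (g + 1)), (τ : EllTwo →L[ℂ] EllTwo) (blockVec j i) = 0 := by
    intro j i
    have hstep : ∀ j : ℤ, (τ : EllTwo →L[ℂ] EllTwo) (blockVec (j + 1) i) =
        (U : EllTwo →L[ℂ] EllTwo) ((τ : EllTwo →L[ℂ] EllTwo) (blockVec j i)) := by
      intro j
      rw [← shiftUnit_blockVec, ← mul_apply_eq_comp, hτcomm.eq, mul_apply_eq_comp]
    have hinj : ∀ f : EllTwo, (U : EllTwo →L[ℂ] EllTwo) f = 0 → f = 0 := fun f hf =>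
      (shiftIso ((g : ℤ) + 1)).injective (hf.trans (map_zero _).symm)
    induction j using Int.induction_on with
    | zero => exact hzero i
    | succ j ih => rw [hstep, ih, map_zero]
    | pred j ih =>
      refine hinj _ ?_
      rw [← hstep, sub_add_cancel, ih]
  have hτz : (τ : EllTwo →L[ℂ] EllTwo) = 0 := by
    refine EllTwo.clm_ext fun n => ?_
    obtain ⟨j, i, rfl⟩ := exists_block_index g n
    exact hτ0 j i
  rw [hτcoe, sub_eq_zero] at hτz
  exact hτz

end IsPeriodicWith

/-! ### Bloch vectors -/

open scoped Matrix.Module in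
theorem exists_chain {R M : Type*} [CommRing R] [AddCommGroup M] [Module R M] {g : ℕ}
    (a : Fin g → Matrix (Fin 2) (Fin 2) R) (Y : Fin 2 → M) :
    ∃ X : Fin (g + 1) → Fin 2 → M, X (Fin.last g) = Y ∧
      ∀ i : Fin g, X i.castSucc = a i • X i.succ := by
  induction g with
  | zero => exact ⟨fun _ => Y, rfl, fun i => i.elim0⟩
  | succ g ih =>
    obtain ⟨X, hX, hXs⟩ := ih fun i => a i.succ
    refine ⟨Fin.cons (a 0 • X 0) X, ?_, fun i => ?_⟩
    · rw [← Fin.succ_last, Fin.cons_succ, hX]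
    · induction i using Fin.cases with
      | zero => rw [Fin.castSucc_zero, Fin.cons_zero, Fin.cons_succ]
      | succ i => rw [Fin.castSucc_succ, Fin.cons_succ, Fin.cons_succ, hXs i]

open scoped Matrix.Module in
/-- If the multiplier `w` is compatible with the trace of the monodromy matrix at `z`, then the
symbol has an eigenvector for the eigenvalue `z`. -/
theorem exists_isFloquetVector {K : Type*} [Field K] {g : ℕ} {c : Fin g → K}
    {p : Fin (g + 1) → K} (q : Fin (g + 1) → K) {z w : K} (hw : w ≠ 0) (hp : p (Fin.last g) ≠ 0)
    (hz : ∀ k, z ≠ c k)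
    (htr : (monodromy z (1 / p (Fin.last g)) (fun k => 1 / (c k - z)) p q).trace = w + w⁻¹) :
    ∃ v : Fin (g + 1) → K, v ≠ 0 ∧ IsFloquetVector c p q z w w⁻¹ v := by
  set t := 1 / p (Fin.last g) with ht
  have hpt : p (Fin.last g) * t = 1 := mul_one_div_cancel hp
  set y : Fin g → K := fun k => 1 / (c k - z) with hy
  have hyc : ∀ k, (c k - z) * y k = 1 := fun k =>
    mul_one_div_cancel (sub_ne_zero.mpr (hz k).symm)
  -- `T` has determinant one and trace `w + w⁻¹`, hence the eigenvalue `w⁻¹`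
  set T := monodromy z t y p q with hT
  have hww : w * w⁻¹ = 1 := mul_inv_cancel₀ hw
  have hdet : (w • T - 1).det = 0 := by
    have h1 := det_monodromy z y q hpt
    rw [← hT, Matrix.det_fin_two] at h1
    rw [Matrix.trace_fin_two] at htr
    rw [Matrix.det_fin_two]
    simp
    linear_combination w ^ 2 * h1 - w * htr - hww
  obtain ⟨X₀, hX₀, hX₀T⟩ := Matrix.exists_mulVec_eq_zero_iff.mpr hdet
  have hTX : w • (T • X₀) = X₀ := by
    rw [Matrix.sub_mulVec, Matrix.one_mulVec, sub_eq_zero, Matrix.smul_mulVec] at hX₀T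
    exact hX₀T
  obtain ⟨X, hXlast, hXs⟩ := exists_chain (R := K)
    (fun k => 1 - y k • nilJ (p k.castSucc) (q k.castSucc))
    (w • (transferInftyRing z (p (Fin.last g)) t (q (Fin.last g)) • X₀))
  have hX0 : X 0 = X₀ := by
    rw [chain_eq_prod_smul X _ hXs, hXlast, smul_comm, ← mul_smul]
    exact hTX
  rw [← hX0] at hXlast
  have hs0 : ∀ i : Fin g, X i.castSucc 0 = X i.succ 0 - y i * p i.castSucc *
      (q i.castSucc * X i.succ 0 - p i.castSucc * X i.succ 1) := by
    intro i
    rw [hXs i]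
    simp only [Matrix.Module.smul_apply, Fin.sum_univ_two, nilJ]
    simp
    ring
  have hs1 : ∀ i : Fin g, X i.castSucc 1 = X i.succ 1 - y i * q i.castSucc *
      (q i.castSucc * X i.succ 0 - p i.castSucc * X i.succ 1) := by
    intro i
    rw [hXs i]
    simp only [Matrix.Module.smul_apply, Fin.sum_univ_two, nilJ]
    simp
    ring
  have hl0 : X (Fin.last g) 0 = w * (-(p (Fin.last g)) * X 0 1) := by
    rw [hXlast]
    simp only [Pi.smul_apply, Matrix.Module.smul_apply, Fin.sum_univ_two, transferInftyRing]
    simp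
  have hl1 : X (Fin.last g) 1 = w * (t * X 0 0 + (t * z - q (Fin.last g)) * X 0 1) := by
    rw [hXlast]
    simp only [Pi.smul_apply, Matrix.Module.smul_apply, Fin.sum_univ_two, transferInftyRing]
    simp
  -- the vector whose tail sums are the first entries of the chain
  set v : Fin (g + 1) → K := Fin.snoc (α := fun _ => K)
    (fun i => -(y i * (q i.castSucc * X i.succ 0 - p i.castSucc * X i.succ 1)))
    (t * X (Fin.last g) 0) with hv
  have hvc : ∀ i : Fin g, v i.castSucc =
      -(y i * (q i.castSucc * X i.succ 0 - p i.castSucc * X i.succ 1)) :=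
    fun i => Fin.snoc_castSucc ..
  have hvl : v (Fin.last g) = t * X (Fin.last g) 0 := Fin.snoc_last ..
  have htail : ∀ i, tailSum p v i = X i 0 := by
    intro i
    induction i using Fin.reverseInduction with
    | last =>
      rw [tailSum_last, smul_eq_mul, hvl]
      linear_combination X (Fin.last g) 0 * hpt
    | cast i ih =>
      rw [tailSum_castSucc, ih, hs0, smul_eq_mul, hvc]
      ring
  have hvl0 : w⁻¹ * v (Fin.last g) = -X 0 1 := by
    rw [hvl, hl0]
    linear_combination -X 0 1 * hww * (p (Fin.last g) * t) - X 0 1 * hpt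
  have hhead : ∀ i, headSum q v i + w⁻¹ * v (Fin.last g) = -X i 1 := by
    intro i
    induction i using Fin.induction with
    | zero => rw [headSum_zero, zero_add, hvl0]
    | succ i ih =>
      rw [headSum_succ, smul_eq_mul, hvc]
      linear_combination ih - hs1 i
  refine ⟨v, ?_, ⟨fun i => ?_, ?_⟩⟩
  · intro hv0
    refine hX₀ ?_
    rw [← hX0]
    ext j
    fin_cases j
    · change X 0 0 = 0
      rw [← htail, tailSum_zero, hv0]
      simp
    · change X 0 1 = 0
      rw [← neg_eq_zero, ← hvl0, hv0]
      simp
  · have e1 : (∑ j, if j ≤ i.castSucc then q j • v j else 0) = headSum q v i.succ := by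
      simp only [headSum, Fin.le_castSucc_iff]
    have e2 : (∑ j, if i.castSucc < j then p j • v j else 0) = tailSum p v i.succ := by
      simp only [tailSum, Fin.castSucc_lt_iff_succ_le]
    rw [e1, e2, htail, hvc]
    simp only [smul_eq_mul]
    linear_combination (q i.castSucc * X i.succ 0 - p i.castSucc * X i.succ 1) * hyc i -
      p i.castSucc * hhead i.succ
  · rw [headSum_last q v, ← tailSum_zero, htail]
    simp only [smul_eq_mul]
    have h1 := hhead (Fin.last g)
    linear_combination -p (Fin.last g) * h1 + p (Fin.last g) * hl1 + w * X 0 0 * hpt +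
      w * z * X 0 1 * hpt + w * (z - p (Fin.last g) * q (Fin.last g)) * hvl0 -
      (z - p (Fin.last g) * q (Fin.last g)) * v (Fin.last g) * hww

/-! ### The spectrum of a periodic matrix -/

theorem jacobiBlock_succ {g : ℕ} (c : Fin g → ℝ) (P Q : ℤ → Fin (g + 1) → ℝ) (j : ℤ)
    (m n : Fin (g + 1)) :
    jacobiBlock c P Q j (j + 1) m n = if m = Fin.last g then P (j + 1) n else 0 := by
  rw [jacobiBlock, if_neg (by omega), if_pos rfl, blockA, Matrix.vecMulVec_apply, Pi.single_apply]
  simp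

/-- On the first block superdiagonal, the diagonal entries of the inverses of `c k - A` are the
positive coefficients of the transformed matrices, each in its own row. -/
theorem entry_inv_eq {g : ℕ} {c' : Fin g → ℝ} {R : EllTwo →L[ℂ] EllTwo} {j : Fin g}
    (h : IsClassA c' (shiftConj ((j : ℕ) + 1) (entry R))) :
    ∃ x : ℝ, 0 < x ∧ ∀ k : Fin g,
      entry R (k : ℕ) ((k : ℕ) + ((g : ℤ) + 1)) = if j = k then (x : ℂ) else 0 := by
  obtain ⟨P, Q, hpos, hPQ⟩ := h
  refine ⟨P 0 (Fin.last g), hpos 0, fun k => ?_⟩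
  have hj := j.isLt
  have hk := k.isLt
  rcases lt_trichotomy (j : ℕ) k with hlt | heq | hgt
  · rw [if_neg (by rintro rfl; omega)]
    have h1 := hPQ 0 (0 + 1) ⟨k - j - 1, by omega⟩ ⟨k - j - 1, by omega⟩
    rw [jacobiBlock_succ, if_neg (by rw [Fin.ext_iff, Fin.val_last]; simp only; omega)] at h1
    simp only [shiftConj, Complex.ofReal_zero] at h1
    rw [← h1]
    congr 1 <;> push_cast [Nat.sub_sub, Nat.cast_sub (show (j : ℕ) + 1 ≤ k by omega)] <;> ring
  · rw [if_pos (Fin.ext heq)]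
    have h1 := hPQ (-1) (-1 + 1) (Fin.last g) (Fin.last g)
    rw [jacobiBlock_succ, if_pos rfl] at h1
    simp only [shiftConj, Fin.val_last] at h1
    rw [show P 0 (Fin.last g) = P (-1 + 1) (Fin.last g) by norm_num, ← h1]
    congr 1 <;> push_cast <;> rw [heq] <;> ring
  · rw [if_neg (by rintro rfl; omega)]
    have h1 := hPQ (-1) (-1 + 1) ⟨g + k - j, by omega⟩ ⟨g + k - j, by omega⟩
    rw [jacobiBlock_succ, if_neg (by rw [Fin.ext_iff, Fin.val_last]; simp only; omega)] at h1
    simp only [shiftConj, Complex.ofReal_zero] at h1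
    rw [← h1]
    congr 1 <;> push_cast [Nat.cast_sub (show (j : ℕ) ≤ g + k by omega)] <;> ring

theorem EllTwo.coe_smul (x : ℝ) (f : EllTwo) : (x : ℂ) • f = x • f := by
  ext m
  rw [lp.coeFn_smul, lp.coeFn_smul, Pi.smul_apply, Pi.smul_apply, Complex.real_smul, smul_eq_mul]

namespace IsPeriodicWith

variable {g : ℕ} {c : Fin g → ℝ} {p q : Fin (g + 1) → ℝ} {A : EllTwo →L[ℂ] EllTwo}

/-- The discriminant of a periodic matrix, the trace of the monodromy matrix, in the form of its
partial fractions. -/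
noncomputable def discr (c : Fin g → ℝ) (p q : Fin (g + 1) → ℝ) : ℂ → ℂ :=
  simplePoleFun c (1 / p (Fin.last g)) (discrConst p q) (Lam c p q)

/-- For a GMP matrix the numbers `Λ_k` are positive: compare the entries of both sides of the
magic formula on the first block superdiagonal. -/
theorem Lam_pos (h : IsPeriodicWith c p q A) (hc : Function.Injective c) (hA : IsGMP c A)
    (k : Fin g) : 0 < Lam c p q k := by
  choose u hu hcl using hA.2
  have hm := h.magic_formula hc hu
  have h1 := congrArg (fun T : EllTwo →L[ℂ] EllTwo =>
    T (blockVec 1 k.castSucc) (((g : ℤ) + 1) * 0 + (k.castSucc : Fin (g + 1)).val)) hm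
  have hsum : ∀ T : Fin g → (EllTwo →L[ℂ] EllTwo),
      (∑ j, ((Lam c p q j : ℝ) : ℂ) • T j) (blockVec 1 k.castSucc)
        (((g : ℤ) + 1) * 0 + (k.castSucc : Fin (g + 1)).val) =
      ∑ j, ((Lam c p q j : ℝ) : ℂ) * entry (T j) (k : ℕ) ((k : ℕ) + ((g : ℤ) + 1)) := by
    intro T
    rw [sum_apply, lp.coeFn_sum, Finset.sum_apply]
    refine Finset.sum_congr rfl fun j _ => ?_
    have e1 : ((k : ℕ) : ℤ) + ((g : ℤ) + 1) =
        ((g : ℤ) + 1) * 1 + ((k.castSucc : Fin (g + 1)).val : ℤ) := by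
      rw [Fin.val_castSucc]; ring
    rw [entry, e1, smul_apply, lp.coeFn_smul, Pi.smul_apply, smul_eq_mul]
    congr 2
    simp [blockVec]
  simp only [add_apply, lp.coeFn_add, Pi.add_apply] at h1
  rw [hsum] at h1
  choose x hx hxe using fun j => entry_inv_eq (hcl j)
  simp only [hxe] at h1
  rw [shiftUnit_blockVec, shiftUnit_inv_blockVec, blockVec_apply, blockVec_apply] at h1
  simp only [smul_apply, lp.coeFn_smul, Pi.smul_apply, h.apply_blockVec,
    one_apply_eq_self, blockVec_apply] at h1
  rw [show (1 : ℤ) = 0 + 1 by norm_num, jacobiBlock_succ, if_neg (Fin.castSucc_ne_last k)] at h1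
  simp at h1
  have h2 : Lam c p q k * x k = 1 := by exact_mod_cast h1.symm
  exact pos_of_mul_pos_left (h2 ▸ one_pos) (hx k).le

theorem ne_of_mem_spectrum (hA : IsGMP c A) {z : ℂ} (hz : z ∈ spectrum ℂ A) (k : Fin g) :
    z ≠ c k := by
  rintro rfl
  obtain ⟨u, hu, -⟩ := hA.2 k
  rw [spectrum.mem_iff, Algebra.algebraMap_eq_smul_one] at hz
  exact hz (hu ▸ u.isUnit)

/-- On the spectrum the discriminant takes values in `[-2, 2]`. -/
theorem discr_of_mem_spectrum (h : IsPeriodicWith c p q A) (hc : Function.Injective c)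
    (hA : IsGMP c A) {z : ℂ} (hz : z ∈ spectrum ℂ A) :
    ∃ x : ℝ, -2 ≤ x ∧ x ≤ 2 ∧ discr c p q z = x := by
  have hzc := ne_of_mem_spectrum hA hz
  choose u hu hcl using hA.2
  have hm := h.magic_formula hc hu
  refine exists_of_not_isUnit_shift_add_inv (k := (g : ℤ) + 1) fun hunit => hz ?_
  -- `Δ(A) - Δ(z)` is divisible by `A - z`
  set Q : EllTwo →L[ℂ] EllTwo := ((1 / p (Fin.last g) : ℝ) : ℂ) • 1 +
    ∑ k, (((Lam c p q k : ℝ) : ℂ) / ((c k : ℂ) - z)) • ((u k)⁻¹ : (EllTwo →L[ℂ] EllTwo)ˣ).val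
    with hQ
  have hfac : ∀ k, ((u k)⁻¹ : (EllTwo →L[ℂ] EllTwo)ˣ).val * (A - z • 1) =
      ((c k : ℂ) - z) • ((u k)⁻¹ : (EllTwo →L[ℂ] EllTwo)ˣ).val - 1 := by
    intro k
    have e1 : A - z • (1 : EllTwo →L[ℂ] EllTwo) = ((c k : ℂ) - z) • 1 - (u k : EllTwo →L[ℂ] EllTwo) := by
      rw [hu k, sub_smul]; abel
    rw [e1, mul_sub, Units.inv_mul, mul_smul_comm, mul_one]
  have hQA : (shiftUnit ((g : ℤ) + 1) : EllTwo →L[ℂ] EllTwo) +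
      ((shiftUnit ((g : ℤ) + 1))⁻¹ : (EllTwo →L[ℂ] EllTwo)ˣ).val - discr c p q z • 1 =
      Q * (A - z • 1) := by
    rw [hm, hQ, add_mul, Finset.sum_mul, discr, simplePoleFun]
    have e2 : ∀ k, ((((Lam c p q k : ℝ) : ℂ) / ((c k : ℂ) - z)) •
        ((u k)⁻¹ : (EllTwo →L[ℂ] EllTwo)ˣ).val) * (A - z • 1) =
        ((Lam c p q k : ℝ) : ℂ) • ((u k)⁻¹ : (EllTwo →L[ℂ] EllTwo)ˣ).val -
          (((Lam c p q k : ℝ) : ℂ) / ((c k : ℂ) - z)) • 1 := by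
      intro k
      have := sub_ne_zero.mpr (hzc k).symm
      rw [smul_mul_assoc, hfac, smul_sub, smul_smul, div_mul_cancel₀ _ this]
    rw [Finset.sum_congr rfl fun k _ => e2 k, Finset.sum_sub_distrib, ← Finset.sum_smul,
      smul_mul_assoc, one_mul, smul_sub, smul_smul, add_smul, add_smul]
    abel
  have hcomm : Commute Q (A - z • 1) := by
    have hAu : ∀ k, Commute ((u k)⁻¹ : (EllTwo →L[ℂ] EllTwo)ˣ).val (A - z • 1) := by
      intro k
      refine Commute.units_inv_left ?_
      rw [hu k]
      refine Commute.sub_left ((Commute.one_left _).smul_left _) ?_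
      exact (Commute.refl A).sub_right ((Commute.one_right A).smul_right z)
    refine Commute.add_left ((Commute.one_left _).smul_left _) ?_
    exact Commute.sum_left _ _ _ fun k _ => (hAu k).smul_left _
  rw [hQA, hcomm.isUnit_mul_iff] at hunit
  rw [spectrum.mem_resolventSet_iff, Algebra.algebraMap_eq_smul_one, ← neg_sub, IsUnit.neg_iff]
  exact hunit.2

theorem trace_monodromy_eq_discr (hc : Function.Injective c) (q : Fin (g + 1) → ℝ)
    (hp : p (Fin.last g) ≠ 0) {z : ℂ} (hz : ∀ k, z ≠ c k) :
    (monodromy z (1 / (p (Fin.last g) : ℂ)) (fun k => 1 / ((c k : ℂ) - z)) (fun i => (p i : ℂ))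
      (fun i => (q i : ℂ))).trace = discr c p q z := by
  have := trace_monodromy_eq hc q hp z (y := fun k => 1 / ((c k : ℂ) - z)) fun k =>
    mul_one_div_cancel (sub_ne_zero.mpr (hz k).symm)
  simp only [Complex.coe_algebraMap, Complex.ofReal_div, Complex.ofReal_one] at this
  rw [this, discr, simplePoleFun, Complex.ofReal_div, Complex.ofReal_one]
  simp only [mul_one_div]

/-- Points where the discriminant takes a value in `[-2, 2]` belong to the spectrum: a Bloch vector
gives a vector `φ` supported in one period with `(A - z) φ` in the range of `U - w⁻¹`. -/
theorem mem_spectrum_of_discr (h : IsPeriodicWith c p q A) (hc : Function.Injective c)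
    {z w : ℂ} (hz : ∀ k, z ≠ c k) (hw : ‖w‖ = 1) (hd : discr c p q z = w + w⁻¹) :
    z ∈ spectrum ℂ A := by
  have hw0 : w ≠ 0 := by rintro rfl; simp at hw
  have hp := h.last_pos.ne'
  have hpC : (p (Fin.last g) : ℂ) ≠ 0 := by exact_mod_cast hp
  obtain ⟨v, hv, hF⟩ := exists_isFloquetVector (c := fun k => (c k : ℂ)) (p := fun i => (p i : ℂ))
    (fun i => (q i : ℂ)) hw0 hpC hz ((trace_monodromy_eq_discr hc q hp hz).trans hd)
  rw [spectrum.mem_iff, Algebra.algebraMap_eq_smul_one]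
  rintro ⟨G, hG⟩
  set U := shiftUnit ((g : ℤ) + 1) with hU
  have hUG : Commute (U : EllTwo →L[ℂ] EllTwo) ((G⁻¹ : (EllTwo →L[ℂ] EllTwo)ˣ).val) := by
    refine Commute.units_inv_right ?_
    rw [hG]
    exact ((Commute.one_right _).smul_right z).sub_right h.commute_shift.symm
  set φ : EllTwo := ∑ l, v l • blockVec 0 l with hφ
  set ψ : EllTwo := v (Fin.last g) • (∑ i, p i • blockVec 0 i) -
    (w * ∑ l, (p l : ℂ) * v l) • (U⁻¹ : (EllTwo →L[ℂ] EllTwo)ˣ).val (blockVec 0 (Fin.last g))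
    with hψ
  have hrow : ∀ i, z * v i = ∑ l, (blockB c p q i l : ℂ) * v l +
      (p i : ℂ) * w⁻¹ * v (Fin.last g) +
      if i = Fin.last g then w * ∑ l, (p l : ℂ) * v l else 0 := by
    intro i
    have e1 := sum_blockB_smul c p q v i
    simp only [Complex.real_smul] at e1
    rw [e1]
    induction i using Fin.lastCases with
    | last =>
      have := hF.lastRow
      simp only [smul_eq_mul] at this
      rw [if_pos rfl, Fin.snoc_last, this]
      simp only [Fin.le_last, if_true, not_lt.mpr (Fin.le_last _), if_false,
        Finset.sum_const_zero, Complex.ofReal_zero]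
      ring
    | cast i =>
      have := hF.row i
      simp only [smul_eq_mul] at this
      rw [if_neg (Fin.castSucc_ne_last i), Fin.snoc_castSucc]
      linear_combination this
  have hUU : ∀ f : EllTwo,
      (U : EllTwo →L[ℂ] EllTwo) ((U⁻¹ : (EllTwo →L[ℂ] EllTwo)ˣ).val f) = f := by
    intro f
    rw [← mul_apply_eq_comp, Units.mul_inv, one_apply_eq_self]
  have hkey : A φ - z • φ = (U : EllTwo →L[ℂ] EllTwo) ψ - w⁻¹ • ψ := by
    set b := blockVec (g := g) 0 with hb
    set e₁ := (U⁻¹ : (EllTwo →L[ℂ] EllTwo)ˣ).val (b (Fin.last g)) with he₁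
    set e₂ : EllTwo := ∑ i, p i • b i with he₂
    set s := ∑ l, (p l : ℂ) * v l with hs
    have hAφ : A φ = ∑ i, (∑ l, (blockB c p q i l : ℂ) * v l) • b i + s • e₁ +
        v (Fin.last g) • (U : EllTwo →L[ℂ] EllTwo) e₂ := by
      rw [hφ, map_sum]
      have e1 : ∀ l, A (v l • b l) = ∑ i, ((blockB c p q i l : ℂ) * v l) • b i +
          ((p l : ℂ) * v l) • e₁ +
            if l = Fin.last g then v l • (U : EllTwo →L[ℂ] EllTwo) e₂ else 0 := by
        intro l
        rw [map_smul, hb, h.map_blockVec_zero, smul_add, smul_add, Finset.smul_sum, smul_ite,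
          smul_zero]
        congr 2
        · refine Finset.sum_congr rfl fun i _ => ?_
          rw [blockB_symm, ← EllTwo.coe_smul, smul_smul, mul_comm]
        · rw [← EllTwo.coe_smul, smul_smul, mul_comm]
      rw [Finset.sum_congr rfl fun l _ => e1 l, Finset.sum_add_distrib, Finset.sum_add_distrib,
        Finset.sum_ite_eq' Finset.univ, if_pos (Finset.mem_univ _), Finset.sum_comm,
        ← Finset.sum_smul]
      simp only [← Finset.sum_smul]
      rfl
    have hzφ : z • φ = ∑ i, (∑ l, (blockB c p q i l : ℂ) * v l) • b i +
        (w⁻¹ * v (Fin.last g)) • e₂ + (w * s) • b (Fin.last g) := by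
      rw [hφ, Finset.smul_sum]
      have e1 : ∀ i, z • v i • b i = (∑ l, (blockB c p q i l : ℂ) * v l) • b i +
          (w⁻¹ * v (Fin.last g)) • p i • b i +
            if i = Fin.last g then (w * s) • b i else 0 := by
        intro i
        rw [smul_smul, hrow i, add_smul, add_smul, ite_smul, zero_smul, ← EllTwo.coe_smul (p i),
          smul_smul]
        congr 3
        ring
      rw [Finset.sum_congr rfl fun l _ => e1 l, Finset.sum_add_distrib, Finset.sum_add_distrib,
        Finset.sum_ite_eq' Finset.univ, if_pos (Finset.mem_univ _), ← Finset.smul_sum]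
    rw [hAφ, hzφ, hψ, map_sub, map_smul, map_smul, he₁, hUU, smul_sub, smul_smul, smul_smul,
      ← mul_assoc w⁻¹ w, inv_mul_cancel₀ hw0, one_mul]
    abel
  -- if `z - A` were invertible, `φ` itself would be in the range of `U - w⁻¹`
  set ξ := -((G⁻¹ : (EllTwo →L[ℂ] EllTwo)ˣ).val ψ) with hξ
  have hφξ : φ = (U : EllTwo →L[ℂ] EllTwo) ξ - w⁻¹ • ξ := by
    have e1 : (G : EllTwo →L[ℂ] EllTwo) φ = -(A φ - z • φ) := by
      rw [hG, sub_apply, smul_apply, one_apply_eq_self,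
        neg_sub]
    have e2 : φ = (G⁻¹ : (EllTwo →L[ℂ] EllTwo)ˣ).val ((G : EllTwo →L[ℂ] EllTwo) φ) := by
      rw [← mul_apply_eq_comp, Units.inv_mul, one_apply_eq_self]
    rw [e2, e1, hkey, map_neg, map_sub, map_smul, hξ, map_neg, ← mul_apply_eq_comp,
      ← hUG.eq, mul_apply_eq_comp, smul_neg]
    abel
  obtain ⟨i, hi⟩ := Function.ne_iff.mp hv
  refine hi (eq_zero_of_shift_sub_smul_eq (k := (g : ℤ) + 1) (i := (i : ℕ)) (ξ := ξ) (μ := w⁻¹)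
    (by omega) (by rw [norm_inv, hw, inv_one]) fun j => ?_)
  have e1 := congrArg (fun f : EllTwo => f (((g : ℤ) + 1) * j + (i : ℕ))) hφξ
  simp only [lp.coeFn_sub, Pi.sub_apply, lp.coeFn_smul, Pi.smul_apply, hU, shiftUnit_apply,
    smul_eq_mul] at e1
  rw [← e1, hφ, lp.coeFn_sum, Finset.sum_apply]
  simp only [lp.coeFn_smul, Pi.smul_apply, blockVec_apply, smul_eq_mul]
  by_cases hj : j = 0 <;> simp [hj]

end IsPeriodicWith

/-! ### Discriminants on the real line -/

/-- The restriction of `simplePoleFun` to the real line. -/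
noncomputable def simplePoleFunReal {g : ℕ} (c : Fin g → ℝ) (a b : ℝ) (e : Fin g → ℝ) (x : ℝ) : ℝ :=
  a * x + b + ∑ k, e k / (c k - x)

theorem simplePoleFun_ofReal {g : ℕ} (c : Fin g → ℝ) (a b : ℝ) (e : Fin g → ℝ) (x : ℝ) :
    simplePoleFun c a b e x = (simplePoleFunReal c a b e x : ℝ) := by
  simp [simplePoleFun, simplePoleFunReal]

theorem continuousAt_simplePoleFunReal {g : ℕ} {c : Fin g → ℝ} (a b : ℝ) (e : Fin g → ℝ) {x : ℝ}
    (hx : ∀ k, c k ≠ x) : ContinuousAt (simplePoleFunReal c a b e) x := by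
  unfold simplePoleFunReal
  refine ContinuousAt.add (by fun_prop) (tendsto_finsetSum _ fun k _ => ?_)
  exact ContinuousAt.div (by fun_prop) (by fun_prop) (sub_ne_zero.mpr (hx k))

/-- With positive coefficients, the function increases on every interval without poles. -/
theorem simplePoleFunReal_lt {g : ℕ} {c : Fin g → ℝ} {a : ℝ} (b : ℝ) {e : Fin g → ℝ} (ha : 0 < a)
    (he : ∀ k, 0 < e k) {x y : ℝ} (hxy : x < y) (hc : ∀ k, c k ∉ Set.Icc x y) :
    simplePoleFunReal c a b e x < simplePoleFunReal c a b e y := by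
  unfold simplePoleFunReal
  refine add_lt_add_of_lt_of_le (by nlinarith) (Finset.sum_le_sum fun k _ => ?_)
  have hk : c k < x ∨ y < c k := by
    by_contra! hh
    exact hc k hh
  rcases hk with hk | hk
  · rw [← neg_le_neg_iff, ← div_neg, ← div_neg]
    exact div_le_div_of_nonneg_left (he k).le (by linarith) (by linarith)
  · exact div_le_div_of_nonneg_left (he k).le (by linarith) (by linarith)

open Polynomial in
/-- The coefficients are determined by the values at more than `g + 1` points. -/
theorem simplePoleFunReal_eq_zero {g : ℕ} {c : Fin g → ℝ} (hc : Function.Injective c) {a b : ℝ}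
    {e : Fin g → ℝ} {s : Finset ℝ} (hs : g + 1 < s.card) (hcs : ∀ x ∈ s, ∀ k, c k ≠ x)
    (h0 : ∀ x ∈ s, simplePoleFunReal c a b e x = 0) : a = 0 ∧ b = 0 ∧ ∀ k, e k = 0 := by
  set D : ℝ[X] := ∏ k, (C (c k) - X) with hD
  set P : ℝ[X] := (C a * X + C b) * D +
    ∑ k, C (e k) * ∏ j ∈ Finset.univ.erase k, (C (c j) - X) with hP
  have hlin : ∀ k, (C (c k) - X : ℝ[X]).natDegree ≤ 1 := fun k =>
    (natDegree_sub_le _ _).trans (by simp)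
  have hprod : ∀ t : Finset (Fin g), (∏ k ∈ t, (C (c k) - X : ℝ[X])).natDegree ≤ g := fun t =>
    (natDegree_prod_le _ _).trans <| (Finset.sum_le_sum fun k _ => hlin k).trans <| by
      simpa using Finset.card_le_univ t
  have hdeg : P.natDegree ≤ g + 1 := by
    refine natDegree_add_le_of_degree_le ?_ ?_
    · refine natDegree_mul_le.trans ?_
      have := natDegree_linear_le (a := a) (b := b)
      have := hprod Finset.univ
      rw [← hD] at this
      omega
    · refine natDegree_sum_le_of_forall_le _ _ fun k _ => ?_
      exact (natDegree_C_mul_le _ _).trans ((hprod _).trans (Nat.le_succ g))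
  have hP0 : P = 0 := by
    refine eq_zero_of_natDegree_lt_card_of_eval_eq_zero' P s (fun x hx => ?_) (by omega)
    have hne : ∀ k, c k - x ≠ 0 := fun k => sub_ne_zero.mpr (hcs x hx k)
    have h1 := h0 x hx
    rw [simplePoleFunReal] at h1
    have h2 : P.eval x = (a * x + b + ∑ k, e k / (c k - x)) * ∏ k, (c k - x) := by
      rw [hP, hD, add_mul _ (∑ k, _), Finset.sum_mul]
      simp only [eval_add, eval_mul, eval_C, eval_X, eval_prod, eval_sub, eval_finsetSum]
      congr 1
      refine Finset.sum_congr rfl fun k _ => ?_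
      rw [← Finset.mul_prod_erase Finset.univ (fun j => c j - x) (Finset.mem_univ k), ← mul_assoc,
        div_mul_cancel₀ _ (hne k)]
    rw [h2, h1, zero_mul]
  have he : ∀ k, e k = 0 := by
    intro k
    have h1 := congrArg (eval (c k)) hP0
    rw [hP, hD] at h1
    simp only [eval_add, eval_mul, eval_C, eval_X, eval_prod, eval_sub, eval_finsetSum,
      eval_zero] at h1
    rw [Finset.prod_eq_zero (Finset.mem_univ k) (sub_self _), mul_zero, zero_add,
      Finset.sum_eq_single k _ (by simp)] at h1
    · refine (mul_eq_zero.mp h1).resolve_right (Finset.prod_ne_zero_iff.mpr fun j hj => ?_)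
      exact sub_ne_zero.mpr (hc.ne (Finset.ne_of_mem_erase hj))
    · intro j _ hj
      rw [Finset.prod_eq_zero (Finset.mem_erase.mpr ⟨hj.symm, Finset.mem_univ k⟩) (sub_self _),
        mul_zero]
  have hDne : D ≠ 0 := Finset.prod_ne_zero_iff.mpr fun k _ hk => by
    have := congrArg (fun f : ℝ[X] => f.coeff 1) hk
    simp at this
  rw [hP, Finset.sum_eq_zero (fun k _ => by rw [he k, C_0, zero_mul]), add_zero] at hP0
  have hl := (mul_eq_zero.mp hP0).resolve_right hDne
  refine ⟨?_, ?_, he⟩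
  · simpa using congrArg (fun f : ℝ[X] => f.coeff 1) hl
  · simpa using congrArg (fun f : ℝ[X] => f.coeff 0) hl

theorem simplePoleFunReal_sub {g : ℕ} (c : Fin g → ℝ) (a b a' b' : ℝ) (e e' : Fin g → ℝ) (x : ℝ) :
    simplePoleFunReal c (a - a') (b - b') (fun k => e k - e' k) x =
      simplePoleFunReal c a b e x - simplePoleFunReal c a' b' e' x := by
  simp only [simplePoleFunReal, sub_div, Finset.sum_sub_distrib]
  ring

theorem exists_norm_eq_one_add_inv {t : ℝ} (h1 : -2 ≤ t) (h2 : t ≤ 2) :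
    ∃ w : ℂ, ‖w‖ = 1 ∧ (t : ℂ) = w + w⁻¹ := by
  refine ⟨Complex.exp (Real.arccos (t / 2) * Complex.I), Complex.norm_exp_ofReal_mul_I _, ?_⟩
  have h3 := Real.cos_arccos (x := t / 2) (by linarith) (by linarith)
  have h4 : (t : ℂ) = 2 * Complex.cos (Real.arccos (t / 2)) := by
    rw [← Complex.ofReal_cos, h3]
    push_cast
    ring
  rw [h4, ← Complex.exp_neg, ← neg_mul, Complex.two_cos]

/-! ### Rational functions with prescribed band edges -/

namespace IsBandSystem

variable {g : ℕ} {l r : Fin (g + 1) → ℝ}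

theorem eventually_lt_left_notMem (h : IsBandSystem l r) (j : Fin (g + 1)) :
    ∀ᶠ x in 𝓝[<] l j, x ∉ bandUnion l r := by
  have h1 : ∀ᶠ x in 𝓝[<] l j, ∀ i, i < j → r i < x := by
    rw [eventually_all]
    intro i
    by_cases hij : i < j
    · filter_upwards [nhdsWithin_le_nhds (eventually_gt_nhds (h.sep i j hij))] with x hx _ using hx
    · exact Eventually.of_forall fun x hh => absurd hh hij
  filter_upwards [h1, self_mem_nhdsWithin] with x hx hxl hmem
  obtain ⟨i, hi1, hi2⟩ := Set.mem_iUnion.mp hmem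
  have hxl : x < l j := hxl
  rcases lt_trichotomy i j with hij | rfl | hij
  · exact absurd (hx i hij) (not_lt.mpr hi2)
  · linarith
  · linarith [h.sep j i hij, h.lt j]

theorem eventually_gt_right_notMem (h : IsBandSystem l r) (j : Fin (g + 1)) :
    ∀ᶠ x in 𝓝[>] r j, x ∉ bandUnion l r := by
  have h1 : ∀ᶠ x in 𝓝[>] r j, ∀ i, j < i → x < l i := by
    rw [eventually_all]
    intro i
    by_cases hij : j < i
    · filter_upwards [nhdsWithin_le_nhds (eventually_lt_nhds (h.sep j i hij))] with x hx _ using hx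
    · exact Eventually.of_forall fun x hh => absurd hh hij
  filter_upwards [h1, self_mem_nhdsWithin] with x hx hxr hmem
  obtain ⟨i, hi1, hi2⟩ := Set.mem_iUnion.mp hmem
  have hxr : r j < x := hxr
  rcases lt_trichotomy j i with hij | rfl | hij
  · exact absurd (hx i hij) (not_lt.mpr hi1)
  · linarith
  · linarith [h.sep i j hij, h.lt j]

/-- The left and right ends of the bands are `2 g + 2` different points. -/
theorem card_ends (h : IsBandSystem l r) :
    g + 1 < (Finset.univ.image l ∪ Finset.univ.image r).card := by
  rw [Finset.card_union_of_disjoint, Finset.card_image_of_injective _ h.injective_left,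
    Finset.card_image_of_injective _ h.injective_right, Finset.card_univ, Fintype.card_fin]
  · omega
  · rw [Finset.disjoint_left]
    intro x hx hx'
    obtain ⟨i, -, rfl⟩ := Finset.mem_image.mp hx
    obtain ⟨j, -, hj⟩ := Finset.mem_image.mp hx'
    rcases lt_trichotomy i j with hij | rfl | hij
    · linarith [h.sep i j hij, h.lt i, h.lt j]
    · linarith [h.lt i]
    · linarith [h.sep j i hij]

/-- A function whose preimage of `[-2, 2]` is the union of the bands, and which increases on
each of them, takes the values `-2` and `2` at the ends of the bands. -/
theorem values_at_ends (h : IsBandSystem l r) {c : Fin g → ℝ} (hcE : ∀ k, c k ∉ bandUnion l r)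
    {a b : ℝ} {e : Fin g → ℝ} (ha : 0 < a) (he : ∀ k, 0 < e k)
    (hmem : ∀ x : ℝ, (∀ k, c k ≠ x) → (x ∈ bandUnion l r ↔
      simplePoleFunReal c a b e x ∈ Set.Icc (-2) 2)) (j : Fin (g + 1)) :
    simplePoleFunReal c a b e (l j) = -2 ∧ simplePoleFunReal c a b e (r j) = 2 := by
  have hne : ∀ x ∈ bandUnion l r, ∀ k, c k ≠ x := fun x hx k hk => hcE k (hk ▸ hx)
  have hl := hne _ (h.left_mem j)
  have hr := hne _ (h.right_mem j)
  have hlI := (hmem _ hl).mp (h.left_mem j)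
  have hrI := (hmem _ hr).mp (h.right_mem j)
  have hlt : simplePoleFunReal c a b e (l j) < simplePoleFunReal c a b e (r j) :=
    simplePoleFunReal_lt b ha he (h.lt j) fun k hk => hcE k (Set.mem_iUnion.mpr ⟨j, hk⟩)
  -- at an interior value, nearby points off the bands would be mapped to `[-2, 2]`
  have key : ∀ (x : ℝ) (f : Filter ℝ) [f.NeBot], f ≤ 𝓝 x → (∀ᶠ y in f, y ∉ bandUnion l r) →
      (∀ k, c k ≠ x) → ¬(-2 < simplePoleFunReal c a b e x ∧ simplePoleFunReal c a b e x < 2) := by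
    rintro x f _ hf hout hx ⟨h1, h2⟩
    have hcont := continuousAt_simplePoleFunReal a b e hx
    have h3 : ∀ᶠ y in 𝓝 x, ∀ k, c k ≠ y :=
      eventually_all.mpr fun k => (isOpen_ne.eventually_mem (hx k).symm).mono fun y hy => hy.symm
    obtain ⟨y, hy1, hy2, hy3, hy4⟩ := (hout.and ((h3.filter_mono hf).and
      (((hcont.eventually_const_lt h1).filter_mono hf).and
        ((hcont.eventually_lt_const h2).filter_mono hf)))).exists
    exact hy1 ((hmem y hy2).mpr ⟨hy3.le, hy4.le⟩)
  have hkl := key _ _ nhdsWithin_le_nhds (h.eventually_lt_left_notMem j) hl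
  have hkr := key _ _ nhdsWithin_le_nhds (h.eventually_gt_right_notMem j) hr
  constructor
  · by_contra hh
    exact hkl ⟨lt_of_le_of_ne hlI.1 (Ne.symm hh), hlt.trans_le hrI.2⟩
  · by_contra hh
    exact hkr ⟨hlI.1.trans_lt hlt, lt_of_le_of_ne hrI.2 hh⟩

end IsBandSystem

/-- `F` has poles at the points of `c` and takes the value `-2` at the left and the value `2` at the
right ends of the bands, and nowhere else off `c`; `a` is the leading coefficient at infinity. -/
structure IsBandDiscriminant {g : ℕ} (l r : Fin (g + 1) → ℝ) (c : Fin g → ℝ) (a : ℝ) (F : ℂ → ℂ) :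
    Prop where
  sub_two : ∀ z : ℂ, (∀ k, z ≠ c k) →
    F z - 2 = a * ((∏ i, (z - (r i : ℂ))) / ∏ k, (z - (c k : ℂ)))
  add_two : ∀ z : ℂ, (∀ k, z ≠ c k) →
    F z + 2 = a * ((∏ i, (z - (l i : ℂ))) / ∏ k, (z - (c k : ℂ)))

namespace IsBandDiscriminant

variable {g : ℕ} {l r : Fin (g + 1) → ℝ} {c : Fin g → ℝ} {a : ℝ} {F : ℂ → ℂ}

theorem mem_bandUnion (hF : IsBandDiscriminant l r c a F) (h : IsBandSystem l r) (ha : a ≠ 0) {z : ℂ}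
    (hz : ∀ k, z ≠ c k) {t : ℝ} (h1 : -2 ≤ t) (h2 : t ≤ 2) (hFz : F z = t) :
    z ∈ toComplexSet (bandUnion l r) := by
  by_contra hzE
  have hD : (∏ k, (z - (c k : ℂ))) ≠ 0 :=
    Finset.prod_ne_zero_iff.mpr fun k _ => sub_ne_zero.mpr (hz k)
  have haC : (a : ℂ) ≠ 0 := by exact_mod_cast ha
  have hR := h.prod_ne_zero_right hzE
  have h3 : bandRatio l r z = (((t + 2) / (t - 2) : ℝ) : ℂ) := by
    push_cast
    rw [← hFz, hF.sub_two z hz, hF.add_two z hz, bandRatio]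
    field_simp
  have h4 := h.bandRatio_mem_slitPlane hzE
  rw [h3, Complex.ofReal_mem_slitPlane] at h4
  exact not_le.mpr h4 (div_nonpos_of_nonneg_of_nonpos (by linarith) (by linarith))

theorem mem_Icc (hF : IsBandDiscriminant l r c a F) (h : IsBandSystem l r) {x : ℝ}
    (hx : x ∈ bandUnion l r) (hxc : ∀ k, c k ≠ x) {t : ℝ} (hFx : F x = t) : t ∈ Set.Icc (-2) 2 := by
  have hxC : ∀ k, (x : ℂ) ≠ c k := fun k hk => hxc k (by exact_mod_cast hk.symm)
  have h1 := hF.sub_two x hxC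
  have h2 := hF.add_two x hxC
  rw [hFx] at h1 h2
  have h1' : t - 2 = a * ((∏ i, (x - r i)) / ∏ k, (x - c k)) := by exact_mod_cast h1
  have h2' : t + 2 = a * ((∏ i, (x - l i)) / ∏ k, (x - c k)) := by exact_mod_cast h2
  have h3 : (t - 2) * (t + 2) =
      (a / ∏ k, (x - c k)) ^ 2 * ((∏ i, (x - l i)) * ∏ i, (x - r i)) := by
    rw [h1', h2']
    ring
  have h4 := mul_nonpos_of_nonneg_of_nonpos (sq_nonneg (a / ∏ k, (x - c k))) (h.prod_nonpos hx)
  rw [← h3] at h4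
  constructor <;> nlinarith

theorem apply_left (hF : IsBandDiscriminant l r c a F) {j : Fin (g + 1)} (hj : ∀ k, c k ≠ l j) :
    F (l j) = -2 := by
  have := hF.add_two (l j) fun k hk => hj k (by exact_mod_cast hk.symm)
  rw [Finset.prod_eq_zero (Finset.mem_univ j) (sub_self _), zero_div, mul_zero] at this
  exact eq_neg_of_add_eq_zero_left this

theorem apply_right (hF : IsBandDiscriminant l r c a F) {j : Fin (g + 1)} (hj : ∀ k, c k ≠ r j) :
    F (r j) = 2 := by
  have := hF.sub_two (r j) fun k hk => hj k (by exact_mod_cast hk.symm)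
  rw [Finset.prod_eq_zero (Finset.mem_univ j) (sub_self _), zero_div, mul_zero] at this
  exact sub_eq_zero.mp this

end IsBandDiscriminant

/-! ### The isospectral torus -/

namespace IsPeriodicWith

variable {g : ℕ} {c : Fin g → ℝ} {p q : Fin (g + 1) → ℝ} {A : EllTwo →L[ℂ] EllTwo}

/-- The spectrum is the preimage of `[-2, 2]` under the discriminant. -/
theorem mem_spectrum_iff (h : IsPeriodicWith c p q A) (hc : Function.Injective c)
    (hA : IsGMP c A) {z : ℂ} (hz : ∀ k, z ≠ c k) :
    z ∈ spectrum ℂ A ↔ ∃ t : ℝ, -2 ≤ t ∧ t ≤ 2 ∧ discr c p q z = t := by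
  refine ⟨h.discr_of_mem_spectrum hc hA, ?_⟩
  rintro ⟨t, h1, h2, ht⟩
  obtain ⟨w, hw, htw⟩ := exists_norm_eq_one_add_inv h1 h2
  exact h.mem_spectrum_of_discr hc hz hw (ht.trans htw)

/-- The spectrum determines the discriminant and is determined by it. -/
theorem spectrum_eq_iff (h : IsPeriodicWith c p q A) (hc : Function.Injective c) (hA : IsGMP c A)
    {l r : Fin (g + 1) → ℝ} (hlr : IsBandSystem l r) (hcE : ∀ k, c k ∉ bandUnion l r)
    {a b : ℝ} {e : Fin g → ℝ} (ha : 0 < a)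
    (hF : IsBandDiscriminant l r c a (simplePoleFun c a b e)) :
    spectrum ℂ A = toComplexSet (bandUnion l r) ↔
      1 / p (Fin.last g) = a ∧ discrConst p q = b ∧ ∀ k, Lam c p q k = e k := by
  have hne : ∀ x ∈ bandUnion l r, ∀ k, c k ≠ x := fun x hx k hk => hcE k (hk ▸ hx)
  constructor
  · intro hspec
    have hmem : ∀ x : ℝ, (∀ k, c k ≠ x) → (x ∈ bandUnion l r ↔
        simplePoleFunReal c (1 / p (Fin.last g)) (discrConst p q) (Lam c p q) x ∈
          Set.Icc (-2) 2) := by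
      intro x hx
      have h1 : x ∈ bandUnion l r ↔ (x : ℂ) ∈ spectrum ℂ A := by
        rw [hspec]
        exact (Complex.ofReal_injective.mem_set_image).symm
      rw [h1, h.mem_spectrum_iff hc hA fun k hk => hx k (by exact_mod_cast hk.symm), discr,
        simplePoleFun_ofReal]
      constructor
      · rintro ⟨t, h2, h3, h4⟩
        rw [Complex.ofReal_inj] at h4
        exact h4 ▸ ⟨h2, h3⟩
      · rintro ⟨h2, h3⟩
        exact ⟨_, h2, h3, rfl⟩
    have hends := hlr.values_at_ends hcE (one_div_pos.mpr h.last_pos) (h.Lam_pos hc hA) hmem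
    have hl : ∀ j, simplePoleFunReal c a b e (l j) = -2 := by
      intro j
      have := hF.apply_left (hne _ (hlr.left_mem j))
      rw [simplePoleFun_ofReal] at this
      exact_mod_cast this
    have hr : ∀ j, simplePoleFunReal c a b e (r j) = 2 := by
      intro j
      have := hF.apply_right (hne _ (hlr.right_mem j))
      rw [simplePoleFun_ofReal] at this
      exact_mod_cast this
    obtain ⟨h1, h2, h3⟩ := simplePoleFunReal_eq_zero hc (a := 1 / p (Fin.last g) - a)
      (b := discrConst p q - b) (e := fun k => Lam c p q k - e k) hlr.card_ends (by
        intro x hx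
        rcases Finset.mem_union.mp hx with hx | hx <;> obtain ⟨j, -, rfl⟩ := Finset.mem_image.mp hx
        · exact hne _ (hlr.left_mem j)
        · exact hne _ (hlr.right_mem j)) (by
        intro x hx
        rw [simplePoleFunReal_sub]
        rcases Finset.mem_union.mp hx with hx | hx <;> obtain ⟨j, -, rfl⟩ := Finset.mem_image.mp hx
        · rw [(hends j).1, hl, sub_self]
        · rw [(hends j).2, hr, sub_self])
    exact ⟨sub_eq_zero.mp h1, sub_eq_zero.mp h2, fun k => sub_eq_zero.mp (h3 k)⟩
  · rintro ⟨h1, h2, h3⟩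
    have hd : discr c p q = simplePoleFun c a b e := by
      rw [discr, h1, h2, funext h3]
    ext z
    constructor
    · intro hz
      have hzc := ne_of_mem_spectrum hA hz
      obtain ⟨t, h4, h5, h6⟩ := h.discr_of_mem_spectrum hc hA hz
      exact hF.mem_bandUnion hlr ha.ne' hzc h4 h5 (hd ▸ h6)
    · rintro ⟨x, hx, rfl⟩
      have hxc := hne x hx
      have hI := hF.mem_Icc hlr hx hxc (simplePoleFun_ofReal c a b e x)
      refine (h.mem_spectrum_iff hc hA fun k hk => hxc k (Complex.ofReal_injective hk.symm)).mpr
        ⟨_, hI.1, hI.2, ?_⟩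
      rw [hd, simplePoleFun_ofReal]

end IsPeriodicWith

end

theorem theorem5 (g : ℕ) (E : Set ℝ) (hE : IsFiniteGapSet g E)
    (Ψ : ℂ → ℂ) (hΨ : IsAhlforsFunction (toComplexSet E) Ψ)
    (c : Fin g → ℝ) (hc : Function.Injective c)
    (hzeros : {z : ℂ | z ∉ toComplexSet E ∧ Ψ z = 0} = toComplexSet (Set.range c)) :
    ∃ (lam0 c0 : ℝ) (lam : Fin g → ℝ),
      (0 < lam0 ∧ (∀ k, 0 < lam k) ∧
        ∀ z : ℂ, z ∉ toComplexSet E → Ψ z ≠ 0 →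
          Ψ z + 1 / Ψ z = lam0 * z + c0 + ∑ k : Fin g, (lam k : ℂ) / ((c k : ℂ) - z)) ∧
      ∀ (A : EllTwo →L[ℂ] EllTwo) (p q : Fin (g + 1) → ℝ),
        IsGMP c A → IsPeriodicWith c p q A →
        (A ∈ isospectralTorus E c ↔
          p (Fin.last g) = 1 / lam0 ∧
          q (Fin.last g) = -c0 - lam0 * ∑ j : Fin g, p j.castSucc * q j.castSucc ∧
          ∀ k : Fin g, Lam c p q k = lam k) := by
  obtain ⟨l, r, hlr, rfl⟩ := hE.exists_isBandSystem
  have hck : ∀ k, (c k : ℂ) ∉ toComplexSet (bandUnion l r) ∧ Ψ (c k) = 0 := fun k =>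
    hzeros.ge ⟨c k, ⟨k, rfl⟩, rfl⟩
  have hcE : ∀ k, c k ∉ bandUnion l r := fun k hk => (hck k).1 ⟨c k, hk, rfl⟩
  obtain ⟨lam0, c0, lam, h0, hlam, hF, hΨeq⟩ :=
    exists_ahlfors_simplePoleFun hlr hΨ hc hcE fun k => (hck k).2
  refine ⟨lam0, c0, lam, ⟨h0, hlam, hΨeq⟩, fun A p q hA h => ?_⟩
  have hmem : A ∈ isospectralTorus (bandUnion l r) c ↔
      spectrum ℂ A = toComplexSet (bandUnion l r) :=
    ⟨fun hh => hh.2.1, fun hh => ⟨hA, hh, p, q, h⟩⟩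
  rw [hmem, h.spectrum_eq_iff hc hA hlr hcE h0
    ⟨fun z hz => (hF z hz).1, fun z hz => (hF z hz).2⟩, discrConst]
  have hp := h.last_pos.ne'
  have e1 : 1 / p (Fin.last g) = lam0 ↔ p (Fin.last g) = 1 / lam0 := by
    rw [div_eq_iff hp, eq_div_iff h0.ne', mul_comm, eq_comm]
  rw [← e1]
  refine and_congr_right fun hp0 => and_congr_left' ?_
  rw [hp0]
  constructor <;> intro hh <;> linarith
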